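/- Let $d\ge 1$, $\omega,\gamma,\lambda>0$, $\nu^2=\gamma^2/\omega^2$ and $T_L,T_R\ge 0$. For $N\ge 2$ and $L_1,\dots,L_{d-1}\ge 1$ consider oscillators at the sites $x=(i,j)$, $i\in\{1,\dots,N\}$, $j\in\prod_{a=1}^{d-1}\mathbb Z/L_a\mathbb Z$, with phase-space vector $X=(q,p)$. Let $\Phi=\omega^2(-\Delta+\nu^2 I)$, where $\Delta$ is the discrete Laplacian with Dirichlet boundary conditions in the first direction and periodic boundary conditions in the other $d-1$ directions. For heat-bath temperatures $T=(T_x)$, $T_x\ge 0$, the dynamics is the Ornstein–Uhlenbeck process $$dX=-AX\,dt+\Sigma\,dW,\qquad A=\begin{pmatrix}0&-I\\ \Phi&\lambda I\end{pmatrix},\qquad \Sigma=\begin{pmatrix}0&0\\0&\sqrt{2\lambda\,\mathrm{diag}(T)}\end{pmatrix}.$$ Put $R_x=\lambda(T_x-p_x^2)$, and for a bond from $x$ to a neighbour $y$ let $J_{x\to y}=-\frac{\omega^2}{2}(q_y-q_x)(p_x+p_y)$ be the energy current. Then: 1. For every $T\ge0$ the dynamics has exactly one stationary probability measure, namely the centred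 Gaussian measure $\langle\cdot\rangle_{S}$ with covariance $S=\int_0^\infty e^{-sA}\Sigma^2e^{-sA^{T}}ds$. 2. For all $N\ge2$ and $L_a\ge1$ there is exactly one self-consistent profile, i.e. one $T\ge 0$ with $T_{(1,j)}=T_L$ and $T_{(N,j)}=T_R$ for all $j$, and $\langle R_{(i,j)}\rangle_S=0$ for all $1<i<N$ and all $j$. It satisfies $\min(T_L,T_R)\le T_x\le\max(T_L,T_R)$ and $T_{(i,j)}=T_{(i,j')}$ for all $j,j'$. In its stationary state the mean current through every bond in a periodic direction is zero, and the mean current $\langle J_{(i,j)\to(i+1,j)}\rangle_S$ has the same value $J^{(N,L)}$ for all $1\le i<N$ and all $j$. 3. In the joint limit $N,L_1,\dots,L_{d-1}\to\infty$ the self-consistent profile $T$ and its stationary state satisfy: (a) $T_{(i,j)}-\bigl(T_L+\tfrac{i-1}{N-1}(T_R-T_L)\bigr)\to0$ uniformly in $(i,j)$; (b) (local equilibrium) let $\langle\cdot\rangle_{\mathrm{eq},\theta}$ be the Gibbs state at temperature $\theta$, the centred Gaussian measure with covariance $\theta\begin{pmatrix}\Phi^{-1}&0\\0&I\end{pmatrix}$.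 For any two phase-space coordinates $X_b,X_c$ at sites $x_b,x_c$, $\langle X_bX_c\rangle_S-\langle X_bX_c\rangle_{\mathrm{eq},T_{x_b}}\to0$, uniformly in $b,c$. For every fixed $m$ and $R$, $\langle X_{c_1}\cdots X_{c_m}\rangle_S-\langle X_{c_1}\cdots X_{c_m}\rangle_{\mathrm{eq},\theta}\to0$ uniformly over all sites $x=(i,j)$ and all phase-space coordinates $X_{c_1},\dots,X_{c_m}$ at sites whose first index differs from $i$ by at most $R$, both for $\theta=T_x$ and for $\theta=T_L+\frac{i-1}{N-1}(T_R-T_L)$; (c) (Fourier's law) $(N-1)\,J^{(N,L)}\to\kappa\,(T_L-T_R)$ with $$\kappa=\frac{\omega^2}{\lambda}\int_{[0,1]^{d-1}}\frac{dy}{2+\tilde\nu(y)^2+\sqrt{\tilde\nu(y)^2(4+\tilde\nu(y)^2)}},\qquad \tilde\nu(y)^2=\nu^2+2\sum_{a=1}^{d-1}(1-\cos 2\pi y_a).$$ -/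

import Mathlib

open MeasureTheory ProbabilityTheory

noncomputable section

namespace Crystal

/-- Sites of the crystal: `N` layers in the first direction, and a discrete torus with side
lengths `L a` in the remaining `n` directions. The layer called `i` with `i = 1, …, N` in the
usual numbering is the element of `Fin N` with value `i - 1`. -/
abbrev Site (N : ℕ) {n : ℕ} (L : Fin n → ℕ) : Type :=
  Fin N × ((a : Fin n) → ZMod (L a))

variable {N n : ℕ} {L : Fin n → ℕ}

/-- Index set of the phase space coordinates: `Sum.inl x` is the position `q_x` and
`Sum.inr x` is the momentum `p_x`. -/
abbrev Coord (N : ℕ) {n : ℕ} (L : Fin n → ℕ) : Type := Site N L ⊕ Site N L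

/-- The site of a phase space coordinate. -/
def siteOf (c : Coord N L) : Site N L := Sum.elim id id c

/-- The neighbour of `x` in the positive `a`-th periodic direction. -/
def shift (a : Fin n) (x : Site N L) : Site N L := (x.1, x.2 + Pi.single a 1)

/-- The discrete Laplacian, with Dirichlet boundary conditions in the first direction and
periodic boundary conditions in the other ones. -/
def laplacian (N : ℕ) (L : Fin n → ℕ) : Matrix (Site N L) (Site N L) ℝ :=
  Matrix.of fun x y =>
    (if x.2 = y.2 then
      (if (y.1 : ℕ) = (x.1 : ℕ) + 1 then 1 else 0) + (if (x.1 : ℕ) = (y.1 : ℕ) + 1 then 1 else 0)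
        - 2 * (if x.1 = y.1 then 1 else 0)
      else 0)
    + ∑ a : Fin n,
        ((if y = shift a x then 1 else 0) + (if x = shift a y then 1 else 0)
          - 2 * (if x = y then 1 else 0))

/-- The matrix `Φ = ω² (-Δ + ν²)` with `ν² = γ²/ω²`. -/
def potential (ω γ : ℝ) (N : ℕ) (L : Fin n → ℕ) : Matrix (Site N L) (Site N L) ℝ :=
  ω ^ 2 • (-(laplacian N L) + (γ ^ 2 / ω ^ 2) • (1 : Matrix (Site N L) (Site N L) ℝ))

/-- The drift matrix `A` of the dynamics `dX = -A X dt + Σ dW`. -/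
def drift (ω γ lam : ℝ) (N : ℕ) (L : Fin n → ℕ) : Matrix (Coord N L) (Coord N L) ℝ :=
  Matrix.fromBlocks 0 (-1) (potential ω γ N L) (lam • (1 : Matrix (Site N L) (Site N L) ℝ))

/-- The noise matrix `Σ` of the dynamics, for the heat bath temperatures `T`. -/
def noise (lam : ℝ) (T : Site N L → ℝ) : Matrix (Coord N L) (Coord N L) ℝ :=
  Matrix.fromBlocks 0 0 0 (Matrix.diagonal fun x => Real.sqrt (2 * lam * T x))

section Dynamics

variable [∀ a, NeZero (L a)]

/-- The propagator `exp (-t A)`. -/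
def propagator (ω γ lam : ℝ) (N : ℕ) (L : Fin n → ℕ) [∀ a, NeZero (L a)] (t : ℝ) :
    Matrix (Coord N L) (Coord N L) ℝ :=
  NormedSpace.exp (-(t • drift ω γ lam N L))

/-- The matrix `exp (-s A) Σ Σᵀ exp (-s Aᵀ)`. -/
def noiseAt (ω γ lam : ℝ) (T : Site N L → ℝ) (s : ℝ) : Matrix (Coord N L) (Coord N L) ℝ :=
  propagator ω γ lam N L s * (noise lam T * (noise lam T).transpose)
    * (propagator ω γ lam N L s).transpose

/-- The covariance `∫₀ᵗ exp (-s A) Σ Σᵀ exp (-s Aᵀ) ds` of the stochastic integral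
`∫₀ᵗ exp (-(t-s) A) Σ dW(s)`. -/
def noiseCov (ω γ lam : ℝ) (T : Site N L → ℝ) (t : ℝ) : Matrix (Coord N L) (Coord N L) ℝ :=
  Matrix.of fun a b => ∫ s in (0 : ℝ)..t, noiseAt ω γ lam T s a b

/-- The law at time `t` of the solution
`X(t) = exp (-t A) X(0) + ∫₀ᵗ exp (-(t-s) A) Σ dW(s)` of the Ornstein-Uhlenbeck equation
`dX = -A X dt + Σ dW`, when `X(0)` has law `μ` and is independent of the noise. -/
def lawAt (ω γ lam : ℝ) (T : Site N L → ℝ) (μ : Measure (EuclideanSpace ℝ (Coord N L)))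
    (t : ℝ) : Measure (EuclideanSpace ℝ (Coord N L)) :=
  (μ.map (Matrix.toEuclideanCLM (𝕜 := ℝ) (propagator ω γ lam N L t)))
    ∗ multivariateGaussian 0 (noiseCov ω γ lam T t)

/-- Stationary states of the dynamics. -/
def IsStationary (ω γ lam : ℝ) (T : Site N L → ℝ)
    (μ : Measure (EuclideanSpace ℝ (Coord N L))) : Prop :=
  IsProbabilityMeasure μ ∧ ∀ t : ℝ, 0 ≤ t → lawAt ω γ lam T μ t = μ

/-- The matrix `S = ∫₀^∞ exp (-s A) Σ Σᵀ exp (-s Aᵀ) ds`. -/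
def steadyCov (ω γ lam : ℝ) (T : Site N L → ℝ) : Matrix (Coord N L) (Coord N L) ℝ :=
  Matrix.of fun a b => ∫ s in Set.Ioi (0 : ℝ), noiseAt ω γ lam T s a b

/-- The steady state `⟨ · ⟩_S`: the centred Gaussian measure with covariance `S`. -/
def steadyState (ω γ lam : ℝ) (T : Site N L → ℝ) : Measure (EuclideanSpace ℝ (Coord N L)) :=
  multivariateGaussian 0 (steadyCov ω γ lam T)

/-- The equilibrium (Gibbs) state at temperature `θ`: the Gibbs measure of the Hamiltonian
`½ |p|² + ½ q · Φ q`, i.e. the centred Gaussian measure with covariance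
`θ · diag (Φ⁻¹, 1)`. -/
def gibbsState (ω γ : ℝ) (N : ℕ) (L : Fin n → ℕ) [∀ a, NeZero (L a)] (θ : ℝ) :
    Measure (EuclideanSpace ℝ (Coord N L)) :=
  multivariateGaussian 0 (θ • Matrix.fromBlocks (potential ω γ N L)⁻¹ 0 0 1)

/-- The energy current along the bond from `x` to a neighbour `y` of `x`:
`-(ω²/2) (q_y - q_x) (p_x + p_y)`. -/
def current (ω : ℝ) (x y : Site N L) (z : EuclideanSpace ℝ (Coord N L)) : ℝ :=
  -(ω ^ 2 / 2) * (z (Sum.inl y) - z (Sum.inl x)) * (z (Sum.inr x) + z (Sum.inr y))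

/-- The energy flux `R_x = λ (T_x - p_x²)` from the reservoir at `x` into the system. -/
def reservoirFlux (lam : ℝ) (T : Site N L → ℝ) (x : Site N L)
    (z : EuclideanSpace ℝ (Coord N L)) : ℝ :=
  lam * (T x - z (Sum.inr x) ^ 2)

/-- Self-consistent temperature profiles with boundary temperatures `TL` and `TR`: there is no
mean energy flux between the system and any reservoir that is not in the first or last layer. -/
structure IsSelfConsistent (ω γ lam TL TR : ℝ) (T : Site N L → ℝ) : Prop where
  nonneg : ∀ x, 0 ≤ T x
  left : ∀ x : Site N L, (x.1 : ℕ) = 0 → T x = TL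
  right : ∀ x : Site N L, (x.1 : ℕ) + 1 = N → T x = TR
  no_flux : ∀ x : Site N L, 0 < (x.1 : ℕ) → (x.1 : ℕ) + 1 < N →
    ∫ z, reservoirFlux lam T x z ∂(steadyState ω γ lam T) = 0

end Dynamics

/-- The linear profile: `TL + ((i-1)/(N-1)) (TR - TL)` in the layer numbered `i = 1, …, N`. -/
def linearProfile (TL TR : ℝ) (i : Fin N) : ℝ :=
  TL + ((i : ℕ) : ℝ) / ((N : ℝ) - 1) * (TR - TL)

/-- `ν̃(y)² = ν² + 2 ∑ₐ (1 - cos (2 π yₐ))` with `ν² = γ²/ω²`. -/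
def nuSq (ω γ : ℝ) (y : Fin n → ℝ) : ℝ :=
  γ ^ 2 / ω ^ 2 + 2 * ∑ a, (1 - Real.cos (2 * Real.pi * y a))

/-- The thermal conductivity of the crystal with `n` periodic directions. -/
def conductivity (ω γ lam : ℝ) (n : ℕ) : ℝ :=
  ω ^ 2 / lam * ∫ y in Set.Icc (0 : Fin n → ℝ) 1,
    1 / (2 + nuSq ω γ y + Real.sqrt (nuSq ω γ y * (4 + nuSq ω γ y)))

end Crystal

end

/-! The stationary covariance S solves the Lyapunov equation A S + S Aᵀ = Σ². In the blocks U =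
⟨qq⟩, Z = ⟨qp⟩, V = ⟨pp⟩ it says that Z is antisymmetric, V = UΦ + λZ and [Φ, Z] + 2λV = 2λ diag T.
Eliminating U and V leaves λ(ΦZ + ZΦ) + (1/2λ)[Φ, [Φ, Z]] = [Φ, diag T]
(`IsSteadyMoments.transport_eq`). The operator on the left is bounded and coercive for the
Hilbert-Schmidt product, with constants that do not depend on the size of the crystal
(`IsElastic.transport_coercive`, `IsElastic.hs_transport_le`).

Finite systems. The energy identity `IsSteadyMoments.sum_mul_sub` shows that the heat exchange T ↦ T
- diag V has a nonnegative quadratic form, which vanishes only when T is constant along bonds. So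
the self-consistency equations with prescribed boundary values are an injective, hence uniquely
solvable, linear system. Since V_xx is a combination of the temperatures with nonnegative
coefficients, testing with the negative part of T gives the maximum principle
`nonneg_of_exchange_eq_zero`. The reflections j ↦ c - j preserve Φ, so the profile depends on the
layer only. A reflection can swap any two sites of a layer, so the antisymmetric Z vanishes inside
layers. The mean current through a bond is ω² Z_xy, and absence of flux makes it constant
(`IsSelfConsistent.exists_corr_eq`).

Large systems. A constant temperature gradient in the infinite crystal produces an explicit Z: in
the Fourier mode of wave vector y it is proportional to sign(m) r^|m| at layer distance m, where r +
1/r = 2 + ν̃(y)². Restricted to N layers (`corrector`), it solves the transport equation up to an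
error at the two ends, whose squared norm is at most a constant times the number of sites in a
layer, uniformly in N (`hs_transport_response_sub_le`). Choose α such that Y = Z - α w, with w the
normalised corrector, has zero total bond entry between any two consecutive layers. Y is then
orthogonal to every matrix that is supported on the bonds of the first direction with weights
depending on the layer, in particular to [Φ, diag T]. Coercivity bounds Y by the end error times
|α|, and the equation read backwards bounds the fluctuations of the gradient around its mean: Σ
(ω²(T_i - T_{i+1}) - α)² ≤ G α² (`IsSelfConsistent.exists_gradient`). Telescoping with
Cauchy-Schwarz yields α = O(1/N) and a linear profile up to O(N^(-1/2)).

It also follows that the squared norm of Z is O(1/N) per site of a layer. Reflection invariance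
turns this into a bound for each entry (`IsInvariant.sq_apply_le`), and U - diag T Φ⁻¹ and V - diag
T are controlled by Z, which is local equilibrium for pairs. Higher moments follow by polarization
and one-dimensional Gaussian moments (`exists_delta_moments`). The current equals α/(2λ) times the
mean of r over the dual torus, a Riemann sum for the integral defining κ. -/

namespace Crystal

/-! ### Hilbert-Schmidt estimates, the transport operator and the moment equations -/

section HilbertSchmidt

variable {ι : Type*} [Fintype ι]

/-- The Hilbert-Schmidt inner product of real matrices. -/
def hs (A B : Matrix ι ι ℝ) : ℝ := ∑ x, ∑ y, A x y * B x y

lemma hs_comm (A B : Matrix ι ι ℝ) : hs A B = hs B A := by simp [hs, mul_comm]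

lemma hs_add_left (A B C : Matrix ι ι ℝ) : hs (A + B) C = hs A C + hs B C := by
  simp [hs, add_mul, Finset.sum_add_distrib]

lemma hs_smul_left (c : ℝ) (A B : Matrix ι ι ℝ) : hs (c • A) B = c * hs A B := by
  simp [hs, mul_assoc, Finset.mul_sum]

lemma hs_sub_left (A B C : Matrix ι ι ℝ) : hs (A - B) C = hs A C - hs B C := by
  simp [hs, sub_mul]

lemma hs_add_right (A B C : Matrix ι ι ℝ) : hs A (B + C) = hs A B + hs A C := by
  rw [hs_comm, hs_add_left, hs_comm B, hs_comm C]

lemma hs_sub_right (A B C : Matrix ι ι ℝ) : hs A (B - C) = hs A B - hs A C := by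
  rw [hs_comm, hs_sub_left, hs_comm B, hs_comm C]

lemma hs_smul_right (c : ℝ) (A B : Matrix ι ι ℝ) : hs A (c • B) = c * hs A B := by
  rw [hs_comm, hs_smul_left, hs_comm]

lemma hs_self_nonneg (A : Matrix ι ι ℝ) : 0 ≤ hs A A :=
  Finset.sum_nonneg fun _ _ => Finset.sum_nonneg fun _ _ => mul_self_nonneg _

lemma hs_self_eq_zero {A : Matrix ι ι ℝ} (h : hs A A = 0) : A = 0 := by
  ext x y
  have h1 := (Finset.sum_eq_zero_iff_of_nonneg
    (fun x _ => Finset.sum_nonneg fun y _ => mul_self_nonneg (A x y))).1 h x (Finset.mem_univ _)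
  have h2 := (Finset.sum_eq_zero_iff_of_nonneg
    (fun y _ => mul_self_nonneg (A x y))).1 h1 y (Finset.mem_univ _)
  simpa using h2

lemma hs_transpose (A B : Matrix ι ι ℝ) : hs A.transpose B.transpose = hs A B := by
  simp only [hs, Matrix.transpose_apply]
  exact Finset.sum_comm

lemma hs_sq_le (A B : Matrix ι ι ℝ) : hs A B ^ 2 ≤ hs A A * hs B B := by
  have h := Finset.sum_mul_sq_le_sq_mul_sq (Finset.univ : Finset (ι × ι))
    (fun p => A p.1 p.2) (fun p => B p.1 p.2)
  simpa [hs, Fintype.sum_prod_type, sq] using h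

lemma hs_self_add_le (A B : Matrix ι ι ℝ) : hs (A + B) (A + B) ≤ 2 * hs A A + 2 * hs B B := by
  have h := hs_self_nonneg (A - B)
  simp only [hs_sub_left, hs_sub_right, hs_add_left, hs_add_right] at *
  linarith

lemma hs_self_sub_le (A B : Matrix ι ι ℝ) : hs (A - B) (A - B) ≤ 2 * hs A A + 2 * hs B B := by
  have h := hs_self_nonneg (A + B)
  simp only [hs_sub_left, hs_sub_right, hs_add_left, hs_add_right] at *
  linarith

lemma hs_mul_left (M A B : Matrix ι ι ℝ) : hs (M * A) B = hs A (M.transpose * B) := by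
  simp only [hs, Matrix.mul_apply, Finset.sum_mul, Finset.mul_sum, Matrix.transpose_apply]
  calc ∑ x, ∑ y, ∑ z, M x z * A z y * B x y = ∑ x, ∑ z, ∑ y, M x z * A z y * B x y :=
        Finset.sum_congr rfl fun x _ => Finset.sum_comm
    _ = ∑ z, ∑ x, ∑ y, M x z * A z y * B x y := Finset.sum_comm
    _ = ∑ z, ∑ y, ∑ x, M x z * A z y * B x y := Finset.sum_congr rfl fun x _ => Finset.sum_comm
    _ = _ := by
        refine Finset.sum_congr rfl fun z _ => Finset.sum_congr rfl fun y _ =>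
          Finset.sum_congr rfl fun x _ => by ring

lemma hs_mul_right (A M B : Matrix ι ι ℝ) : hs (A * M) B = hs A (B * M.transpose) := by
  rw [← hs_transpose, Matrix.transpose_mul, hs_mul_left, ← hs_transpose, Matrix.transpose_mul]
  simp

/-- A symmetric matrix with spectrum in `[g, K]`, `g > 0`. -/
structure IsElastic (Φ : Matrix ι ι ℝ) (g K : ℝ) : Prop where
  pos : 0 < g
  symm : Φ.transpose = Φ
  coercive : ∀ v : ι → ℝ, g * (v ⬝ᵥ v) ≤ v ⬝ᵥ Φ.mulVec v
  bounded : ∀ v : ι → ℝ, Φ.mulVec v ⬝ᵥ Φ.mulVec v ≤ K ^ 2 * (v ⬝ᵥ v)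

variable {Φ : Matrix ι ι ℝ} {g K lam : ℝ}

lemma hs_eq_sum_dotProduct_col (A B : Matrix ι ι ℝ) : hs A B = ∑ y, A.col y ⬝ᵥ B.col y := by
  rw [hs, Finset.sum_comm]; rfl

lemma col_mul_eq (A B : Matrix ι ι ℝ) (y : ι) : (A * B).col y = A.mulVec (B.col y) := by
  ext x; simp [Matrix.mul_apply, Matrix.mulVec, dotProduct, Matrix.col]

namespace IsElastic

lemma hs_left (h : IsElastic Φ g K) (Y : Matrix ι ι ℝ) : g * hs Y Y ≤ hs Y (Φ * Y) := by
  simp only [hs_eq_sum_dotProduct_col, Finset.mul_sum, col_mul_eq]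
  exact Finset.sum_le_sum fun y _ => h.coercive _

lemma hs_right (h : IsElastic Φ g K) (Y : Matrix ι ι ℝ) : g * hs Y Y ≤ hs Y (Y * Φ) := by
  have := h.hs_left Y.transpose
  rw [← hs_transpose Y (Y * Φ), Matrix.transpose_mul, h.symm]
  simpa [hs_transpose] using this

lemma hs_mul_le (h : IsElastic Φ g K) (Y : Matrix ι ι ℝ) :
    hs (Φ * Y) (Φ * Y) ≤ K ^ 2 * hs Y Y := by
  simp only [hs_eq_sum_dotProduct_col, Finset.mul_sum, col_mul_eq]
  exact Finset.sum_le_sum fun y _ => h.bounded _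

lemma hs_mul_le_right (h : IsElastic Φ g K) (Y : Matrix ι ι ℝ) :
    hs (Y * Φ) (Y * Φ) ≤ K ^ 2 * hs Y Y := by
  have := h.hs_mul_le Y.transpose
  rw [← hs_transpose (Y * Φ) (Y * Φ), Matrix.transpose_mul, h.symm]
  simpa [hs_transpose] using this

end IsElastic

/-- The commutator with `Φ`. -/
def comm (Φ Y : Matrix ι ι ℝ) : Matrix ι ι ℝ := Φ * Y - Y * Φ

lemma comm_sub (Φ A B : Matrix ι ι ℝ) : comm Φ (A - B) = comm Φ A - comm Φ B := by
  simp only [comm, mul_sub, sub_mul]; abel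

lemma comm_smul (Φ A : Matrix ι ι ℝ) (c : ℝ) : comm Φ (c • A) = c • comm Φ A := by
  simp [comm, smul_sub]

lemma hs_comm_left (hΦ : Φ.transpose = Φ) (A B : Matrix ι ι ℝ) :
    hs (comm Φ A) B = hs A (comm Φ B) := by
  rw [comm, comm, hs_sub_left, hs_sub_right, hs_mul_left, hs_mul_right, hΦ]

lemma IsElastic.hs_comm_le (h : IsElastic Φ g K) (Y : Matrix ι ι ℝ) :
    hs (comm Φ Y) (comm Φ Y) ≤ 4 * K ^ 2 * hs Y Y := by
  have := hs_self_sub_le (Φ * Y) (Y * Φ)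
  have h1 := h.hs_mul_le Y
  have h2 := h.hs_mul_le_right Y
  rw [comm]
  linarith

/-- The operator which determines the position-momentum correlations of a steady state. -/
noncomputable def transport (Φ : Matrix ι ι ℝ) (lam : ℝ) (Y : Matrix ι ι ℝ) : Matrix ι ι ℝ :=
  lam • (Φ * Y + Y * Φ) + (1 / (2 * lam)) • comm Φ (comm Φ Y)

lemma transport_sub (A B : Matrix ι ι ℝ) :
    transport Φ lam (A - B) = transport Φ lam A - transport Φ lam B := by
  simp only [transport, comm_sub, mul_sub, sub_mul, smul_sub, smul_add]; abel

lemma transport_smul (c : ℝ) (A : Matrix ι ι ℝ) :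
    transport Φ lam (c • A) = c • transport Φ lam A := by
  simp only [transport, comm_smul, Matrix.mul_smul, Matrix.smul_mul, smul_add, smul_comm c]

/-- Commutation with a symmetric Φ is self-adjoint, so the double commutator contributes a square.
The anticommutator alone supplies the lower bound. -/
lemma IsElastic.transport_coercive (h : IsElastic Φ g K) (hlam : 0 < lam) (Y : Matrix ι ι ℝ) :
    2 * lam * g * hs Y Y ≤ hs Y (transport Φ lam Y) := by
  simp only [transport, hs_add_right, hs_smul_right]
  rw [← hs_comm_left h.symm]
  have h1 := mul_le_mul_of_nonneg_left (h.hs_left Y) hlam.le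
  have h2 := mul_le_mul_of_nonneg_left (h.hs_right Y) hlam.le
  have h3 : 0 ≤ 1 / (2 * lam) * hs (comm Φ Y) (comm Φ Y) :=
    mul_nonneg (by positivity) (hs_self_nonneg _)
  linarith

/-- An upper bound for the squared norm of the operator `transport`. -/
noncomputable def transportBound (K lam : ℝ) : ℝ := 8 * lam ^ 2 * K ^ 2 + 8 * K ^ 4 / lam ^ 2

lemma IsElastic.hs_transport_le (h : IsElastic Φ g K) (hlam : 0 < lam) (Y : Matrix ι ι ℝ) :
    hs (transport Φ lam Y) (transport Φ lam Y) ≤ transportBound K lam * hs Y Y := by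
  have h0 := hs_self_add_le (lam • (Φ * Y + Y * Φ)) ((1 / (2 * lam)) • comm Φ (comm Φ Y))
  have h1 := hs_self_add_le (Φ * Y) (Y * Φ)
  have h2 := h.hs_mul_le Y
  have h3 := h.hs_mul_le_right Y
  have h4 := h.hs_comm_le (comm Φ Y)
  have h5 := h.hs_comm_le Y
  have h6 : hs (Φ * Y + Y * Φ) (Φ * Y + Y * Φ) ≤ 4 * K ^ 2 * hs Y Y := by linarith
  have h7 : hs (comm Φ (comm Φ Y)) (comm Φ (comm Φ Y)) ≤ 16 * K ^ 4 * hs Y Y :=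
    h4.trans ((mul_le_mul_of_nonneg_left h5 (by positivity)).trans_eq (by ring))
  rw [transport]
  refine h0.trans ?_
  simp only [hs_smul_left, hs_smul_right]
  have h8 := mul_le_mul_of_nonneg_left h6 (sq_nonneg lam)
  have h9 := mul_le_mul_of_nonneg_left h7 (sq_nonneg (1 / (2 * lam)))
  calc _ = 2 * (lam ^ 2 * hs (Φ * Y + Y * Φ) (Φ * Y + Y * Φ))
        + 2 * ((1 / (2 * lam)) ^ 2 * hs (comm Φ (comm Φ Y)) (comm Φ (comm Φ Y))) := by ring
    _ ≤ 2 * (lam ^ 2 * (4 * K ^ 2 * hs Y Y))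
        + 2 * ((1 / (2 * lam)) ^ 2 * (16 * K ^ 4 * hs Y Y)) := by linarith
    _ = transportBound K lam * hs Y Y := by rw [transportBound]; field_simp; ring

/-- If `Y` solves a coercive equation with right-hand side `R`, then `Y` is bounded by `R`. -/
lemma IsElastic.hs_le_of_hs_transport_le (h : IsElastic Φ g K) (hlam : 0 < lam)
    (Y R : Matrix ι ι ℝ) (hY : hs Y (transport Φ lam Y) ≤ hs Y R) :
    (2 * lam * g) ^ 2 * hs Y Y ≤ hs R R := by
  have h1 := (h.transport_coercive hlam Y).trans hY
  have h2 := hs_sq_le Y R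
  have h3 := hs_self_nonneg Y
  have h4 := hs_self_nonneg R
  have hg := h.pos
  rcases h3.eq_or_lt with h5 | h5
  · rw [← h5]; simpa using h4
  · have h6 : (2 * lam * g * hs Y Y) ^ 2 ≤ hs Y R ^ 2 :=
      pow_le_pow_left₀ (by positivity) h1 2
    have h7 : hs Y Y * ((2 * lam * g) ^ 2 * hs Y Y) ≤ hs Y Y * hs R R := by
      calc _ = (2 * lam * g * hs Y Y) ^ 2 := by ring
        _ ≤ _ := h6.trans h2
    exact le_of_mul_le_mul_left h7 h5

variable [DecidableEq ι]

lemma IsElastic.isUnit_det (h : IsElastic Φ g K) : IsUnit Φ.det := by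
  rw [isUnit_iff_ne_zero]
  intro hdet
  obtain ⟨v, hv, hv0⟩ := Matrix.exists_mulVec_eq_zero_iff.2 hdet
  have h1 := h.coercive v
  rw [hv0, dotProduct_zero] at h1
  have h2 : 0 < v ⬝ᵥ v := by
    have := Matrix.dotProduct_star_self_pos_iff (v := v)
    simpa using this.2 hv
  nlinarith [h.pos]

/-- Coercivity applied to X = YΦ⁻¹ gives g‖X‖² ≤ ⟨X, Y⟩, and Cauchy-Schwarz finishes. -/
lemma IsElastic.hs_mul_inv_le (h : IsElastic Φ g K) (Y : Matrix ι ι ℝ) :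
    g ^ 2 * hs (Y * Φ⁻¹) (Y * Φ⁻¹) ≤ hs Y Y := by
  set X := Y * Φ⁻¹ with hX
  have hXY : X * Φ = Y := Matrix.nonsing_inv_mul_cancel_right _ _ h.isUnit_det
  have h1 := h.hs_right X
  rw [hXY] at h1
  have h2 := hs_sq_le X Y
  have hg := h.pos
  rcases (hs_self_nonneg X).eq_or_lt with h5 | h5
  · rw [← h5]; simpa using hs_self_nonneg Y
  · have h6 : (g * hs X X) ^ 2 ≤ hs X Y ^ 2 := pow_le_pow_left₀ (by positivity) h1 2
    have h7 : hs X X * (g ^ 2 * hs X X) ≤ hs X X * hs Y Y := by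
      calc _ = (g * hs X X) ^ 2 := by ring
        _ ≤ _ := h6.trans h2
    exact le_of_mul_le_mul_left h7 h5

lemma hs_diagonal_left (T : ι → ℝ) (A : Matrix ι ι ℝ) :
    hs (Matrix.diagonal T) A = ∑ x, T x * A x x := by
  refine Finset.sum_congr rfl fun x _ => ?_
  rw [Finset.sum_eq_single x] <;> simp +contextual [eq_comm]

/-- The stationary second moments `U = ⟨q q⟩`, `Z = ⟨q p⟩`, `V = ⟨p p⟩` of a harmonic system with
potential matrix `Φ`, coupled with strength `lam` to heat baths with temperatures `T`. -/
structure IsSteadyMoments (Φ : Matrix ι ι ℝ) (lam : ℝ) (T : ι → ℝ) (U Z V : Matrix ι ι ℝ) :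
    Prop where
  symm_pos : U.transpose = U
  symm_mom : V.transpose = V
  anti : Z.transpose = -Z
  pos_mom : V = U * Φ + lam • Z
  mom_mom : comm Φ Z + (2 * lam) • V = (2 * lam) • Matrix.diagonal T

namespace IsSteadyMoments

variable {T T' : ι → ℝ} {U Z V U' Z' V' : Matrix ι ι ℝ}

/-- The moment equations are linear and make sense for temperatures of any sign; this is what allows
comparison of two profiles and of positive and negative parts. -/
lemma sub (h : IsSteadyMoments Φ lam T U Z V) (h' : IsSteadyMoments Φ lam T' U' Z' V') :
    IsSteadyMoments Φ lam (T - T') (U - U') (Z - Z') (V - V') where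
  symm_pos := by rw [Matrix.transpose_sub, h.symm_pos, h'.symm_pos]
  symm_mom := by rw [Matrix.transpose_sub, h.symm_mom, h'.symm_mom]
  anti := by rw [Matrix.transpose_sub, h.anti, h'.anti]; abel
  pos_mom := by
    rw [h.pos_mom, h'.pos_mom, sub_mul, smul_sub]; abel
  mom_mom := by
    have := congrArg₂ (· - ·) h.mom_mom h'.mom_mom
    rw [comm_sub, show Matrix.diagonal (T - T') = Matrix.diagonal T - Matrix.diagonal T' by
      rw [Matrix.diagonal_sub]; rfl, smul_sub, smul_sub, ← this]
    abel

lemma pos_mom' (h : IsSteadyMoments Φ lam T U Z V) (hΦ : Φ.transpose = Φ) :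
    V = Φ * U - lam • Z := by
  have := congrArg Matrix.transpose h.pos_mom
  rw [h.symm_mom, Matrix.transpose_add, Matrix.transpose_mul, hΦ, h.symm_pos,
    Matrix.transpose_smul, h.anti] at this
  rw [this]; simp [sub_eq_add_neg]

lemma mom_sub (h : IsSteadyMoments Φ lam T U Z V) (hlam : 0 < lam) :
    Matrix.diagonal T - V = (1 / (2 * lam)) • comm Φ Z := by
  have h1 : comm Φ Z = (2 * lam) • (Matrix.diagonal T - V) := by
    rw [smul_sub, ← h.mom_mom]; abel
  rw [h1, smul_smul, one_div, inv_mul_cancel₀ (by positivity), one_smul]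

/-- The two expressions V = UΦ + λZ = ΦU - λZ give [Φ, V] = λ(ΦZ + ZΦ), because ΦUΦ cancels. The
momentum equation gives [Φ, diag T - V] as a double commutator; the sum is the claim. -/
lemma transport_eq (h : IsSteadyMoments Φ lam T U Z V) (hΦ : Φ.transpose = Φ) (hlam : 0 < lam) :
    transport Φ lam Z = comm Φ (Matrix.diagonal T) := by
  have h1 := h.pos_mom
  have h2 := h.pos_mom' hΦ
  have h3 := h.mom_sub hlam
  have h4 : comm Φ V = lam • (Φ * Z + Z * Φ) := by
    have hc : comm Φ V = Φ * (U * Φ + lam • Z) - (Φ * U - lam • Z) * Φ := by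
      rw [← h1, ← h2, comm]
    rw [hc]
    simp only [mul_add, sub_mul, Matrix.mul_smul, Matrix.smul_mul, smul_add, Matrix.mul_assoc]
    abel
  rw [transport, ← h4, ← comm_smul, ← h3, comm_sub]
  abel

/-- The energy identity. -/
lemma sum_mul_sub (h : IsSteadyMoments Φ lam T U Z V) (hΦ : Φ.transpose = Φ) (hlam : 0 < lam) :
    ∑ x, T x * (T x - V x x) = 1 / (2 * lam) * hs Z (transport Φ lam Z) := by
  have h1 : ∑ x, T x * (T x - V x x) = hs (Matrix.diagonal T) (Matrix.diagonal T - V) := by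
    rw [hs_diagonal_left]; simp
  rw [h1, h.mom_sub hlam, hs_smul_right, ← hs_comm_left hΦ, h.transport_eq hΦ hlam, hs_comm]

/-- The energy identity and coercivity squeeze ‖Z‖² to zero. -/
lemma eq_zero_of_sum_nonpos (h : IsSteadyMoments Φ lam T U Z V) (hΦ : IsElastic Φ g K)
    (hlam : 0 < lam) (hT : ∑ x, T x * (T x - V x x) ≤ 0) : Z = 0 := by
  have h1 := hΦ.transport_coercive hlam Z
  rw [h.sum_mul_sub hΦ.symm hlam] at hT
  have h2 : hs Z (transport Φ lam Z) ≤ 0 := by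
    by_contra hc
    push Not at hc
    have : 0 < 1 / (2 * lam) * hs Z (transport Φ lam Z) := by positivity
    linarith
  have h3 : 0 < 2 * lam * g := by have := hΦ.pos; positivity
  apply hs_self_eq_zero
  nlinarith [hs_self_nonneg Z]

/-- With Z = 0 the transport equation reads [Φ, diag T] = 0, and the entries of this commutator are
Φ_xy (T_y - T_x). -/
lemma apply_eq_of_sum_nonpos (h : IsSteadyMoments Φ lam T U Z V) (hΦ : IsElastic Φ g K)
    (hlam : 0 < lam) (hT : ∑ x, T x * (T x - V x x) ≤ 0) {x y : ι} (hxy : Φ x y ≠ 0) :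
    T x = T y := by
  have h1 := h.transport_eq hΦ.symm hlam
  rw [h.eq_zero_of_sum_nonpos hΦ hlam hT] at h1
  have h2 := congrFun (congrFun h1 x) y
  simp [comm, transport, Matrix.mul_diagonal, Matrix.diagonal_mul] at h2
  have h3 : Φ x y * (T y - T x) = 0 := by linarith
  rcases mul_eq_zero.1 h3 with h4 | h4
  · exact absurd h4 hxy
  · linarith

/-- The difference of two solutions has temperature zero, so its Z vanishes, then its V, then its U
because Φ is invertible. -/
lemma unique (h : IsSteadyMoments Φ lam T U Z V) (h' : IsSteadyMoments Φ lam T U' Z' V')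
    (hΦ : IsElastic Φ g K) (hlam : 0 < lam) : U = U' ∧ Z = Z' ∧ V = V' := by
  have hd := h.sub h'
  rw [sub_self] at hd
  have hZ : Z - Z' = 0 := hd.eq_zero_of_sum_nonpos hΦ hlam (by simp)
  have hV := hd.mom_sub hlam
  rw [hZ] at hV
  have hV' : V - V' = 0 := by
    simpa [comm, ← neg_eq_zero (a := V - V')] using hV
  have hU := hd.pos_mom
  rw [hZ, hV', smul_zero, add_zero] at hU
  have hU' : U - U' = 0 := by
    rw [← Matrix.mul_nonsing_inv_cancel_right _ (U - U') hΦ.isUnit_det, ← hU, zero_mul]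
  exact ⟨sub_eq_zero.1 hU', sub_eq_zero.1 hZ, sub_eq_zero.1 hV'⟩

lemma const (hΦ : IsElastic Φ g K) (θ : ℝ) :
    IsSteadyMoments Φ lam (fun _ => θ) (θ • Φ⁻¹) 0 (θ • (1 : Matrix ι ι ℝ)) where
  symm_pos := by rw [Matrix.transpose_smul, Matrix.transpose_nonsing_inv, hΦ.symm]
  symm_mom := by simp
  anti := by simp
  pos_mom := by simp [Matrix.nonsing_inv_mul _ hΦ.isUnit_det]
  mom_mom := by
    simp only [comm, mul_zero, zero_mul, sub_self, zero_add]
    rw [← Matrix.diagonal_one, ← Matrix.diagonal_smul]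
    congr 2; ext; simp

/-- Together with `unique`, this transfers symmetries of Φ to the steady state. -/
lemma submatrix (h : IsSteadyMoments Φ lam T U Z V) (σ : ι ≃ ι) (hσ : Φ.submatrix σ σ = Φ) :
    IsSteadyMoments Φ lam (T ∘ σ) (U.submatrix σ σ) (Z.submatrix σ σ) (V.submatrix σ σ) where
  symm_pos := by rw [Matrix.transpose_submatrix, h.symm_pos]
  symm_mom := by rw [Matrix.transpose_submatrix, h.symm_mom]
  anti := by rw [Matrix.transpose_submatrix, h.anti]; rfl
  pos_mom := by
    conv_lhs => rw [h.pos_mom]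
    conv_rhs => rw [← hσ]
    rw [Matrix.submatrix_mul_equiv]; rfl
  mom_mom := by
    have h1 := congrArg (fun A => A.submatrix σ σ) h.mom_mom
    conv_lhs => rw [← hσ]
    rw [comm, Matrix.submatrix_mul_equiv, Matrix.submatrix_mul_equiv,
      ← Matrix.submatrix_diagonal_equiv]
    exact h1

end IsSteadyMoments

end HilbertSchmidt

end Crystal

namespace Crystal

/-! ### The semigroup exp(-tB) and the Lyapunov equation -/

section Propagator

variable {κ : Type*} [Fintype κ] [DecidableEq κ]

/-- The semigroup `exp (-t B)`. -/
noncomputable def flow (B : Matrix κ κ ℝ) (t : ℝ) : Matrix κ κ ℝ := NormedSpace.exp (-(t • B))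

lemma flow_zero (B : Matrix κ κ ℝ) : flow B 0 = 1 := by simp [flow]

lemma commute_flow (B : Matrix κ κ ℝ) (t : ℝ) : Commute B (flow B t) := by
  let _ : NormedRing (Matrix κ κ ℝ) := Matrix.linftyOpNormedRing
  let _ : NormedAlgebra ℝ (Matrix κ κ ℝ) := Matrix.linftyOpNormedAlgebra
  exact (((Commute.refl B).smul_right t).neg_right).exp_right

lemma hasDerivAt_flow_apply (B : Matrix κ κ ℝ) (t : ℝ) (b c : κ) :
    HasDerivAt (fun t => flow B t b c) (-(B * flow B t) b c) t := by
  let _ : NormedRing (Matrix κ κ ℝ) := Matrix.linftyOpNormedRing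
  let _ : NormedAlgebra ℝ (Matrix κ κ ℝ) := Matrix.linftyOpNormedAlgebra
  have h := hasDerivAt_exp_smul_const' (𝕂 := ℝ) (-B) t
  have h2 := ((Matrix.entryLinearMap ℝ ℝ b c).toContinuousLinearMap.hasFDerivAt).comp_hasDerivAt t h
  have h3 : (fun t => flow B t b c) = (Matrix.entryLinearMap ℝ ℝ b c).toContinuousLinearMap ∘
      fun u : ℝ => NormedSpace.exp (u • -B) := by
    ext u; simp [flow]
  rw [h3]
  exact h2.congr_deriv (by simp only [flow, smul_neg, neg_mul]; rfl)

lemma continuous_flow_apply (B : Matrix κ κ ℝ) (b c : κ) : Continuous fun t => flow B t b c :=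
  continuous_iff_continuousAt.2 fun t => (hasDerivAt_flow_apply B t b c).continuousAt

/-- The propagated matrix `exp (-t B) M exp (-t Bᵀ)`. -/
noncomputable def propagated (B M : Matrix κ κ ℝ) (t : ℝ) : Matrix κ κ ℝ :=
  flow B t * M * (flow B t).transpose

lemma propagated_apply (B M : Matrix κ κ ℝ) (t : ℝ) (b c : κ) :
    propagated B M t b c = ∑ j, ∑ k, flow B t b k * M k j * flow B t c j := by
  simp [propagated, Matrix.mul_apply, Finset.sum_mul]

lemma continuous_propagated_apply (B M : Matrix κ κ ℝ) (b c : κ) :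
    Continuous fun t => propagated B M t b c := by
  simp only [propagated_apply]
  have := continuous_flow_apply B
  fun_prop

lemma hasDerivAt_propagated_apply (B M : Matrix κ κ ℝ) (t : ℝ) (b c : κ) :
    HasDerivAt (fun t => propagated B M t b c)
      (-(B * propagated B M t + propagated B M t * B.transpose) b c) t := by
  simp only [propagated_apply]
  have h : ∀ j k, HasDerivAt (fun t => flow B t b k * M k j * flow B t c j)
      (-(B * flow B t) b k * M k j * flow B t c j + flow B t b k * M k j * -(B * flow B t) c j) t :=
    fun j k => ((hasDerivAt_flow_apply B t b k).mul_const _).mul (hasDerivAt_flow_apply B t c j)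
  have h2 := HasDerivAt.fun_sum (u := Finset.univ) fun j _ =>
    HasDerivAt.fun_sum (u := Finset.univ) fun k _ => h j k
  refine h2.congr_deriv ?_
  have e1 : (B * propagated B M t) b c =
      ∑ j, ∑ k, (B * flow B t) b k * M k j * flow B t c j := by
    rw [propagated, ← Matrix.mul_assoc, ← Matrix.mul_assoc]
    simp [Matrix.mul_apply, Finset.sum_mul]
  have e2 : (propagated B M t * B.transpose) b c =
      ∑ j, ∑ k, flow B t b k * M k j * (B * flow B t) c j := by
    rw [propagated, Matrix.mul_assoc, ← Matrix.transpose_mul, Matrix.mul_apply]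
    simp only [Matrix.transpose_apply, Matrix.mul_apply, Finset.sum_mul]
  rw [Matrix.add_apply, e1, e2]
  simp only [neg_mul, mul_neg, Finset.sum_add_distrib, Finset.sum_neg_distrib]
  ring

/-- B commutes with its own semigroup. The derivative of a propagated matrix is thus again
propagated, and inherits decay and integrability. -/
lemma mul_propagated (B M : Matrix κ κ ℝ) (t : ℝ) :
    B * propagated B M t + propagated B M t * B.transpose
      = propagated B (B * M + M * B.transpose) t := by
  have h := commute_flow B t
  have h2 : (flow B t).transpose * B.transpose = B.transpose * (flow B t).transpose := by
    rw [← Matrix.transpose_mul, ← Matrix.transpose_mul, h.eq]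
  simp only [propagated, mul_add, add_mul]
  rw [← Matrix.mul_assoc, ← Matrix.mul_assoc, h.eq, Matrix.mul_assoc _ _ B.transpose, h2]
  simp only [Matrix.mul_assoc]

/-- Exponential decay of the semigroup `exp (-t B)`. -/
def IsStable (B : Matrix κ κ ℝ) : Prop :=
  ∃ C r : ℝ, 0 < r ∧ ∀ t, 0 ≤ t → ∀ b c, |flow B t b c| ≤ C * Real.exp (-r * t)

lemma IsStable.tendsto_flow {B : Matrix κ κ ℝ} (h : IsStable B) (b c : κ) :
    Filter.Tendsto (fun t => flow B t b c) Filter.atTop (nhds 0) := by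
  obtain ⟨C, r, hr, h⟩ := h
  have h1 : Filter.Tendsto (fun t => C * Real.exp (-r * t)) Filter.atTop (nhds 0) := by
    have : Filter.Tendsto (fun t => Real.exp (-r * t)) Filter.atTop (nhds 0) :=
      Real.tendsto_exp_atBot.comp
        ((Filter.tendsto_const_mul_atBot_of_neg (neg_neg_of_pos hr)).2 Filter.tendsto_id)
    simpa using this.const_mul C
  refine squeeze_zero_norm' ?_ h1
  filter_upwards [Filter.eventually_ge_atTop 0] with t ht
  exact h t ht b c

lemma IsStable.tendsto_propagated {B : Matrix κ κ ℝ} (h : IsStable B) (M : Matrix κ κ ℝ)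
    (b c : κ) : Filter.Tendsto (fun t => propagated B M t b c) Filter.atTop (nhds 0) := by
  simp only [propagated_apply]
  rw [show (0 : ℝ) = ∑ j : κ, ∑ k : κ, 0 * M k j * 0 by simp]
  exact tendsto_finsetSum _ fun j _ => tendsto_finsetSum _ fun k _ =>
    ((h.tendsto_flow b k).mul_const _).mul (h.tendsto_flow c j)

lemma IsStable.integrableOn_mul {B : Matrix κ κ ℝ} (h : IsStable B) (a b c d : κ) :
    IntegrableOn (fun t => flow B t a b * flow B t c d) (Set.Ioi 0) := by
  obtain ⟨C, r, hr, h⟩ := h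
  have h1 : IntegrableOn (fun t => C ^ 2 * Real.exp (-(2 * r) * t)) (Set.Ioi 0) :=
    (exp_neg_integrableOn_Ioi 0 (by positivity : 0 < 2 * r)).const_mul _
  refine Integrable.mono' h1
    ((continuous_flow_apply B a b).mul (continuous_flow_apply B c d)).aestronglyMeasurable ?_
  rw [ae_restrict_iff' measurableSet_Ioi]
  refine Filter.Eventually.of_forall fun t ht => ?_
  rw [Real.norm_eq_abs, abs_mul]
  calc |flow B t a b| * |flow B t c d| ≤ (C * Real.exp (-r * t)) * (C * Real.exp (-r * t)) :=
        mul_le_mul (h t (le_of_lt ht) a b) (h t (le_of_lt ht) c d) (abs_nonneg _)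
          ((abs_nonneg _).trans (h t (le_of_lt ht) a b))
    _ = C ^ 2 * Real.exp (-(2 * r) * t) := by
        rw [show -(2 * r) * t = -r * t + -r * t by ring, Real.exp_add]; ring

lemma IsStable.integrableOn_propagated {B : Matrix κ κ ℝ} (h : IsStable B) (M : Matrix κ κ ℝ)
    (b c : κ) : IntegrableOn (fun t => propagated B M t b c) (Set.Ioi 0) := by
  simp only [propagated_apply]
  refine integrable_finsetSum _ fun j _ => integrable_finsetSum _ fun k _ => ?_
  refine ((h.integrableOn_mul b k c j).const_mul (M k j)).congr
    (Filter.Eventually.of_forall fun t => ?_)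
  ring

/-- The solution of the Lyapunov equation. -/
noncomputable def lyapunov (B D : Matrix κ κ ℝ) : Matrix κ κ ℝ :=
  Matrix.of fun b c => ∫ s in Set.Ioi (0 : ℝ), propagated B D s b c

/-- Integrate the derivative of exp(-tB) D exp(-tBᵀ) over the half-line; the boundary terms are D at
t = 0 and 0 at infinity. -/
lemma IsStable.lyapunov_eq {B : Matrix κ κ ℝ} (h : IsStable B) (D : Matrix κ κ ℝ) :
    B * lyapunov B D + lyapunov B D * B.transpose = D := by
  ext b c
  have h1 := integral_Ioi_of_hasDerivAt_of_tendsto' (a := 0) (m := 0)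
    (fun t _ => hasDerivAt_propagated_apply B D t b c)
    (by
      simp only [mul_propagated]
      exact (h.integrableOn_propagated _ b c).neg) (h.tendsto_propagated D b c)
  have h2 : propagated B D 0 b c = D b c := by simp [propagated, flow_zero]
  rw [h2, integral_neg, zero_sub, neg_inj] at h1
  rw [← h1]
  simp only [Matrix.add_apply, Matrix.mul_apply, lyapunov, Matrix.of_apply]
  rw [integral_add, integral_finsetSum, integral_finsetSum]
  · congr 1
    · exact Finset.sum_congr rfl fun k _ => (integral_const_mul _ _).symm
    · exact Finset.sum_congr rfl fun k _ => (integral_mul_const _ _).symm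
  · exact fun k _ => (h.integrableOn_propagated D _ _).mul_const _
  · exact fun k _ => (h.integrableOn_propagated D _ _).const_mul _
  · exact integrable_finsetSum _ fun k _ => (h.integrableOn_propagated D _ _).const_mul _
  · exact integrable_finsetSum _ fun k _ => (h.integrableOn_propagated D _ _).mul_const _

/-- By the Lyapunov equation, minus the propagated solution is an antiderivative of the propagated
D. The noise accumulated up to time t is therefore exactly what the contraction of S has lost. -/
lemma IsStable.intervalIntegral_propagated {B : Matrix κ κ ℝ} (h : IsStable B)
    (D : Matrix κ κ ℝ) (t : ℝ) (b c : κ) :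
    ∫ s in (0 : ℝ)..t, propagated B D s b c
      = lyapunov B D b c - propagated B (lyapunov B D) t b c := by
  have h1 : ∀ s ∈ Set.uIcc 0 t, HasDerivAt (fun s => -propagated B (lyapunov B D) s b c)
      (propagated B D s b c) s := by
    intro s _
    have := (hasDerivAt_propagated_apply B (lyapunov B D) s b c).neg
    rw [mul_propagated, h.lyapunov_eq, neg_neg] at this
    exact this
  rw [intervalIntegral.integral_eq_sub_of_hasDerivAt h1
    (continuous_propagated_apply B D b c).continuousOn.intervalIntegrable]
  simp [propagated, flow_zero]
  ring

lemma propagated_transpose (B D : Matrix κ κ ℝ) (hD : D.transpose = D) (t : ℝ) :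
    (propagated B D t).transpose = propagated B D t := by
  simp [propagated, Matrix.transpose_mul, hD, Matrix.mul_assoc]

lemma propagated_posSemidef (B : Matrix κ κ ℝ) {D : Matrix κ κ ℝ} (hD : D.PosSemidef) (t : ℝ) :
    (propagated B D t).PosSemidef := by
  have := hD.mul_mul_conjTranspose_same (flow B t)
  simpa [propagated, Matrix.conjTranspose_eq_transpose_of_trivial] using this

/-- An entrywise integral of positive semidefinite matrices is positive semidefinite. -/
lemma posSemidef_of_integral {κ : Type*} [Fintype κ] {μ : Measure ℝ} {F : ℝ → Matrix κ κ ℝ}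
    (hF : ∀ t, (F t).PosSemidef) (hi : ∀ b c, Integrable (fun t => F t b c) μ) :
    (Matrix.of fun b c => ∫ t, F t b c ∂μ).PosSemidef := by
  refine Matrix.PosSemidef.of_dotProduct_mulVec_nonneg ?_ fun x => ?_
  · ext b c
    simp only [Matrix.conjTranspose_apply, Matrix.of_apply, star_trivial]
    refine integral_congr_ae (Filter.Eventually.of_forall fun t => ?_)
    have := congrFun (congrFun (hF t).isHermitian b) c
    simpa using this
  · have h1 : star x ⬝ᵥ (Matrix.of fun b c => ∫ t, F t b c ∂μ).mulVec x
        = ∫ t, star x ⬝ᵥ (F t).mulVec x ∂μ := by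
      simp only [dotProduct, Matrix.mulVec, Matrix.of_apply]
      rw [integral_finsetSum]
      · refine Finset.sum_congr rfl fun b _ => ?_
        rw [integral_const_mul, integral_finsetSum]
        · congr 1
          exact Finset.sum_congr rfl fun c _ => (integral_mul_const _ _).symm
        · exact fun c _ => (hi b c).mul_const _
      · exact fun b _ => (integrable_finsetSum _ fun c _ => (hi b c).mul_const _).const_mul _
    rw [h1]
    exact integral_nonneg fun t => (hF t).dotProduct_mulVec_nonneg x

lemma IsStable.lyapunov_posSemidef {B : Matrix κ κ ℝ} (h : IsStable B) {D : Matrix κ κ ℝ}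
    (hD : D.PosSemidef) : (lyapunov B D).PosSemidef :=
  posSemidef_of_integral (propagated_posSemidef B hD) (h.integrableOn_propagated D)

lemma intervalIntegral_propagated_posSemidef (B : Matrix κ κ ℝ) {D : Matrix κ κ ℝ}
    (hD : D.PosSemidef) {t : ℝ} (ht : 0 ≤ t) :
    (Matrix.of fun b c => ∫ s in (0 : ℝ)..t, propagated B D s b c).PosSemidef := by
  simp only [intervalIntegral.integral_of_le ht]
  exact posSemidef_of_integral (propagated_posSemidef B hD) fun b c =>
    (continuous_propagated_apply B D b c).integrableOn_Ioc

end Propagator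

/-! ### Exponential decay of the damped dynamics and the steady covariance -/

section Stability

variable {ι : Type*} [Fintype ι] [DecidableEq ι] {Φ : Matrix ι ι ℝ} {g K lam : ℝ}

/-- The drift matrix for the potential matrix `Φ`. -/
noncomputable def driftMatrix (Φ : Matrix ι ι ℝ) (lam : ℝ) : Matrix (ι ⊕ ι) (ι ⊕ ι) ℝ :=
  Matrix.fromBlocks 0 (-1) Φ (lam • (1 : Matrix ι ι ℝ))

lemma dotProduct_self_nonneg {ι : Type*} [Fintype ι] (v : ι → ℝ) : 0 ≤ v ⬝ᵥ v :=
  Finset.sum_nonneg fun _ _ => mul_self_nonneg _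

lemma abs_two_mul_dotProduct_le {ι : Type*} [Fintype ι] (u v : ι → ℝ) {δ : ℝ} (hδ : 0 < δ) :
    |2 * (u ⬝ᵥ v)| ≤ δ * (u ⬝ᵥ u) + (v ⬝ᵥ v) / δ := by
  have h : ∀ s : ℝ, s ^ 2 = 1 → s * (2 * (u ⬝ᵥ v)) ≤ δ * (u ⬝ᵥ u) + (v ⬝ᵥ v) / δ := by
    intro s hs
    have h1 : 0 ≤ (δ • u - s • v) ⬝ᵥ (δ • u - s • v) := dotProduct_self_nonneg _
    simp only [sub_dotProduct, dotProduct_sub, smul_dotProduct, dotProduct_smul, smul_eq_mul,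
      dotProduct_comm v u] at h1
    have h2 : s * (2 * (u ⬝ᵥ v)) * δ ≤ (δ * (u ⬝ᵥ u) + (v ⬝ᵥ v) / δ) * δ := by
      rw [add_mul, div_mul_cancel₀ _ hδ.ne']
      have : s * (s * (v ⬝ᵥ v)) = v ⬝ᵥ v := by rw [← mul_assoc, ← sq, hs, one_mul]
      nlinarith
    exact le_of_mul_le_mul_right h2 hδ
  rw [abs_le']
  exact ⟨by simpa using h 1 (by norm_num), by simpa using h (-1) (by norm_num)⟩

/-- A quadratic Lyapunov function of the noiseless dynamics. -/
lemma exists_lyapunov_function {ι : Type*} [Fintype ι] {Φ : Matrix ι ι ℝ}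
    (hΦ : IsElastic Φ g K) (hlam : 0 < lam) :
    ∃ ε m : ℝ, 0 < m ∧ ∀ q p : ι → ℝ,
      (1 / 2) * (g * (q ⬝ᵥ q) + p ⬝ᵥ p) ≤ q ⬝ᵥ Φ.mulVec q + 2 * ε * (q ⬝ᵥ p) + p ⬝ᵥ p ∧
      m * (q ⬝ᵥ Φ.mulVec q + 2 * ε * (q ⬝ᵥ p) + p ⬝ᵥ p)
        ≤ ε * (q ⬝ᵥ Φ.mulVec q) + ε * lam * (q ⬝ᵥ p) + (lam - ε) * (p ⬝ᵥ p) := by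
  have hg := hΦ.pos
  -- The first bound keeps the cross term below half of the energy. The second lets the friction
  -- absorb what the cross term costs in kinetic energy.
  set ε := min (Real.sqrt g / 2) (lam / (2 * (1 + lam ^ 2 / (2 * g)))) with hε
  have hε0 : 0 < ε := lt_min (by positivity) (by positivity)
  have hε1 : 4 * ε ^ 2 ≤ g := by
    have h1 : ε ≤ Real.sqrt g / 2 := min_le_left _ _
    have h2 : (2 * ε) ^ 2 ≤ Real.sqrt g ^ 2 := pow_le_pow_left₀ (by positivity) (by linarith) 2
    rw [Real.sq_sqrt hg.le] at h2
    linarith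
  have hε2 : ε * (1 + lam ^ 2 / (2 * g)) ≤ lam / 2 := by
    have h1 : ε ≤ lam / (2 * (1 + lam ^ 2 / (2 * g))) := min_le_right _ _
    calc _ ≤ lam / (2 * (1 + lam ^ 2 / (2 * g))) * (1 + lam ^ 2 / (2 * g)) :=
          mul_le_mul_of_nonneg_right h1 (by positivity)
      _ = lam / 2 := by field_simp
  -- The dissipation is at least ε/2 times the potential part plus lam/2 times the kinetic part; the
  -- quadratic function itself is at most 3/2 of their sum.
  refine ⟨ε, min (ε / 2) (lam / 2) / (3 / 2), ?_, fun q p => ?_⟩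
  · have : 0 < min (ε / 2) (lam / 2) := lt_min (by positivity) (by positivity)
    positivity
  have hp : 0 ≤ p ⬝ᵥ p := dotProduct_self_nonneg p
  have hq : 0 ≤ q ⬝ᵥ q := dotProduct_self_nonneg q
  have ha := hΦ.coercive q
  set a := q ⬝ᵥ Φ.mulVec q
  set b := p ⬝ᵥ p
  set r := q ⬝ᵥ p
  set s := q ⬝ᵥ q
  have ha0 : 0 ≤ a := le_trans (by positivity) ha
  have hr1 : |2 * ε * r| ≤ (1 / 2) * (a + b) := by
    have h1 := abs_two_mul_dotProduct_le q p (δ := g / (2 * ε)) (by positivity)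
    have h2 : |2 * ε * r| = ε * |2 * r| := by
      rw [show 2 * ε * r = ε * (2 * r) by ring, abs_mul, abs_of_pos hε0]
    rw [h2]
    calc ε * |2 * r| ≤ ε * (g / (2 * ε) * s + b / (g / (2 * ε))) :=
          mul_le_mul_of_nonneg_left h1 hε0.le
      _ = 1 / 2 * (g * s) + (2 * ε ^ 2 / g) * b := by field_simp
      _ ≤ 1 / 2 * a + 1 / 2 * b := by
          have : 2 * ε ^ 2 / g ≤ 1 / 2 := by rw [div_le_iff₀ hg]; linarith
          have := mul_le_mul_of_nonneg_right this hp
          linarith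
      _ = _ := by ring
  have hr2 : |ε * lam * r| ≤ ε / 2 * a + ε * (lam ^ 2 / (2 * g)) * b := by
    have h1 := abs_two_mul_dotProduct_le q p (δ := g / lam) (by positivity)
    have h2 : |ε * lam * r| = ε * lam / 2 * |2 * r| := by
      rw [show ε * lam * r = ε * lam / 2 * (2 * r) by ring, abs_mul,
        abs_of_pos (by positivity : 0 < ε * lam / 2)]
    rw [h2]
    calc ε * lam / 2 * |2 * r| ≤ ε * lam / 2 * (g / lam * s + b / (g / lam)) :=
          mul_le_mul_of_nonneg_left h1 (by positivity)
      _ = ε / 2 * (g * s) + ε * (lam ^ 2 / (2 * g)) * b := by field_simp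
      _ ≤ _ := by
          have := mul_le_mul_of_nonneg_left ha (by positivity : 0 ≤ ε / 2)
          linarith
  have h3 := abs_le.1 hr1
  have h4 := abs_le.1 hr2
  have h5 := mul_le_mul_of_nonneg_right hε2 hp
  refine ⟨by linarith, ?_⟩
  set m := min (ε / 2) (lam / 2) with hm
  have hm0 : 0 ≤ m := le_min (by positivity) (by positivity)
  have h6 : m * a ≤ ε / 2 * a := mul_le_mul_of_nonneg_right (min_le_left _ _) ha0
  have h7 : m * b ≤ lam / 2 * b := mul_le_mul_of_nonneg_right (min_le_right _ _) hp
  have h8 : m * (a + 2 * ε * r + b) ≤ m * (3 / 2 * (a + b)) :=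
    mul_le_mul_of_nonneg_left (by linarith) hm0
  rw [div_mul_eq_mul_div, div_le_iff₀ (by norm_num)]
  nlinarith

/-- Each column of the semigroup is a trajectory (q, p) of the noiseless dynamics. The quadratic
Lyapunov function decays along it and dominates the squares of the entries. -/
lemma IsElastic.isStable (hΦ : IsElastic Φ g K) (hlam : 0 < lam) :
    IsStable (driftMatrix Φ lam) := by
  obtain ⟨ε, m, hm, hF⟩ := exists_lyapunov_function hΦ hlam
  have hg := hΦ.pos
  set B := driftMatrix Φ lam
  let q : (ι ⊕ ι) → ℝ → ι → ℝ := fun c t x => flow B t (Sum.inl x) c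
  let p : (ι ⊕ ι) → ℝ → ι → ℝ := fun c t x => flow B t (Sum.inr x) c
  have hq : ∀ c t x, HasDerivAt (fun t => q c t x) (p c t x) t := by
    intro c t x
    refine (hasDerivAt_flow_apply B t (Sum.inl x) c).congr_deriv ?_
    simp [B, driftMatrix, Matrix.mul_apply, p, Matrix.one_apply]
  have hp : ∀ c t x, HasDerivAt (fun t => p c t x) (-(Φ.mulVec (q c t)) x - lam * p c t x) t := by
    intro c t x
    refine (hasDerivAt_flow_apply B t (Sum.inr x) c).congr_deriv ?_
    simp [B, driftMatrix, Matrix.mul_apply, p, q, Matrix.one_apply, Matrix.mulVec, dotProduct]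
    ring
  have hdot : ∀ u v u' v' : ℝ → ι → ℝ, ∀ t, (∀ x, HasDerivAt (fun t => u t x) (u' t x) t) →
      (∀ x, HasDerivAt (fun t => v t x) (v' t x) t) →
      HasDerivAt (fun t => u t ⬝ᵥ v t) (u' t ⬝ᵥ v t + u t ⬝ᵥ v' t) t := by
    intro u v u' v' t hu hv
    have := HasDerivAt.fun_sum (u := Finset.univ) fun x _ => (hu x).mul (hv x)
    refine this.congr_deriv ?_
    simp [dotProduct, Finset.sum_add_distrib]
  have hΦq : ∀ c t x, HasDerivAt (fun t => Φ.mulVec (q c t) x) (Φ.mulVec (p c t) x) t := by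
    intro c t x
    exact HasDerivAt.fun_sum (u := Finset.univ) fun y _ => (hq c t y).const_mul (Φ x y)
  let F : (ι ⊕ ι) → ℝ → ℝ := fun c t =>
    q c t ⬝ᵥ Φ.mulVec (q c t) + 2 * ε * (q c t ⬝ᵥ p c t) + p c t ⬝ᵥ p c t
  have hF' : ∀ c t, HasDerivAt (F c) (-2 * (ε * (q c t ⬝ᵥ Φ.mulVec (q c t))
      + ε * lam * (q c t ⬝ᵥ p c t) + (lam - ε) * (p c t ⬝ᵥ p c t))) t := by
    intro c t
    have h1 := hdot _ (fun t => Φ.mulVec (q c t)) _ (fun t => Φ.mulVec (p c t)) t (hq c t) (hΦq c t)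
    have h2 := hdot _ _ _ (fun t x => -(Φ.mulVec (q c t)) x - lam * p c t x) t (hq c t) (hp c t)
    have h3 := hdot _ _ (fun t x => -(Φ.mulVec (q c t)) x - lam * p c t x)
      (fun t x => -(Φ.mulVec (q c t)) x - lam * p c t x) t (hp c t) (hp c t)
    have h := (h1.add (h2.const_mul (2 * ε))).add h3
    refine h.congr_deriv ?_
    have e1 : (fun x => -(Φ.mulVec (q c t)) x - lam * p c t x)
        = -Φ.mulVec (q c t) - lam • p c t := rfl
    have e2 : q c t ⬝ᵥ Φ.mulVec (p c t) = p c t ⬝ᵥ Φ.mulVec (q c t) := by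
      rw [Matrix.dotProduct_mulVec, ← Matrix.mulVec_transpose, hΦ.symm, dotProduct_comm]
    simp only [e1, e2, dotProduct_sub, sub_dotProduct, dotProduct_neg, neg_dotProduct,
      dotProduct_smul, smul_dotProduct, smul_eq_mul, dotProduct_comm (Φ.mulVec (q c t))]
    ring
  have hdecay : ∀ c t, 0 ≤ t → F c t ≤ F c 0 * Real.exp (-(2 * m) * t) := by
    intro c t ht
    have hd : ∀ t, HasDerivAt (fun t => Real.exp (2 * m * t) * F c t)
        (Real.exp (2 * m * t) * (2 * m) * F c t + Real.exp (2 * m * t) *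
        (-2 * (ε * (q c t ⬝ᵥ Φ.mulVec (q c t))
      + ε * lam * (q c t ⬝ᵥ p c t) + (lam - ε) * (p c t ⬝ᵥ p c t)))) t := by
      intro t
      have he : HasDerivAt (fun t => Real.exp (2 * m * t)) (Real.exp (2 * m * t) * (2 * m)) t := by
        simpa using ((hasDerivAt_id t).const_mul (2 * m)).exp
      exact he.mul (hF' c t)
    -- Grönwall's argument: dissipation at rate 2m makes the weighted function nonincreasing.
    have hanti : Antitone fun t => Real.exp (2 * m * t) * F c t := by
      refine antitone_of_deriv_nonpos (fun t => (hd t).differentiableAt) fun t => ?_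
      rw [(hd t).deriv]
      have h1 := (hF (q c t) (p c t)).2
      have h2 := mul_le_mul_of_nonneg_left h1 (Real.exp_pos (2 * m * t)).le
      simp only [F]
      linarith
    have h1 := hanti ht
    simp only [mul_zero, Real.exp_zero, one_mul] at h1
    rw [neg_mul, Real.exp_neg, ← div_eq_mul_inv, le_div_iff₀ (Real.exp_pos _), mul_comm]
    exact h1
  have hF0 : ∀ c t, 0 ≤ F c t := by
    intro c t
    refine le_trans ?_ (hF (q c t) (p c t)).1
    have h1 := dotProduct_self_nonneg (q c t)
    have h2 := dotProduct_self_nonneg (p c t)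
    positivity
  -- Summing the initial values over all columns gives one constant for all entries.
  have hentry : ∀ b c t, 0 ≤ t →
      flow B t b c ^ 2 ≤ (2 * (1 / g + 1) * ∑ c, F c 0) * Real.exp (-(2 * m) * t) := by
    intro b c t ht
    have h1 := (hF (q c t) (p c t)).1
    have hs : ∀ v : ι → ℝ, ∀ x, v x ^ 2 ≤ v ⬝ᵥ v := fun v x => by
      rw [sq]
      exact Finset.single_le_sum (f := fun x => v x * v x) (fun x _ => mul_self_nonneg _)
        (Finset.mem_univ x)
    have hn : ∀ v : ι → ℝ, 0 ≤ v ⬝ᵥ v := dotProduct_self_nonneg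
    have h2 : flow B t b c ^ 2 ≤ 2 * (1 / g + 1) * F c t := by
      have hFt : (1 / 2) * (g * (q c t ⬝ᵥ q c t) + p c t ⬝ᵥ p c t) ≤ F c t := h1
      have hF1 := hF0 c t
      have e : 2 * (1 / g + 1) * F c t = 2 / g * F c t + 2 * F c t := by ring
      have hnn : 0 ≤ 2 / g * F c t := by positivity
      rcases b with x | x
      · have h3 := hs (q c t) x
        have h4 : g * (q c t ⬝ᵥ q c t) ≤ 2 * F c t := by linarith [hn (p c t)]
        have h5 : q c t ⬝ᵥ q c t ≤ 2 / g * F c t := by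
          rw [div_mul_eq_mul_div, le_div_iff₀ hg]; linarith
        change q c t x ^ 2 ≤ _
        linarith
      · have h3 := hs (p c t) x
        have h4 : 0 ≤ g * (q c t ⬝ᵥ q c t) := mul_nonneg hg.le (hn _)
        change p c t x ^ 2 ≤ _
        linarith
    refine h2.trans ?_
    rw [mul_assoc (2 * (1 / g + 1))]
    refine mul_le_mul_of_nonneg_left ?_ (by positivity : 0 ≤ 2 * (1 / g + 1))
    refine (hdecay c t ht).trans (mul_le_mul_of_nonneg_right ?_ (Real.exp_pos _).le)
    exact Finset.single_le_sum (f := fun c => F c 0) (fun c _ => hF0 c 0) (Finset.mem_univ c)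
  refine ⟨Real.sqrt (2 * (1 / g + 1) * ∑ c, F c 0), m, hm, fun t ht b c => ?_⟩
  have hnn : 0 ≤ 2 * (1 / g + 1) * ∑ c, F c 0 :=
    mul_nonneg (by positivity) (Finset.sum_nonneg fun c _ => hF0 c 0)
  refine abs_le_of_sq_le_sq ?_ (mul_nonneg (Real.sqrt_nonneg _) (Real.exp_pos _).le)
  rw [mul_pow, Real.sq_sqrt hnn, ← Real.exp_nat_mul]
  refine (hentry b c t ht).trans_eq ?_
  congr 2
  push_cast; ring

/-- The noise intensity matrix for the temperatures `T`. -/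
noncomputable def noiseMatrix {ι : Type*} [DecidableEq ι] (lam : ℝ) (T : ι → ℝ) : Matrix (ι ⊕ ι) (ι ⊕ ι) ℝ :=
  Matrix.fromBlocks 0 0 0 (Matrix.diagonal fun x => 2 * lam * T x)

lemma noiseMatrix_eq_diagonal {ι : Type*} [DecidableEq ι] (T : ι → ℝ) :
    noiseMatrix lam T = Matrix.diagonal (Sum.elim 0 fun x => 2 * lam * T x) := by
  rw [noiseMatrix, show (0 : Matrix ι ι ℝ) = Matrix.diagonal 0 by simp,
    show (Matrix.fromBlocks (Matrix.diagonal 0) (Matrix.diagonal 0) (Matrix.diagonal 0)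
      (Matrix.diagonal fun x => 2 * lam * T x)) = Matrix.fromBlocks (Matrix.diagonal 0) 0 0
      (Matrix.diagonal fun x => 2 * lam * T x) by simp, Matrix.fromBlocks_diagonal]

/-- The steady covariance for the potential matrix `Φ` and arbitrary real temperatures. -/
noncomputable def cov (Φ : Matrix ι ι ℝ) (lam : ℝ) (T : ι → ℝ) : Matrix (ι ⊕ ι) (ι ⊕ ι) ℝ :=
  lyapunov (driftMatrix Φ lam) (noiseMatrix lam T)

lemma cov_posSemidef (hΦ : IsElastic Φ g K) (hlam : 0 < lam) {T : ι → ℝ} (hT : ∀ x, 0 ≤ T x) :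
    (cov Φ lam T).PosSemidef := by
  refine (hΦ.isStable hlam).lyapunov_posSemidef ?_
  rw [noiseMatrix_eq_diagonal]
  refine Matrix.PosSemidef.diagonal fun b => ?_
  rcases b with x | x
  · simp
  · simpa using mul_nonneg (by positivity) (hT x)

lemma cov_transpose (Φ : Matrix ι ι ℝ) (lam : ℝ) (T : ι → ℝ) :
    (cov Φ lam T).transpose = cov Φ lam T := by
  ext b c
  simp only [cov, lyapunov, Matrix.transpose_apply, Matrix.of_apply]
  refine integral_congr_ae (Filter.Eventually.of_forall fun t => ?_)
  have := propagated_transpose (driftMatrix Φ lam) (noiseMatrix lam T)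
    (by rw [noiseMatrix_eq_diagonal, Matrix.diagonal_transpose]) t
  exact congrFun (congrFun this b) c

/-- These are the blocks of the Lyapunov equation: the position block makes Z antisymmetric, the
mixed block determines V, and the momentum block carries the noise. -/
lemma isSteadyMoments_cov (hΦ : IsElastic Φ g K) (hlam : 0 < lam) (T : ι → ℝ) :
    IsSteadyMoments Φ lam T (cov Φ lam T).toBlocks₁₁ (cov Φ lam T).toBlocks₁₂
      (cov Φ lam T).toBlocks₂₂ := by
  have hsymm := cov_transpose Φ lam T
  have hl := (hΦ.isStable hlam).lyapunov_eq (noiseMatrix lam T)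
  change driftMatrix Φ lam * cov Φ lam T + cov Φ lam T * (driftMatrix Φ lam).transpose = _ at hl
  set S := cov Φ lam T
  set U := S.toBlocks₁₁
  set Z := S.toBlocks₁₂
  set V := S.toBlocks₂₂
  set Z' := S.toBlocks₂₁
  have hS : S = Matrix.fromBlocks U Z Z' V := (Matrix.fromBlocks_toBlocks S).symm
  rw [hS, Matrix.fromBlocks_transpose, Matrix.fromBlocks_inj] at hsymm
  obtain ⟨hU, hZ', hZ, hV⟩ := hsymm
  rw [hS, driftMatrix, noiseMatrix, Matrix.fromBlocks_transpose, Matrix.fromBlocks_multiply,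
    Matrix.fromBlocks_multiply, Matrix.fromBlocks_add, Matrix.fromBlocks_inj] at hl
  obtain ⟨h11, h12, h21, h22⟩ := hl
  simp only [Matrix.transpose_zero, zero_mul, mul_zero, Matrix.transpose_neg, Matrix.transpose_one,
    Matrix.transpose_smul, neg_mul, mul_neg, one_mul, mul_one, zero_add,
    Matrix.mul_smul, Matrix.smul_mul, hΦ.symm] at h11 h12 h21 h22
  have hanti : Z' = -Z := by
    have : Z' + Z = 0 := by rw [← neg_eq_zero, ← h11]; abel
    exact eq_neg_of_add_eq_zero_left this
  refine ⟨hU, hV, by rw [hZ, hanti], ?_, ?_⟩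
  · have := eq_neg_of_add_eq_zero_left h12
    rw [neg_inj] at this
    exact this
  · rw [hanti] at h22
    rw [comm, two_mul, add_smul, show (lam + lam) • Matrix.diagonal T
      = Matrix.diagonal fun x => 2 * lam * T x by
        rw [← Matrix.diagonal_smul]; congr 1; ext x; simp only [Pi.smul_apply, smul_eq_mul]; ring, ← h22]
    rw [neg_mul]; abel

/-- The kernel which expresses the mean kinetic energies through the temperatures. -/
noncomputable def kineticKernel (Φ : Matrix ι ι ℝ) (lam : ℝ) (x y : ι) : ℝ :=
  ∫ s in Set.Ioi (0 : ℝ), 2 * lam * flow (driftMatrix Φ lam) s (Sum.inr x) (Sum.inr y) ^ 2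

lemma kineticKernel_nonneg (hlam : 0 < lam) (x y : ι) : 0 ≤ kineticKernel Φ lam x y :=
  integral_nonneg fun s => by positivity

/-- The noise acts diagonally on the momenta, so its contribution to ⟨p_x²⟩ is a sum of squared
propagator entries weighted by temperatures. The resulting nonnegative kernel is the source of the
maximum principle. -/
lemma cov_inr_inr (hΦ : IsElastic Φ g K) (hlam : 0 < lam) (T : ι → ℝ) (x : ι) :
    (cov Φ lam T).toBlocks₂₂ x x = ∑ y, kineticKernel Φ lam x y * T y := by
  have h1 : ∀ s, propagated (driftMatrix Φ lam) (noiseMatrix lam T) s (Sum.inr x) (Sum.inr x)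
      = ∑ y, 2 * lam * flow (driftMatrix Φ lam) s (Sum.inr x) (Sum.inr y) ^ 2 * T y := by
    intro s
    rw [propagated, noiseMatrix_eq_diagonal, Matrix.mul_apply]
    simp only [Matrix.mul_diagonal, Matrix.transpose_apply, Fintype.sum_sum_type]
    simp only [Sum.elim_inl, Sum.elim_inr, Pi.zero_apply, mul_zero, zero_mul,
      Finset.sum_const_zero, zero_add]
    exact Finset.sum_congr rfl fun y _ => by ring
  simp only [Matrix.toBlocks₂₂, cov, lyapunov, Matrix.of_apply, h1, kineticKernel]
  rw [integral_finsetSum]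
  · exact Finset.sum_congr rfl fun y _ => integral_mul_const _ _
  · intro y _
    refine Integrable.mul_const ?_ _
    have := ((hΦ.isStable hlam).integrableOn_mul (Sum.inr x) (Sum.inr y) (Sum.inr x)
      (Sum.inr y)).const_mul (2 * lam)
    simpa only [sq] using this

end Stability

end Crystal

namespace Crystal

/-! ### Moments of centred Gaussian measures -/

section GaussianMoments

variable {κ : Type*} [Fintype κ] [DecidableEq κ] {S S' : Matrix κ κ ℝ}

lemma memLp_eval_gaussian (S : Matrix κ κ ℝ) (b : κ) {p : ENNReal} (hp : p ≠ ⊤) :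
    MemLp (fun z : EuclideanSpace ℝ κ => z b) p (multivariateGaussian 0 S) :=
  IsGaussian.memLp_dual (multivariateGaussian 0 S) (EuclideanSpace.proj b) p hp

lemma integrable_mul_gaussian (S : Matrix κ κ ℝ) (b c : κ) :
    Integrable (fun z : EuclideanSpace ℝ κ => z b * z c) (multivariateGaussian 0 S) :=
  (memLp_eval_gaussian S b (by norm_num : (2 : ENNReal) ≠ ⊤)).integrable_mul
    (memLp_eval_gaussian S c (by norm_num : (2 : ENNReal) ≠ ⊤))

lemma integral_eval_gaussian (S : Matrix κ κ ℝ) (b : κ) :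
    ∫ z : EuclideanSpace ℝ κ, z b ∂(multivariateGaussian 0 S) = 0 := by
  have h := IsGaussian.integral_dual (μ := multivariateGaussian 0 S)
    (EuclideanSpace.proj b : EuclideanSpace ℝ κ →L[ℝ] ℝ)
  rw [integral_id_multivariateGaussian] at h
  simpa using h

lemma integral_mul_gaussian (hS : S.PosSemidef) (b c : κ) :
    ∫ z : EuclideanSpace ℝ κ, z b * z c ∂(multivariateGaussian 0 S) = S b c := by
  have h := covariance_eval_multivariateGaussian (μ := 0) hS b c
  rw [covariance_eq_sub (memLp_eval_gaussian S b (by norm_num))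
    (memLp_eval_gaussian S c (by norm_num)), integral_eval_gaussian, zero_mul, sub_zero] at h
  exact h

/-- The `m`-th moment of the standard Gaussian measure. -/
noncomputable def stdMoment (m : ℕ) : ℝ := ∫ x, x ^ m ∂(gaussianReal 0 1)

lemma integral_pow_gaussianReal (v : NNReal) (m : ℕ) :
    ∫ x, x ^ m ∂(gaussianReal 0 v) = Real.sqrt v ^ m * stdMoment m := by
  have h := gaussianReal_map_const_mul (μ := 0) (v := 1) (Real.sqrt v)
  have hv : NNReal.mk (Real.sqrt v ^ 2) (sq_nonneg _) * 1 = v := by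
    ext; simp
  rw [mul_zero, hv] at h
  rw [← h, integral_map (by fun_prop) (by fun_prop), stdMoment, ← integral_const_mul]
  simp [mul_pow]

/-- A sum of coordinates is a one-dimensional centred Gaussian, and its variance is the double sum
of covariances. -/
lemma integral_sum_pow_gaussian (hS : S.PosSemidef) {ι : Type*} (s : Finset ι) (c : ι → κ)
    (m : ℕ) : ∫ z : EuclideanSpace ℝ κ, (∑ k ∈ s, z (c k)) ^ m ∂(multivariateGaussian 0 S)
      = Real.sqrt (∑ k ∈ s, ∑ l ∈ s, S (c k) (c l)) ^ m * stdMoment m := by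
  set μ := multivariateGaussian 0 S with hμ
  let Λ : EuclideanSpace ℝ κ →L[ℝ] ℝ := ∑ k ∈ s, EuclideanSpace.proj (c k)
  have hΛ : ∀ z, Λ z = ∑ k ∈ s, z (c k) := fun z => by simp [Λ]
  have hmean : ∫ z, Λ z ∂μ = 0 := by
    simp only [hΛ]
    rw [integral_finsetSum]
    · simp [μ, integral_eval_gaussian]
    · exact fun k _ => (memLp_eval_gaussian S (c k) (p := 1) (by norm_num)).integrable le_rfl
  have hvar : Var[Λ; μ] = ∑ k ∈ s, ∑ l ∈ s, S (c k) (c l) := by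
    rw [variance_of_integral_eq_zero (by fun_prop) hmean]
    simp only [hΛ, sq, Finset.sum_mul_sum]
    rw [integral_finsetSum]
    · refine Finset.sum_congr rfl fun k _ => ?_
      rw [integral_finsetSum]
      · exact Finset.sum_congr rfl fun l _ => integral_mul_gaussian hS _ _
      · exact fun l _ => integrable_mul_gaussian S _ _
    · exact fun k _ => integrable_finsetSum _ fun l _ => integrable_mul_gaussian S _ _
  have hmap : μ.map Λ = gaussianReal 0 (Var[Λ; μ]).toNNReal := by
    rw [IsGaussian.map_eq_gaussianReal Λ, hmean]
  have h1 : ∫ z, (∑ k ∈ s, z (c k)) ^ m ∂μ = ∫ x, x ^ m ∂(μ.map Λ) := by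
    rw [integral_map (by fun_prop) (by fun_prop)]
    simp only [hΛ]
  rw [h1, hmap, integral_pow_gaussianReal, hvar]
  congr 3
  rw [Real.coe_toNNReal']
  refine max_eq_left ?_
  rw [← hvar]
  exact variance_nonneg _ _

lemma integrable_sum_pow_gaussian (S : Matrix κ κ ℝ) {ι : Type*} (s : Finset ι) (c : ι → κ)
    (m : ℕ) :
    Integrable (fun z : EuclideanSpace ℝ κ => (∑ k ∈ s, z (c k)) ^ m)
      (multivariateGaussian 0 S) := by
  let Λ : EuclideanSpace ℝ κ →L[ℝ] ℝ := ∑ k ∈ s, EuclideanSpace.proj (c k)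
  have hΛ : ∀ z, Λ z = ∑ k ∈ s, z (c k) := fun z => by simp [Λ]
  simp only [← hΛ]
  have h := IsGaussian.memLp_dual (multivariateGaussian 0 S) Λ m (by simp)
  have h2 := h.integrable_norm_pow'
  refine h2.mono' (by fun_prop) (Filter.Eventually.of_forall fun z => ?_)
  rw [norm_pow]

/-- A product of `m` real numbers is a linear combination of `m`-th powers of their partial
sums. -/
lemma exists_polarization (m : ℕ) : ∃ C : ℝ, ∀ x : Fin m → ℝ,
    ∏ k, x k = C * ∑ u : Finset (Fin m), (-1 : ℝ) ^ u.card * (∑ k ∈ uᶜ, x k) ^ m := by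
  classical
  -- Expand the power over all maps f from the factors to the indices; those with range outside u
  -- survive.
  have hpow : ∀ (x : Fin m → ℝ) (u : Finset (Fin m)), (∑ k ∈ uᶜ, x k) ^ m
      = ∑ f : Fin m → Fin m, if u ⊆ (Finset.univ.image f)ᶜ then ∏ i, x (f i) else 0 := by
    intro x u
    have h := Finset.prod_univ_sum (fun _ : Fin m => uᶜ) (fun _ k => x k)
    rw [Finset.prod_const, Finset.card_univ, Fintype.card_fin] at h
    rw [h, ← Finset.sum_filter]
    refine Finset.sum_congr ?_ fun _ _ => rfl
    ext f
    simp only [Fintype.mem_piFinset, Finset.mem_compl, Finset.mem_filter, Finset.mem_univ,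
      true_and, Finset.subset_iff, Finset.mem_image, not_exists]
    exact ⟨fun h a ha i hi => h i (hi ▸ ha), fun h i hi => h hi i rfl⟩
  -- The alternating sum over u cancels unless the complement of the range is empty, that is, unless
  -- f is surjective and hence bijective.
  have hsign : ∀ f : Fin m → Fin m,
      (∑ u : Finset (Fin m), if u ⊆ (Finset.univ.image f)ᶜ then (-1 : ℝ) ^ u.card else 0)
        = if Function.Bijective f then 1 else 0 := by
    intro f
    have h := @Finset.sum_powerset_neg_one_pow_card _ _ (Finset.univ.image f)ᶜ
    have h2 : ((Finset.univ.image f)ᶜ = ∅) ↔ Function.Bijective f := by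
      rw [Finset.compl_eq_empty_iff, Finset.eq_univ_iff_forall]
      simp only [Finset.mem_image, Finset.mem_univ, true_and]
      change Function.Surjective f ↔ _
      exact ⟨fun h => ⟨Finite.injective_iff_surjective.2 h, h⟩, fun h => h.2⟩
    rw [← Finset.sum_filter]
    have h3 : Finset.univ.filter (fun u => u ⊆ (Finset.univ.image f)ᶜ)
        = (Finset.univ.image f)ᶜ.powerset := by ext; simp
    rw [h3]
    have h4 := congrArg (Int.cast : ℤ → ℝ) h
    push_cast at h4
    rw [h4]
    simp [h2]
  set n := (Finset.univ.filter fun f : Fin m → Fin m => Function.Bijective f).card with hn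
  have hn0 : (n : ℝ) ≠ 0 := by
    have : 0 < n := Finset.card_pos.2 ⟨id, Finset.mem_filter.2 ⟨Finset.mem_univ _, Function.bijective_id⟩⟩
    positivity
  refine ⟨(n : ℝ)⁻¹, fun x => ?_⟩
  have hsum : ∑ u : Finset (Fin m), (-1 : ℝ) ^ u.card * (∑ k ∈ uᶜ, x k) ^ m = n * ∏ k, x k := by
    calc _ = ∑ u : Finset (Fin m), ∑ f : Fin m → Fin m,
          (if u ⊆ (Finset.univ.image f)ᶜ then (-1 : ℝ) ^ u.card else 0) * ∏ i, x (f i) := by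
          refine Finset.sum_congr rfl fun u _ => ?_
          rw [hpow, Finset.mul_sum]
          refine Finset.sum_congr rfl fun f _ => ?_
          split_ifs <;> simp
      _ = ∑ f : Fin m → Fin m, (if Function.Bijective f then 1 else 0) * ∏ i, x (f i) := by
          rw [Finset.sum_comm]
          refine Finset.sum_congr rfl fun f _ => ?_
          rw [← Finset.sum_mul, hsign]
      _ = ∑ f : Fin m → Fin m, if Function.Bijective f then ∏ i, x i else 0 := by
          refine Finset.sum_congr rfl fun f _ => ?_
          split_ifs with hf
          · rw [one_mul]
            exact Function.Bijective.prod_comp hf x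
          · rw [zero_mul]
      _ = n * ∏ k, x k := by
          rw [← Finset.sum_filter, Finset.sum_const, nsmul_eq_mul]
  rw [hsum, ← mul_assoc, inv_mul_cancel₀ hn0, one_mul]

/-- Moments of centred Gaussian measures depend uniformly continuously on the covariances. -/
lemma exists_delta_moments (m : ℕ) (C : ℝ) {ε : ℝ} (hε : 0 < ε) :
    ∃ δ > 0, ∀ {κ : Type} [Fintype κ] [DecidableEq κ] {S S' : Matrix κ κ ℝ}, S.PosSemidef →
      S'.PosSemidef → ∀ c : Fin m → κ,
      (∀ k l, |S (c k) (c l)| ≤ C) → (∀ k l, |S' (c k) (c l)| ≤ C) →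
      (∀ k l, |S (c k) (c l) - S' (c k) (c l)| ≤ δ) →
      |∫ z : EuclideanSpace ℝ κ, ∏ k, z (c k) ∂(multivariateGaussian 0 S)
        - ∫ z : EuclideanSpace ℝ κ, ∏ k, z (c k) ∂(multivariateGaussian 0 S')| ≤ ε := by
  obtain ⟨A, hA⟩ := exists_polarization m
  -- There are 2 ^ m subsets in the polarization formula; the summand 1 makes the bound positive.
  set Q := |A| * (2 ^ m * |stdMoment m|) + 1 with hQ
  have hQ0 : 0 < Q := by positivity
  -- All variances that occur lie in this compact interval, so the modulus of continuity does not
  -- depend on the Gaussian or on its dimension.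
  have hcont : ContinuousOn (fun v : ℝ => Real.sqrt v ^ m) (Set.Icc 0 (m * (m * C))) := by
    fun_prop
  obtain ⟨η, hη, hunif⟩ := Metric.uniformContinuousOn_iff_le.1
    (isCompact_Icc.uniformContinuousOn_of_continuous hcont) (ε / Q) (by positivity)
  -- A variance is a sum of at most m * m covariances; adding 1 covers m = 0.
  refine ⟨η / (m * m + 1), by positivity, ?_⟩
  intro κ _ _ S S' hS hS' c hC hC' hδ
  have hint : ∀ {S : Matrix κ κ ℝ}, S.PosSemidef →
      ∫ z : EuclideanSpace ℝ κ, ∏ k, z (c k) ∂(multivariateGaussian 0 S)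
      = A * ∑ u : Finset (Fin m), (-1 : ℝ) ^ u.card *
        (Real.sqrt (∑ k ∈ uᶜ, ∑ l ∈ uᶜ, S (c k) (c l)) ^ m * stdMoment m) := by
    intro S hS
    simp only [hA]
    rw [integral_const_mul, integral_finsetSum]
    · congr 1
      refine Finset.sum_congr rfl fun u _ => ?_
      rw [integral_const_mul, integral_sum_pow_gaussian hS]
    · exact fun u _ => (integrable_sum_pow_gaussian S _ _ _).const_mul _
  have hcard : ∀ u : Finset (Fin m), (u.card : ℝ) ≤ m := fun u => by
    have := u.card_le_univ
    rw [Fintype.card_fin] at this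
    exact_mod_cast this
  have hsum : ∀ (F : Fin m → Fin m → ℝ) (D : ℝ), 0 ≤ D → (∀ k l, |F k l| ≤ D) →
      ∀ u : Finset (Fin m), |∑ k ∈ u, ∑ l ∈ u, F k l| ≤ m * (m * D) := by
    intro F D hD hF u
    have h1 : ∀ k, |∑ l ∈ u, F k l| ≤ m * D := fun k => by
      refine (Finset.abs_sum_le_sum_abs _ _).trans
        ((Finset.sum_le_card_nsmul _ _ _ fun l _ => hF k l).trans ?_)
      rw [nsmul_eq_mul]
      exact mul_le_mul_of_nonneg_right (hcard u) hD
    refine (Finset.abs_sum_le_sum_abs _ _).trans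
      ((Finset.sum_le_card_nsmul _ _ _ fun k _ => h1 k).trans ?_)
    rw [nsmul_eq_mul]
    exact mul_le_mul_of_nonneg_right (hcard u) (by positivity)
  have hmem : ∀ {S : Matrix κ κ ℝ}, S.PosSemidef → (∀ k l, |S (c k) (c l)| ≤ C) →
      ∀ u : Finset (Fin m), ∑ k ∈ u, ∑ l ∈ u, S (c k) (c l) ∈ Set.Icc 0 (m * (m * C)) := by
    intro S hS hC u
    constructor
    · have h := (hS.submatrix c).dotProduct_mulVec_nonneg fun k => if k ∈ u then 1 else 0
      simpa [dotProduct, Matrix.mulVec, Finset.sum_ite_mem] using h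
    -- For m = 0 nothing forces C to be nonnegative, but the sums are empty.
    · rcases m.eq_zero_or_pos with h0 | h0
      · subst h0
        simp [Finset.eq_empty_of_isEmpty u]
      · have hC0 : 0 ≤ C := (abs_nonneg _).trans (hC ⟨0, h0⟩ ⟨0, h0⟩)
        exact (le_abs_self _).trans (hsum _ C hC0 hC u)
  rw [hint hS, hint hS', ← mul_sub, ← Finset.sum_sub_distrib, abs_mul]
  have hterm : ∀ u : Finset (Fin m),
      |(-1 : ℝ) ^ u.card * (Real.sqrt (∑ k ∈ uᶜ, ∑ l ∈ uᶜ, S (c k) (c l)) ^ m * stdMoment m)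
        - (-1 : ℝ) ^ u.card * (Real.sqrt (∑ k ∈ uᶜ, ∑ l ∈ uᶜ, S' (c k) (c l)) ^ m * stdMoment m)|
      ≤ ε / Q * |stdMoment m| := by
    intro u
    rw [← mul_sub, ← sub_mul, abs_mul, abs_mul, abs_pow, abs_neg, abs_one, one_pow, one_mul]
    refine mul_le_mul_of_nonneg_right ?_ (abs_nonneg _)
    have h := hunif _ (hmem hS hC uᶜ) _ (hmem hS' hC' uᶜ) (by
      rw [Real.dist_eq, ← Finset.sum_sub_distrib]
      simp only [← Finset.sum_sub_distrib]
      refine (hsum _ (η / (m * m + 1)) (by positivity) hδ uᶜ).trans ?_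
      rw [← mul_assoc, mul_div_assoc', div_le_iff₀ (by positivity)]
      nlinarith)
    rwa [Real.dist_eq] at h
  calc _ ≤ |A| * ∑ u : Finset (Fin m), ε / Q * |stdMoment m| := by
        refine mul_le_mul_of_nonneg_left ?_ (abs_nonneg _)
        exact (Finset.abs_sum_le_sum_abs _ _).trans (Finset.sum_le_sum fun u _ => hterm u)
    _ = ε * (|A| * (2 ^ m * |stdMoment m|) / Q) := by
        rw [Finset.sum_const, Finset.card_univ, Fintype.card_finset, Fintype.card_fin,
          nsmul_eq_mul]
        push_cast; ring
    _ ≤ ε * 1 := by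
        refine mul_le_mul_of_nonneg_left ?_ hε.le
        rw [div_le_one hQ0, hQ]; linarith
    _ = ε := mul_one _

end GaussianMoments

/-! ### Uniqueness of the stationary measure -/

section Stationary

variable {κ : Type*} [Fintype κ] [DecidableEq κ]

lemma charFun_map_toEuclideanCLM (μ : Measure (EuclideanSpace ℝ κ)) (M : Matrix κ κ ℝ)
    (ξ : EuclideanSpace ℝ κ) :
    charFun (μ.map (Matrix.toEuclideanCLM (𝕜 := ℝ) M)) ξ
      = charFun μ (WithLp.toLp 2 (M.transpose.mulVec ξ)) := by
  rw [charFun_apply, charFun_apply, integral_map (by fun_prop) (by fun_prop)]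
  refine integral_congr_ae (Filter.Eventually.of_forall fun x => ?_)
  have h : inner ℝ (Matrix.toEuclideanCLM (𝕜 := ℝ) M x) ξ
      = inner ℝ x (WithLp.toLp 2 (M.transpose.mulVec ξ)) := by
    rw [real_inner_comm, Matrix.inner_toEuclideanCLM, Matrix.dotProduct_mulVec,
      ← Matrix.mulVec_transpose, EuclideanSpace.inner_eq_star_dotProduct]
    simp
  simp only [h]

/-- The Ornstein-Uhlenbeck semigroup of a stable drift matrix has a unique stationary
probability measure. -/
lemma IsStable.stationary_iff {B : Matrix κ κ ℝ} (h : IsStable B) {D : Matrix κ κ ℝ}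
    (hD : D.PosSemidef) (μ : Measure (EuclideanSpace ℝ κ)) :
    (IsProbabilityMeasure μ ∧ ∀ t : ℝ, 0 ≤ t →
      (μ.map (Matrix.toEuclideanCLM (𝕜 := ℝ) (flow B t))) ∗ multivariateGaussian 0
        (Matrix.of fun b c => ∫ s in (0 : ℝ)..t, propagated B D s b c) = μ) ↔
      μ = multivariateGaussian 0 (lyapunov B D) := by
  have hS := h.lyapunov_posSemidef hD
  have hR := fun t (ht : 0 ≤ t) => intervalIntegral_propagated_posSemidef B hD ht
  have hquad : ∀ (t : ℝ) (ξ : κ → ℝ),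
      ξ ⬝ᵥ (Matrix.of fun b c => ∫ s in (0 : ℝ)..t, propagated B D s b c).mulVec ξ
        = ξ ⬝ᵥ (lyapunov B D).mulVec ξ
          - ((flow B t).transpose.mulVec ξ) ⬝ᵥ (lyapunov B D).mulVec
            ((flow B t).transpose.mulVec ξ) := by
    intro t ξ
    have e : (Matrix.of fun b c => ∫ s in (0 : ℝ)..t, propagated B D s b c)
        = lyapunov B D - propagated B (lyapunov B D) t := by
      ext b c
      simp [h.intervalIntegral_propagated]
    rw [e, Matrix.sub_mulVec, dotProduct_sub, propagated]
    congr 1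
    rw [← Matrix.mulVec_mulVec, ← Matrix.mulVec_mulVec, Matrix.dotProduct_mulVec,
      ← Matrix.mulVec_transpose]
  constructor
  · rintro ⟨hμ, hstat⟩
    refine Measure.ext_of_charFun ?_
    ext ξ
    -- Stationarity on the level of characteristic functions. As t → ∞ the propagated argument tends
    -- to 0, where the characteristic function is 1, and only the Gaussian factor with the full
    -- covariance remains.
    have hev : ∀ t, 0 ≤ t → charFun μ ξ =
        charFun μ (WithLp.toLp 2 ((flow B t).transpose.mulVec ξ)) *
        Complex.exp (-(((ξ ⬝ᵥ (lyapunov B D).mulVec ξ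
          - ((flow B t).transpose.mulVec ξ) ⬝ᵥ (lyapunov B D).mulVec
            ((flow B t).transpose.mulVec ξ) : ℝ) : ℂ) / 2)) := by
      intro t ht
      have : IsProbabilityMeasure (μ.map (Matrix.toEuclideanCLM (𝕜 := ℝ) (flow B t))) :=
        Measure.isProbabilityMeasure_map (by fun_prop)
      conv_lhs => rw [← hstat t ht]
      rw [charFun_conv, charFun_map_toEuclideanCLM, charFun_multivariateGaussian (hR t ht),
        hquad]
      simp
    have hvec : ∀ b, Filter.Tendsto (fun t => (flow B t).transpose.mulVec ξ b) Filter.atTop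
        (nhds 0) := by
      intro b
      simp only [Matrix.mulVec, dotProduct, Matrix.transpose_apply]
      rw [show (0 : ℝ) = ∑ c, 0 * ξ c by simp]
      exact tendsto_finsetSum _ fun c _ => (h.tendsto_flow c b).mul_const _
    have hvec' : Filter.Tendsto (fun t => (flow B t).transpose.mulVec ξ) Filter.atTop
        (nhds (0 : κ → ℝ)) := tendsto_pi_nhds.2 hvec
    have h1 : Filter.Tendsto (fun t => charFun μ (WithLp.toLp 2 ((flow B t).transpose.mulVec ξ)))
        Filter.atTop (nhds (charFun μ 0)) := by
      refine (continuous_charFun.tendsto _).comp ?_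
      exact ((PiLp.continuous_toLp 2 _).tendsto 0).comp hvec'
    have h2 : Filter.Tendsto (fun t => ((flow B t).transpose.mulVec ξ) ⬝ᵥ
        (lyapunov B D).mulVec ((flow B t).transpose.mulVec ξ)) Filter.atTop (nhds 0) := by
      have hc : Continuous fun v : κ → ℝ => v ⬝ᵥ (lyapunov B D).mulVec v := by fun_prop
      have := (hc.tendsto 0).comp hvec'
      rw [zero_dotProduct] at this
      exact this
    have h3 : Filter.Tendsto (fun t => charFun μ (WithLp.toLp 2 ((flow B t).transpose.mulVec ξ)) *
        Complex.exp (-(((ξ ⬝ᵥ (lyapunov B D).mulVec ξ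
          - ((flow B t).transpose.mulVec ξ) ⬝ᵥ (lyapunov B D).mulVec
            ((flow B t).transpose.mulVec ξ) : ℝ) : ℂ) / 2))) Filter.atTop
        (nhds (charFun μ 0 * Complex.exp (-(((ξ ⬝ᵥ (lyapunov B D).mulVec ξ - 0 : ℝ) : ℂ) / 2)))) := by
      refine h1.mul ((Complex.continuous_exp.tendsto _).comp ?_)
      have := (Complex.continuous_ofReal.tendsto _).comp (h2.const_sub (ξ ⬝ᵥ (lyapunov B D).mulVec ξ))
      exact (this.div_const 2).neg
    have h4 : Filter.Tendsto (fun _ : ℝ => charFun μ ξ) Filter.atTop (nhds (charFun μ ξ)) :=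
      tendsto_const_nhds
    have h5 := tendsto_nhds_unique (h3.congr' (by
      filter_upwards [Filter.eventually_ge_atTop 0] with t ht
      exact (hev t ht).symm)) h4
    rw [← h5, charFun_multivariateGaussian hS]
    simp
  · rintro rfl
    refine ⟨inferInstance, fun t ht => ?_⟩
    have : IsProbabilityMeasure ((multivariateGaussian 0 (lyapunov B D)).map
        (Matrix.toEuclideanCLM (𝕜 := ℝ) (flow B t))) :=
      Measure.isProbabilityMeasure_map (by fun_prop)
    refine Measure.ext_of_charFun ?_
    ext ξ
    rw [charFun_conv, charFun_map_toEuclideanCLM, charFun_multivariateGaussian (hR t ht),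
      hquad, charFun_multivariateGaussian hS, charFun_multivariateGaussian hS, ← Complex.exp_add]
    congr 1
    simp
    ring

end Stationary

end Crystal

namespace Crystal

/-! ### Schur's test for nonnegative symmetric matrices -/

section Schur

variable {ι : Type*} [Fintype ι]

lemma dotProduct_mulVec_le_of_rowSum {O : Matrix ι ι ℝ} {r : ℝ} (h0 : ∀ x y, 0 ≤ O x y)
    (hsymm : O.transpose = O) (hr : ∀ x, ∑ y, O x y ≤ r) (v : ι → ℝ) :
    v ⬝ᵥ O.mulVec v ≤ r * (v ⬝ᵥ v) := by
  have hs : ∀ x y, O y x = O x y := fun x y => congrFun (congrFun hsymm x) y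
  have h1 : ∑ x, ∑ y, O x y * v y ^ 2 = ∑ x, ∑ y, O x y * v x ^ 2 := by
    rw [Finset.sum_comm]
    exact Finset.sum_congr rfl fun x _ => Finset.sum_congr rfl fun y _ => by rw [hs]
  have h2 : ∑ x, ∑ y, O x y * v x ^ 2 ≤ r * (v ⬝ᵥ v) := by
    rw [dotProduct, Finset.mul_sum]
    refine Finset.sum_le_sum fun x _ => ?_
    rw [← Finset.sum_mul, ← sq]
    exact mul_le_mul_of_nonneg_right (hr x) (sq_nonneg _)
  calc v ⬝ᵥ O.mulVec v = ∑ x, ∑ y, O x y * (v x * v y) := by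
        simp only [dotProduct, Matrix.mulVec, Finset.mul_sum]
        exact Finset.sum_congr rfl fun x _ => Finset.sum_congr rfl fun y _ => by ring
    _ ≤ ∑ x, ∑ y, (1 / 2 * (O x y * v x ^ 2) + 1 / 2 * (O x y * v y ^ 2)) := by
        refine Finset.sum_le_sum fun x _ => Finset.sum_le_sum fun y _ => ?_
        nlinarith [mul_nonneg (h0 x y) (sq_nonneg (v x - v y))]
    _ = ∑ x, ∑ y, O x y * v x ^ 2 := by
        simp only [Finset.sum_add_distrib, ← Finset.mul_sum]
        rw [h1]; ring
    _ ≤ _ := h2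

lemma mulVec_dotProduct_mulVec_le_of_rowSum {O : Matrix ι ι ℝ} {r : ℝ} (h0 : ∀ x y, 0 ≤ O x y)
    (hr0 : 0 ≤ r) (hsymm : O.transpose = O) (hr : ∀ x, ∑ y, O x y ≤ r) (v : ι → ℝ) :
    O.mulVec v ⬝ᵥ O.mulVec v ≤ r ^ 2 * (v ⬝ᵥ v) := by
  have hs : ∀ x y, O y x = O x y := fun x y => congrFun (congrFun hsymm x) y
  have h1 : ∀ x, O.mulVec v x * O.mulVec v x ≤ r * ∑ y, O x y * v y ^ 2 := by
    intro x
    have h := Finset.sum_sq_le_sum_mul_sum_of_sq_le_mul Finset.univ (r := fun y => O x y * v y)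
      (f := fun y => O x y) (g := fun y => O x y * v y ^ 2) (fun y _ => h0 x y)
      (fun y _ => mul_nonneg (h0 x y) (sq_nonneg _)) (fun y _ => le_of_eq (by ring))
    rw [← sq]
    exact h.trans (mul_le_mul_of_nonneg_right (hr x)
      (Finset.sum_nonneg fun y _ => mul_nonneg (h0 x y) (sq_nonneg _)))
  calc O.mulVec v ⬝ᵥ O.mulVec v ≤ ∑ x, r * ∑ y, O x y * v y ^ 2 :=
        Finset.sum_le_sum fun x _ => h1 x
    _ = r * ∑ y, (∑ x, O y x) * v y ^ 2 := by
        rw [← Finset.mul_sum, Finset.sum_comm]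
        congr 1
        refine Finset.sum_congr rfl fun y _ => ?_
        rw [Finset.sum_mul]
        exact Finset.sum_congr rfl fun x _ => by rw [hs]
    _ ≤ r * ∑ y, r * v y ^ 2 := by
        refine mul_le_mul_of_nonneg_left (Finset.sum_le_sum fun y _ => ?_) hr0
        exact mul_le_mul_of_nonneg_right (hr y) (sq_nonneg _)
    _ = _ := by rw [← Finset.mul_sum, dotProduct]; simp only [sq]; ring

lemma sum_ite_le_one {p : ι → Prop} [DecidablePred p] (h : ∀ x y, p x → p y → x = y) :
    ∑ x, (if p x then (1 : ℝ) else 0) ≤ 1 := by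
  rw [Finset.sum_boole]
  exact_mod_cast Finset.card_le_one.2 fun x hx y hy =>
    h x y (Finset.mem_filter.1 hx).2 (Finset.mem_filter.1 hy).2

end Schur

/-! ### The lattice, its reflections and matrices supported on bonds -/

section Lattice

variable {N n : ℕ} {L : Fin n → ℕ}

/-- `y` is the neighbour of `x` in the positive first direction. -/
def IsUp (x y : Site N L) : Prop := (y.1 : ℕ) = (x.1 : ℕ) + 1 ∧ y.2 = x.2

instance (x y : Site N L) : Decidable (IsUp x y) := inferInstanceAs (Decidable (_ ∧ _))

/-- The hopping matrix: the off-diagonal part of the Laplacian (with multiplicities). -/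
def hop (N : ℕ) (L : Fin n → ℕ) : Matrix (Site N L) (Site N L) ℝ :=
  Matrix.of fun x y => (if IsUp x y then 1 else 0) + (if IsUp y x then 1 else 0)
    + ∑ a : Fin n, ((if y = shift a x then 1 else 0) + (if x = shift a y then 1 else 0))

/-- Because hops are counted with multiplicity, the diagonal coefficient is the same for all side
lengths, including 1 and 2, where hops coincide or return to their starting site. -/
lemma potential_eq (ω γ : ℝ) (hω : 0 < ω) (N : ℕ) (L : Fin n → ℕ) :
    potential ω γ N L = (ω ^ 2 * (2 + 2 * n) + γ ^ 2) • (1 : Matrix (Site N L) (Site N L) ℝ)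
      - ω ^ 2 • hop N L := by
  ext x y
  simp only [potential, laplacian, hop, Matrix.smul_apply, Matrix.add_apply, Matrix.neg_apply,
    Matrix.sub_apply, Matrix.of_apply, smul_eq_mul, Matrix.one_apply, Finset.sum_sub_distrib,
    Finset.sum_const, Finset.card_univ, Fintype.card_fin, nsmul_eq_mul]
  have h1 : (if x.2 = y.2 then
      (if (y.1 : ℕ) = (x.1 : ℕ) + 1 then (1 : ℝ) else 0)
        + (if (x.1 : ℕ) = (y.1 : ℕ) + 1 then 1 else 0)
        - 2 * (if x.1 = y.1 then 1 else 0) else 0)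
      = (if IsUp x y then 1 else 0) + (if IsUp y x then 1 else 0)
        - 2 * (if x = y then 1 else 0) := by
    by_cases h : x.2 = y.2
    · simp [IsUp, h, Prod.ext_iff]
    · simp [IsUp, h, Ne.symm h, Prod.ext_iff]
  rw [h1]
  field_simp
  ring

lemma shift_injective (a : Fin n) : Function.Injective (shift a : Site N L → Site N L) := by
  intro x y h
  simp only [shift, Prod.mk.injEq, add_left_inj] at h
  exact Prod.ext h.1 h.2

lemma hop_nonneg (x y : Site N L) : 0 ≤ hop N L x y := by
  simp only [hop, Matrix.of_apply]
  refine add_nonneg (add_nonneg ?_ ?_) (Finset.sum_nonneg fun a _ => add_nonneg ?_ ?_) <;>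
    split_ifs <;> norm_num

lemma hop_transpose : (hop N L).transpose = hop N L := by
  ext x y
  simp only [hop, Matrix.transpose_apply, Matrix.of_apply]
  rw [add_comm (if IsUp y x then (1 : ℝ) else 0)]
  congr 1
  exact Finset.sum_congr rfl fun a _ => add_comm _ _

lemma not_eq_shift_of_isUp {x y : Site N L} (h : IsUp x y) (a : Fin n) :
    y ≠ shift a x ∧ x ≠ shift a y := by
  constructor
  · intro h1
    have h2 : (y.1 : ℕ) = x.1 := by rw [h1]; rfl
    have := h.1
    omega
  · intro h1
    have h2 : (x.1 : ℕ) = y.1 := by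
      conv_lhs => rw [h1]
      rfl
    have := h.1
    omega

lemma hop_of_isUp {x y : Site N L} (h : IsUp x y) : hop N L x y = 1 := by
  have h2 : ¬ IsUp y x := fun h' => by have := h.1; have := h'.1; omega
  simp [hop, h, h2, (not_eq_shift_of_isUp h _).1, (not_eq_shift_of_isUp h _).2]

lemma IsUp.ne {x y : Site N L} (h : IsUp x y) : x ≠ y := by
  rintro rfl
  have := h.1
  omega

lemma potential_symm {ω γ : ℝ} (hω : 0 < ω) :
    (potential ω γ N L).transpose = potential ω γ N L := by
  rw [potential_eq ω γ hω, Matrix.transpose_sub, Matrix.transpose_smul, Matrix.transpose_smul,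
    hop_transpose, Matrix.transpose_one]

lemma potential_of_isUp {ω γ : ℝ} (hω : 0 < ω) {x y : Site N L} (h : IsUp x y) :
    potential ω γ N L x y = -ω ^ 2 ∧ potential ω γ N L y x = -ω ^ 2 := by
  have h1 : potential ω γ N L x y = -ω ^ 2 := by
    rw [potential_eq ω γ hω]
    simp [h.ne, hop_of_isUp h]
  refine ⟨h1, ?_⟩
  rw [← h1]
  exact congrFun (congrFun (potential_symm hω) x) y

/-- The reflection `j ↦ c - j` of the periodic directions. -/
def reflect (c : (a : Fin n) → ZMod (L a)) : Site N L ≃ Site N L :=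
  Equiv.prodCongr (Equiv.refl _) (Equiv.subLeft c)

lemma reflect_fst (c : (a : Fin n) → ZMod (L a)) (x : Site N L) : (reflect c x).1 = x.1 := rfl

lemma reflect_snd (c : (a : Fin n) → ZMod (L a)) (x : Site N L) :
    (reflect c x).2 = c - x.2 := rfl

lemma reflect_eq_shift (c : (a : Fin n) → ZMod (L a)) (a : Fin n) (x y : Site N L) :
    reflect c y = shift a (reflect c x) ↔ x = shift a y := by
  rw [Prod.ext_iff, Prod.ext_iff]
  simp only [reflect_fst, reflect_snd, shift]
  refine and_congr ⟨fun h => h.symm, fun h => h.symm⟩ ⟨fun h => ?_, fun h => ?_⟩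
  · have : x.2 = c - (c - x.2 + Pi.single a 1) + Pi.single a 1 := by abel
    rw [this, ← h]; abel
  · rw [h]; abel

lemma reflect_isUp (c : (a : Fin n) → ZMod (L a)) (x y : Site N L) :
    IsUp (reflect c x) (reflect c y) ↔ IsUp x y := by
  simp [IsUp, reflect_fst, reflect_snd]

lemma hop_reflect (c : (a : Fin n) → ZMod (L a)) :
    (hop N L).submatrix (reflect c) (reflect c) = hop N L := by
  ext x y
  simp only [hop, Matrix.submatrix_apply, Matrix.of_apply, reflect_isUp, reflect_eq_shift]
  congr 1
  exact Finset.sum_congr rfl fun a _ => add_comm _ _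

lemma potential_reflect {ω γ : ℝ} (hω : 0 < ω) (c : (a : Fin n) → ZMod (L a)) :
    (potential ω γ N L).submatrix (reflect c) (reflect c) = potential ω γ N L := by
  rw [potential_eq ω γ hω, Matrix.submatrix_sub, Matrix.submatrix_smul, Matrix.submatrix_smul,
    Pi.sub_apply, Pi.smul_apply, Pi.smul_apply, Pi.sub_apply, Pi.smul_apply, Pi.smul_apply,
    hop_reflect, Matrix.submatrix_one_equiv]

variable [∀ a, NeZero (L a)]

lemma sum_isUp_le (x : Site N L) : ∑ y, (if IsUp x y then (1 : ℝ) else 0) ≤ 1 :=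
  sum_ite_le_one fun _ _ hy hz => Prod.ext (Fin.ext (hy.1.trans hz.1.symm)) (hy.2.trans hz.2.symm)

lemma sum_isUp_le' (x : Site N L) : ∑ y, (if IsUp y x then (1 : ℝ) else 0) ≤ 1 :=
  sum_ite_le_one fun _ _ hy hz => Prod.ext
    (Fin.ext (by have := hy.1; have := hz.1; omega)) (hy.2.symm.trans hz.2)

lemma sum_hop_le (x : Site N L) : ∑ y, hop N L x y ≤ 2 + 2 * n := by
  simp only [hop, Matrix.of_apply, Finset.sum_add_distrib]
  have h1 := sum_isUp_le x
  have h2 := sum_isUp_le' x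
  have h3 : ∑ y, ∑ a : Fin n, (if y = shift a x then (1 : ℝ) else 0) ≤ n := by
    rw [Finset.sum_comm]
    refine (Finset.sum_le_card_nsmul _ _ 1 fun a _ => ?_).trans (by simp)
    exact sum_ite_le_one fun y z hy hz => hy.trans hz.symm
  have h4 : ∑ y, ∑ a : Fin n, (if x = shift a y then (1 : ℝ) else 0) ≤ n := by
    rw [Finset.sum_comm]
    refine (Finset.sum_le_card_nsmul _ _ 1 fun a _ => ?_).trans (by simp)
    exact sum_ite_le_one fun y z hy hz => shift_injective a (hy.symm.trans hz)
  linarith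

/-- An upper bound for the norm of the potential matrix. -/
def potentialBound (ω γ : ℝ) (n : ℕ) : ℝ := 2 * (ω ^ 2 * (2 + 2 * n) + γ ^ 2)

/-- The diagonal coefficient exceeds ω² times the maximal row sum 2 + 2n of the hopping matrix by
exactly γ²; Schur's test then gives bounds that do not see N and L. -/
lemma isElastic_potential {ω γ : ℝ} (hω : 0 < ω) (hγ : 0 < γ) :
    IsElastic (potential ω γ N L) (γ ^ 2) (potentialBound ω γ n) where
  pos := by positivity
  symm := potential_symm hω
  coercive v := by
    rw [potential_eq ω γ hω, Matrix.sub_mulVec, Matrix.smul_mulVec, Matrix.smul_mulVec,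
      Matrix.one_mulVec, dotProduct_sub, dotProduct_smul, dotProduct_smul, smul_eq_mul, smul_eq_mul]
    have h := dotProduct_mulVec_le_of_rowSum hop_nonneg hop_transpose sum_hop_le v (O := hop N L)
    have := mul_le_mul_of_nonneg_left h (sq_nonneg ω)
    linarith
  bounded v := by
    rw [potential_eq ω γ hω, Matrix.sub_mulVec, Matrix.smul_mulVec, Matrix.smul_mulVec,
      Matrix.one_mulVec]
    have h := mulVec_dotProduct_mulVec_le_of_rowSum hop_nonneg (by positivity) hop_transpose
      sum_hop_le v (O := hop N L)
    set w := (hop N L).mulVec v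
    set A := ω ^ 2 * (2 + 2 * (n : ℝ)) + γ ^ 2 with hA
    -- Parallelogram bound: the squared norm of the difference is at most twice the sum of the two
    -- squared norms, each at most A² ‖v‖².
    have h1 := dotProduct_self_nonneg (A • v + ω ^ 2 • w)
    have h2 : (ω ^ 2) ^ 2 * (w ⬝ᵥ w) ≤ A ^ 2 * (v ⬝ᵥ v) := by
      calc (ω ^ 2) ^ 2 * (w ⬝ᵥ w) ≤ (ω ^ 2) ^ 2 * ((2 + 2 * (n : ℝ)) ^ 2 * (v ⬝ᵥ v)) :=
            mul_le_mul_of_nonneg_left h (by positivity)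
        _ = (ω ^ 2 * (2 + 2 * (n : ℝ))) ^ 2 * (v ⬝ᵥ v) := by ring
        _ ≤ _ := mul_le_mul_of_nonneg_right
            (pow_le_pow_left₀ (by positivity) (by rw [hA]; nlinarith) 2) (dotProduct_self_nonneg v)
    simp only [potentialBound, ← hA]
    simp only [sub_dotProduct, dotProduct_sub, add_dotProduct, dotProduct_add, smul_dotProduct,
      dotProduct_smul, smul_eq_mul] at h1 ⊢
    nlinarith

/-- A matrix that is invariant under the reflections of the periodic directions. -/
def IsInvariant (Y : Matrix (Site N L) (Site N L) ℝ) : Prop :=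
  ∀ c, Y.submatrix (reflect c) (reflect c) = Y

/-- The number of sites of a layer. -/
def layerCard (L : Fin n → ℕ) [∀ a, NeZero (L a)] : ℝ :=
  (Fintype.card ((a : Fin n) → ZMod (L a)) : ℝ)

lemma layerCard_pos : 0 < layerCard L := by
  rw [layerCard]
  exact_mod_cast Fintype.card_pos

/-- The reflections carry x to every site of its layer, so each entry reappears in `layerCard L`
different rows. This turns a norm bound proportional to the layer size into a pointwise one. -/
lemma IsInvariant.sq_apply_le {Y : Matrix (Site N L) (Site N L) ℝ} (h : IsInvariant Y)
    (x y : Site N L) : layerCard L * Y x y ^ 2 ≤ hs Y Y := by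
  let F : Site N L → ℝ := fun x => ∑ y, Y x y * Y x y
  have hF : ∀ x, 0 ≤ F x := fun x => Finset.sum_nonneg fun y _ => mul_self_nonneg _
  calc layerCard L * Y x y ^ 2 = ∑ c, Y (reflect c x) (reflect c y) ^ 2 := by
        have : ∀ c, Y (reflect c x) (reflect c y) = Y x y :=
          fun c => congrFun (congrFun (h c) x) y
        simp only [this, Finset.sum_const, Finset.card_univ, nsmul_eq_mul, layerCard]
    _ ≤ ∑ c, F (reflect c x) := by
        refine Finset.sum_le_sum fun c _ => ?_
        rw [sq]
        exact Finset.single_le_sum (f := fun y => Y (reflect c x) y * Y (reflect c x) y)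
          (fun y _ => mul_self_nonneg _) (Finset.mem_univ _)
    _ = ∑ j, F (x.1, j) := Equiv.sum_comp (Equiv.subRight x.2) fun j => F (x.1, j)
    _ ≤ ∑ i, ∑ j, F (i, j) := Finset.single_le_sum (f := fun i => ∑ j, F (i, j))
        (fun i _ => Finset.sum_nonneg fun j _ => hF _) (Finset.mem_univ _)
    _ = hs Y Y := by rw [hs, Fintype.sum_prod_type]

/-- The antisymmetric matrix with weights `D i` on the bonds between the layers `i` and `i + 1`. -/
def bond (N : ℕ) (L : Fin n → ℕ) (D : ℕ → ℝ) : Matrix (Site N L) (Site N L) ℝ :=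
  Matrix.of fun x y => (if IsUp x y then D x.1 else 0) - (if IsUp y x then D y.1 else 0)

lemma sum_isUp (x : Site N L) :
    ∑ y, (if IsUp x y then (1 : ℝ) else 0) = if (x.1 : ℕ) + 1 < N then 1 else 0 := by
  split_ifs with h
  · rw [Finset.sum_eq_single ((⟨x.1 + 1, h⟩, x.2) : Site N L)]
    · simp [IsUp]
    · intro y _ hy
      rw [if_neg]
      rintro ⟨h1, h2⟩
      exact hy (Prod.ext (Fin.ext h1) h2)
    · simp
  · refine Finset.sum_eq_zero fun y _ => if_neg ?_
    rintro ⟨h1, -⟩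
    have := y.1.2
    omega

/-- The pairing with a bond matrix only sees the antisymmetrised nearest-neighbour entries of Y in
the first direction, summed over each layer. -/
lemma hs_bond (D : ℕ → ℝ) (Y : Matrix (Site N L) (Site N L) ℝ)
    (f : ℕ → ((a : Fin n) → ZMod (L a)) → ℝ)
    (hf : ∀ x y, IsUp x y → Y x y - Y y x = f x.1 x.2) :
    hs (bond N L D) Y = ∑ i ∈ Finset.range (N - 1), D i * ∑ j, f i j := by
  have h1 : hs (bond N L D) Y
      = ∑ x : Site N L, ∑ y, if IsUp x y then D x.1 * (Y x y - Y y x) else 0 := by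
    have e1 : hs (bond N L D) Y = ∑ x : Site N L, ∑ y, (if IsUp x y then D x.1 * Y x y else 0)
        - ∑ x : Site N L, ∑ y, (if IsUp y x then D y.1 * Y x y else 0) := by
      simp only [hs, bond, Matrix.of_apply, sub_mul, Finset.sum_sub_distrib, ite_mul, zero_mul]
    rw [e1, Finset.sum_comm (f := fun x y => if IsUp y x then D y.1 * Y x y else 0),
      ← Finset.sum_sub_distrib]
    refine Finset.sum_congr rfl fun x _ => ?_
    rw [← Finset.sum_sub_distrib]
    refine Finset.sum_congr rfl fun y _ => ?_
    split_ifs <;> ring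
  have h2 : ∀ x : Site N L, (∑ y, if IsUp x y then D x.1 * (Y x y - Y y x) else 0)
      = if (x.1 : ℕ) + 1 < N then D x.1 * f x.1 x.2 else 0 := by
    intro x
    have : ∀ y, (if IsUp x y then D x.1 * (Y x y - Y y x) else 0)
        = (if IsUp x y then (1 : ℝ) else 0) * (D x.1 * f x.1 x.2) := by
      intro y
      split_ifs with h
      · rw [hf x y h, one_mul]
      · rw [zero_mul]
    simp only [this]
    rw [← Finset.sum_mul, sum_isUp]
    split_ifs <;> simp
  rw [h1]
  simp only [h2]
  rw [Fintype.sum_prod_type]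
  simp only
  have h3 : ∀ i : Fin N, (∑ j, if (i : ℕ) + 1 < N then D i * f i j else 0)
      = if (i : ℕ) + 1 < N then D i * ∑ j, f i j else 0 := by
    intro i
    split_ifs
    · rw [Finset.mul_sum]
    · simp
  simp only [h3]
  rw [Fin.sum_univ_eq_sum_range (fun i => if i + 1 < N then D i * ∑ j, f i j else 0) N,
    ← Finset.sum_filter]
  refine Finset.sum_congr ?_ fun _ _ => rfl
  ext i
  simp only [Finset.mem_filter, Finset.mem_range]
  omega

lemma hs_bond_self (D : ℕ → ℝ) :
    hs (bond N L D) (bond N L D) = 2 * layerCard L * ∑ i ∈ Finset.range (N - 1), D i ^ 2 := by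
  rw [hs_bond D _ (fun i _ => 2 * D i)]
  · rw [Finset.mul_sum]
    refine Finset.sum_congr rfl fun i _ => ?_
    rw [Finset.sum_const, Finset.card_univ, nsmul_eq_mul, layerCard]
    ring
  · intro x y h
    have h2 : ¬ IsUp y x := fun h' => by have := h.1; have := h'.1; omega
    simp [bond, h, h2]
    ring

/-- The commutator of the potential with a profile that depends on the layer only. -/
lemma comm_potential_diagonal {ω γ : ℝ} (hω : 0 < ω) {T : Site N L → ℝ} {τ : ℕ → ℝ}
    (hT : ∀ x, T x = τ x.1) :
    comm (potential ω γ N L) (Matrix.diagonal T)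
      = bond N L fun i => ω ^ 2 * (τ i - τ (i + 1)) := by
  ext x y
  have e : comm (potential ω γ N L) (Matrix.diagonal T) x y
      = potential ω γ N L x y * (T y - T x) := by
    simp only [comm, Matrix.sub_apply, Matrix.mul_diagonal, Matrix.diagonal_mul]
    ring
  rw [e, hT, hT]
  simp only [bond, Matrix.of_apply]
  by_cases h1 : IsUp x y
  · have h2 : ¬ IsUp y x := fun h' => by have := h1.1; have := h'.1; omega
    rw [if_pos h1, if_neg h2, (potential_of_isUp hω h1).1, h1.1]
    ring
  by_cases h2 : IsUp y x
  · rw [if_neg h1, if_pos h2, (potential_of_isUp hω h2).2, h2.1]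
    ring
  · rw [if_neg h1, if_neg h2, sub_zero]
    by_cases h3 : x.1 = y.1
    · rw [h3, sub_self, mul_zero]
    · have h4 : potential ω γ N L x y = 0 := by
        rw [potential_eq ω γ hω]
        have e1 : x ≠ y := fun h => h3 (by rw [h])
        have e2 : ∀ a, y ≠ shift a x := fun a h => h3 (by rw [h]; rfl)
        have e3 : ∀ a, x ≠ shift a y := fun a h => h3 (by
          have : x.1 = (shift a y).1 := congrArg Prod.fst h
          exact this)
        simp [e1, hop, h1, h2, e2, e3]
      rw [h4, zero_mul]

end Lattice

end Crystal

namespace Crystal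

/-! ### Heat exchange: maximum principle, uniqueness and existence -/

section Harmonic

variable {ι : Type*} [Fintype ι] [DecidableEq ι] {Φ : Matrix ι ι ℝ} {g K lam : ℝ}

/-- The mean energy exchange with the heat baths, up to the factor `lam`. -/
noncomputable def exchange (Φ : Matrix ι ι ℝ) (lam : ℝ) : (ι → ℝ) →ₗ[ℝ] (ι → ℝ) where
  toFun T x := T x - ∑ y, kineticKernel Φ lam x y * T y
  map_add' T T' := by
    ext x
    simp only [Pi.add_apply, mul_add, Finset.sum_add_distrib]
    ring
  map_smul' c T := by
    ext x
    simp only [Pi.smul_apply, smul_eq_mul, RingHom.id_apply, mul_sub, Finset.mul_sum]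
    congr 1
    exact Finset.sum_congr rfl fun y _ => by ring

lemma exchange_eq (hΦ : IsElastic Φ g K) (hlam : 0 < lam) (T : ι → ℝ) (x : ι) :
    exchange Φ lam T x = T x - (cov Φ lam T).toBlocks₂₂ x x := by
  rw [cov_inr_inr hΦ hlam]; rfl

lemma exchange_const (hΦ : IsElastic Φ g K) (hlam : 0 < lam) (θ : ℝ) :
    exchange Φ lam (fun _ => θ) = 0 := by
  ext x
  have h := ((isSteadyMoments_cov hΦ hlam fun _ => θ).unique
    (IsSteadyMoments.const hΦ θ) hΦ hlam).2.2
  rw [exchange_eq hΦ hlam, h]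
  simp

/-- A system whose boundary sites are connected to all sites through `Φ`. -/
def IsAnchored (Φ : Matrix ι ι ℝ) (bd : ι → Prop) : Prop :=
  ∀ T : ι → ℝ, (∀ x y, Φ x y ≠ 0 → T x = T y) → (∀ x, bd x → T x = 0) → T = 0

variable {bd : ι → Prop}

/-- Vanishing energy forces T to be constant along the bonds, and anchoring spreads the boundary
value zero to every site. -/
lemma eq_zero_of_sum_exchange_nonpos (hΦ : IsElastic Φ g K) (hlam : 0 < lam)
    (hbd : IsAnchored Φ bd) {T : ι → ℝ} (hT : ∀ x, bd x → T x = 0)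
    (h : ∑ x, T x * exchange Φ lam T x ≤ 0) : T = 0 := by
  refine hbd T (fun x y hxy => ?_) hT
  simp only [exchange_eq hΦ hlam] at h
  exact (isSteadyMoments_cov hΦ hlam T).apply_eq_of_sum_nonpos hΦ hlam h hxy

/-- The maximum principle. -/
lemma nonneg_of_exchange_eq_zero (hΦ : IsElastic Φ g K) (hlam : 0 < lam)
    (hbd : IsAnchored Φ bd) {T : ι → ℝ} (hT : ∀ x, bd x → 0 ≤ T x)
    (h : ∀ x, ¬ bd x → exchange Φ lam T x = 0) (x : ι) : 0 ≤ T x := by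
  -- Split T into positive and negative parts u and v. The negative part vanishes on the boundary,
  -- and T exchanges no heat elsewhere, so v is orthogonal to the exchange of T.
  let u : ι → ℝ := fun x => max (T x) 0
  let v : ι → ℝ := fun x => max (-T x) 0
  have huv : T = u - v := by
    ext x
    simp only [u, v, Pi.sub_apply]
    rcases le_total (T x) 0 with h | h
    · rw [max_eq_right h, max_eq_left (by linarith)]; ring
    · rw [max_eq_left h, max_eq_right (by linarith)]; ring
  have hu : ∀ x, 0 ≤ u x := fun x => le_max_right _ _
  have hv : ∀ x, 0 ≤ v x := fun x => le_max_right _ _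
  have hdisj : ∀ x, v x * u x = 0 := by
    intro x
    simp only [u, v]
    rcases le_total (T x) 0 with h | h
    · rw [max_eq_right h, mul_zero]
    · rw [max_eq_right (by linarith : -T x ≤ 0), zero_mul]
  have hvb : ∀ x, bd x → v x = 0 := fun x hx => max_eq_right (by linarith [hT x hx])
  have h1 : ∑ x, v x * exchange Φ lam T x = 0 := by
    refine Finset.sum_eq_zero fun x _ => ?_
    by_cases hx : bd x
    · rw [hvb x hx, zero_mul]
    · rw [h x hx, mul_zero]
  -- The supports of u and v are disjoint, so only the kernel term remains, and it has a sign. The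
  -- energy of v is then nonpositive.
  have h2 : ∑ x, v x * exchange Φ lam u x ≤ 0 := by
    refine Finset.sum_nonpos fun x _ => ?_
    change v x * (u x - ∑ y, kineticKernel Φ lam x y * u y) ≤ 0
    rw [mul_sub, hdisj, zero_sub, neg_nonpos]
    exact mul_nonneg (hv x) (Finset.sum_nonneg fun y _ =>
      mul_nonneg (kineticKernel_nonneg hlam x y) (hu y))
  have h3 : ∑ x, v x * exchange Φ lam v x ≤ 0 := by
    rw [huv, map_sub] at h1
    simp only [Pi.sub_apply, mul_sub, Finset.sum_sub_distrib] at h1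
    linarith
  have h4 := congrFun (eq_zero_of_sum_exchange_nonpos hΦ hlam hbd hvb h3) x
  have h5 : max (-T x) 0 = 0 := h4
  have := le_max_left (-T x) 0
  linarith

lemma eq_of_exchange_eq_zero (hΦ : IsElastic Φ g K) (hlam : 0 < lam)
    (hbd : IsAnchored Φ bd) {T T' : ι → ℝ} (hT : ∀ x, bd x → T x = T' x)
    (h : ∀ x, ¬ bd x → exchange Φ lam T x = 0) (h' : ∀ x, ¬ bd x → exchange Φ lam T' x = 0) :
    T = T' := by
  rw [← sub_eq_zero]
  have hb : ∀ x, bd x → (T - T') x = 0 := fun x hx => sub_eq_zero.2 (hT x hx)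
  refine eq_zero_of_sum_exchange_nonpos hΦ hlam hbd hb (le_of_eq ?_)
  refine Finset.sum_eq_zero fun x _ => ?_
  by_cases hx : bd x
  · rw [hb x hx, zero_mul]
  · have : exchange Φ lam (T - T') x = 0 := by
      rw [map_sub, Pi.sub_apply, h x hx, h' x hx, sub_zero]
    rw [this, mul_zero]

lemma exists_exchange_eq_zero (hΦ : IsElastic Φ g K) (hlam : 0 < lam)
    (hbd : IsAnchored Φ bd) (b : ι → ℝ) :
    ∃ T : ι → ℝ, (∀ x, bd x → T x = b x) ∧ ∀ x, ¬ bd x → exchange Φ lam T x = 0 := by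
  classical
  -- Boundary values and exchange conditions form a square linear system, so uniqueness implies
  -- solvability.
  let F : (ι → ℝ) →ₗ[ℝ] (ι → ℝ) := LinearMap.pi fun x =>
    if bd x then LinearMap.proj x else (LinearMap.proj x).comp (exchange Φ lam)
  have hF1 : ∀ T x, bd x → F T x = T x := fun T x hx => by simp [F, hx]
  have hF2 : ∀ T x, ¬ bd x → F T x = exchange Φ lam T x := fun T x hx => by simp [F, hx]
  have hinj : Function.Injective F := by
    rw [injective_iff_map_eq_zero]
    intro T hT
    refine eq_of_exchange_eq_zero hΦ hlam hbd (T' := 0) (fun x hx => ?_) (fun x hx => ?_)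
      fun x _ => by rw [map_zero]; rfl
    · rw [← hF1 T x hx, hT]
    · rw [← hF2 T x hx, hT]; rfl
  obtain ⟨T, hT⟩ := (LinearMap.injective_iff_surjective.1 hinj) fun x => if bd x then b x else 0
  refine ⟨T, fun x hx => ?_, fun x hx => ?_⟩
  · rw [← hF1 T x hx, hT]; exact if_pos hx
  · rw [← hF2 T x hx, hT]; exact if_neg hx

end Harmonic

/-! ### Self-consistent profiles of the crystal and their currents -/

section SelfConsistent

variable {N n : ℕ} {L : Fin n → ℕ} [∀ a, NeZero (L a)] {ω γ lam TL TR : ℝ}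

/-- Nonnegativity of T enters through the square roots in the noise; `cov` itself is linear in T and
defined for all real temperatures. -/
lemma noiseAt_eq (hlam : 0 < lam) {T : Site N L → ℝ} (hT : ∀ x, 0 ≤ T x) (s : ℝ) :
    noiseAt ω γ lam T s
      = propagated (driftMatrix (potential ω γ N L) lam) (noiseMatrix lam T) s := by
  have h : noise lam T * (noise lam T).transpose = noiseMatrix lam T := by
    rw [noise, Matrix.fromBlocks_transpose, Matrix.fromBlocks_multiply, noiseMatrix]
    simp only [Matrix.transpose_zero, mul_zero, add_zero, zero_mul, zero_add,
      Matrix.diagonal_transpose, Matrix.diagonal_mul_diagonal]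
    congr 2
    ext x
    exact Real.mul_self_sqrt (mul_nonneg (by positivity) (hT x))
  rw [noiseAt, h]
  rfl

lemma steadyCov_eq (hlam : 0 < lam) {T : Site N L → ℝ} (hT : ∀ x, 0 ≤ T x) :
    steadyCov ω γ lam T = cov (potential ω γ N L) lam T := by
  simp only [steadyCov, noiseAt_eq hlam hT]
  rfl

lemma isStationary_iff (hω : 0 < ω) (hγ : 0 < γ) (hlam : 0 < lam) {T : Site N L → ℝ}
    (hT : ∀ x, 0 ≤ T x) (μ : Measure (EuclideanSpace ℝ (Coord N L))) :
    IsStationary ω γ lam T μ ↔ μ = steadyState ω γ lam T := by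
  have hD : (noiseMatrix lam T).PosSemidef := by
    rw [noiseMatrix_eq_diagonal]
    refine Matrix.PosSemidef.diagonal fun b => ?_
    rcases b with x | x
    · simp
    · simpa using mul_nonneg (by positivity) (hT x)
  have h := ((isElastic_potential (N := N) (L := L) hω hγ).isStable hlam).stationary_iff hD μ
  rw [steadyState, steadyCov_eq hlam hT]
  simp only [IsStationary, lawAt, noiseCov, noiseAt_eq hlam hT]
  exact h

lemma integral_mul_steadyState (hω : 0 < ω) (hγ : 0 < γ) (hlam : 0 < lam) {T : Site N L → ℝ}
    (hT : ∀ x, 0 ≤ T x) (b c : Coord N L) :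
    ∫ z, z b * z c ∂(steadyState ω γ lam T) = cov (potential ω γ N L) lam T b c := by
  rw [steadyState, steadyCov_eq hlam hT]
  exact integral_mul_gaussian (cov_posSemidef (isElastic_potential hω hγ) hlam hT) b c

lemma integral_reservoirFlux (hω : 0 < ω) (hγ : 0 < γ) (hlam : 0 < lam) {T : Site N L → ℝ}
    (hT : ∀ x, 0 ≤ T x) (x : Site N L) :
    ∫ z, reservoirFlux lam T x z ∂(steadyState ω γ lam T)
      = lam * exchange (potential ω γ N L) lam T x := by
  have h := integral_mul_steadyState hω hγ hlam hT (Sum.inr x) (Sum.inr x)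
  have hp : IsProbabilityMeasure (steadyState ω γ lam T) := by rw [steadyState]; infer_instance
  simp only [reservoirFlux, sq]
  have hi : Integrable (fun z : EuclideanSpace ℝ (Coord N L) => z (Sum.inr x) * z (Sum.inr x))
      (steadyState ω γ lam T) := integrable_mul_gaussian _ _ _
  rw [integral_const_mul, integral_sub (integrable_const _) hi, h,
    exchange_eq (isElastic_potential hω hγ) hlam]
  simp [Matrix.toBlocks₂₂]

/-- The sites of the first and of the last layer. -/
def IsBoundary (x : Site N L) : Prop := (x.1 : ℕ) = 0 ∨ (x.1 : ℕ) + 1 = N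

lemma eq_of_isUp_chain {L : Fin n → ℕ} {T : Site N L → ℝ} (h : ∀ x y, IsUp x y → T x = T y) :
    ∀ (i : ℕ) (hi : i < N) (j : (a : Fin n) → ZMod (L a)),
      T (⟨i, hi⟩, j) = T (⟨0, by omega⟩, j) := by
  intro i
  induction i with
  | zero => intro _ _; rfl
  | succ i ih =>
    intro hi j
    rw [← ih (by omega) j]
    exact (h (⟨i, by omega⟩, j) (⟨i + 1, hi⟩, j) ⟨rfl, rfl⟩).symm

lemma isAnchored_potential {L : Fin n → ℕ} (hω : 0 < ω) :
    IsAnchored (potential ω γ N L) (IsBoundary (N := N) (L := L)) := by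
  intro T h hb
  ext ⟨⟨i, hi⟩, j⟩
  have h1 : ∀ x y : Site N L, IsUp x y → T x = T y := fun x y hxy =>
    h x y (by rw [(potential_of_isUp hω hxy).1]; exact neg_ne_zero.2 (pow_ne_zero 2 hω.ne'))
  rw [eq_of_isUp_chain h1 i hi j]
  exact hb _ (Or.inl rfl)

lemma isSelfConsistent_iff (hω : 0 < ω) (hγ : 0 < γ) (hlam : 0 < lam) (T : Site N L → ℝ) :
    IsSelfConsistent ω γ lam TL TR T ↔ (∀ x, 0 ≤ T x) ∧
      (∀ x : Site N L, (x.1 : ℕ) = 0 → T x = TL) ∧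
      (∀ x : Site N L, (x.1 : ℕ) + 1 = N → T x = TR) ∧
      ∀ x, ¬ IsBoundary x → exchange (potential ω γ N L) lam T x = 0 := by
  constructor
  · intro h
    refine ⟨h.nonneg, h.left, h.right, fun x hx => ?_⟩
    have h1 := h.no_flux x (by rw [IsBoundary] at hx; omega)
      (by have := x.1.2; rw [IsBoundary] at hx; omega)
    rw [integral_reservoirFlux hω hγ hlam h.nonneg] at h1
    exact (mul_eq_zero.1 h1).resolve_left hlam.ne'
  · rintro ⟨h0, hl, hr, hb⟩
    refine ⟨h0, hl, hr, fun x h1 h2 => ?_⟩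
    rw [integral_reservoirFlux hω hγ hlam h0, hb x (by rw [IsBoundary]; omega), mul_zero]

/-- Constants exchange no heat, so the maximum principle applies to the differences between T and
the extreme boundary temperatures. -/
lemma bounds_of_exchange_eq_zero (hω : 0 < ω) (hγ : 0 < γ) (hlam : 0 < lam) {T : Site N L → ℝ}
    (hl : ∀ x : Site N L, (x.1 : ℕ) = 0 → T x = TL)
    (hr : ∀ x : Site N L, (x.1 : ℕ) + 1 = N → T x = TR)
    (hb : ∀ x, ¬ IsBoundary x → exchange (potential ω γ N L) lam T x = 0) (x : Site N L) :
    min TL TR ≤ T x ∧ T x ≤ max TL TR := by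
  have hΦ := isElastic_potential (N := N) (L := L) hω hγ
  have hanch := isAnchored_potential (γ := γ) (N := N) (L := L) hω
  constructor
  · have h := nonneg_of_exchange_eq_zero hΦ hlam hanch
      (T := T - fun _ => min TL TR) (fun x hx => by
        rcases hx with hx | hx
        · simp [hl x hx]
        · simp [hr x hx]) (fun x hx => by
        rw [map_sub, exchange_const hΦ hlam, sub_zero, hb x hx]) x
    simpa using h
  · have h := nonneg_of_exchange_eq_zero hΦ hlam hanch
      (T := (fun _ => max TL TR) - T) (fun x hx => by
        rcases hx with hx | hx
        · simp [hl x hx]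
        · simp [hr x hx]) (fun x hx => by
        rw [map_sub, exchange_const hΦ hlam, zero_sub, Pi.neg_apply, hb x hx, neg_zero]) x
    simpa using h

lemma existsUnique_isSelfConsistent (hω : 0 < ω) (hγ : 0 < γ) (hlam : 0 < lam) (hTL : 0 ≤ TL)
    (hTR : 0 ≤ TR) (hN : 2 ≤ N) :
    ∃! T : Site N L → ℝ, IsSelfConsistent ω γ lam TL TR T := by
  have hΦ := isElastic_potential (N := N) (L := L) hω hγ
  have hanch := isAnchored_potential (γ := γ) (N := N) (L := L) hω
  obtain ⟨T, hT1, hT2⟩ := exists_exchange_eq_zero hΦ hlam hanch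
    fun x => if (x.1 : ℕ) = 0 then TL else TR
  have hl : ∀ x : Site N L, (x.1 : ℕ) = 0 → T x = TL := fun x hx => by
    rw [hT1 x (Or.inl hx), if_pos hx]
  have hr : ∀ x : Site N L, (x.1 : ℕ) + 1 = N → T x = TR := fun x hx => by
    rw [hT1 x (Or.inr hx), if_neg (by omega)]
  refine ⟨T, (isSelfConsistent_iff hω hγ hlam T).2 ⟨fun x => ?_, hl, hr, hT2⟩, fun T' hT' => ?_⟩
  · exact (le_min hTL hTR).trans (bounds_of_exchange_eq_zero hω hγ hlam hl hr hT2 x).1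
  · obtain ⟨-, hl', hr', hb'⟩ := (isSelfConsistent_iff hω hγ hlam T').1 hT'
    refine eq_of_exchange_eq_zero hΦ hlam hanch (fun x hx => ?_) hb' hT2
    rcases hx with hx | hx
    · rw [hl x hx, hl' x hx]
    · rw [hr x hx, hr' x hx]

lemma cov_reflect (hω : 0 < ω) (hγ : 0 < γ) (hlam : 0 < lam) (T : Site N L → ℝ)
    (c : (a : Fin n) → ZMod (L a)) :
    (cov (potential ω γ N L) lam T).toBlocks₁₁.submatrix (reflect c) (reflect c)
        = (cov (potential ω γ N L) lam (T ∘ reflect c)).toBlocks₁₁ ∧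
      (cov (potential ω γ N L) lam T).toBlocks₁₂.submatrix (reflect c) (reflect c)
        = (cov (potential ω γ N L) lam (T ∘ reflect c)).toBlocks₁₂ ∧
      (cov (potential ω γ N L) lam T).toBlocks₂₂.submatrix (reflect c) (reflect c)
        = (cov (potential ω γ N L) lam (T ∘ reflect c)).toBlocks₂₂ := by
  have hΦ := isElastic_potential (N := N) (L := L) hω hγ
  exact ((isSteadyMoments_cov hΦ hlam T).submatrix (reflect c) (potential_reflect hω c)).unique
    (isSteadyMoments_cov hΦ hlam _) hΦ hlam

namespace IsSelfConsistent

variable {T : Site N L → ℝ}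

lemma bounds (h : IsSelfConsistent ω γ lam TL TR T) (hω : 0 < ω) (hγ : 0 < γ) (hlam : 0 < lam)
    (x : Site N L) : min TL TR ≤ T x ∧ T x ≤ max TL TR := by
  obtain ⟨-, hl, hr, hb⟩ := (isSelfConsistent_iff hω hγ hlam T).1 h
  exact bounds_of_exchange_eq_zero hω hγ hlam hl hr hb x

lemma comp_reflect (h : IsSelfConsistent ω γ lam TL TR T) (hω : 0 < ω) (hγ : 0 < γ)
    (hlam : 0 < lam) (c : (a : Fin n) → ZMod (L a)) : T ∘ reflect c = T := by
  obtain ⟨-, hl, hr, hb⟩ := (isSelfConsistent_iff hω hγ hlam T).1 h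
  have hΦ := isElastic_potential (N := N) (L := L) hω hγ
  refine eq_of_exchange_eq_zero hΦ hlam (isAnchored_potential hω) (fun x hx => ?_)
    (fun x hx => ?_) hb
  · rcases hx with hx | hx
    · exact (hl (reflect c x) hx).trans (hl x hx).symm
    · exact (hr (reflect c x) hx).trans (hr x hx).symm
  · rw [exchange_eq hΦ hlam, ← (cov_reflect hω hγ hlam T c).2.2]
    have h1 := hb (reflect c x) hx
    rw [exchange_eq hΦ hlam] at h1
    exact h1

/-- Within a layer, the reflection with c = x.2 + y.2 exchanges x and y. -/
lemma eq_of_layer_eq (h : IsSelfConsistent ω γ lam TL TR T) (hω : 0 < ω) (hγ : 0 < γ)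
    (hlam : 0 < lam) {x y : Site N L} (hxy : x.1 = y.1) : T x = T y := by
  have h1 := congrFun (h.comp_reflect hω hγ hlam (x.2 + y.2)) y
  rw [← h1, Function.comp_apply]
  congr 1
  refine Prod.ext hxy ?_
  rw [reflect_snd]; abel

lemma exists_layer (h : IsSelfConsistent ω γ lam TL TR T) (hω : 0 < ω) (hγ : 0 < γ)
    (hlam : 0 < lam) : ∃ τ : ℕ → ℝ, ∀ x, T x = τ x.1 := by
  refine ⟨fun i => if hi : i < N then T (⟨i, hi⟩, 0) else 0, fun x => ?_⟩
  simp only [x.1.2, dite_true]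
  exact h.eq_of_layer_eq hω hγ hlam rfl

lemma isInvariant (h : IsSelfConsistent ω γ lam TL TR T) (hω : 0 < ω) (hγ : 0 < γ)
    (hlam : 0 < lam) :
    IsInvariant (cov (potential ω γ N L) lam T).toBlocks₁₁ ∧
    IsInvariant (cov (potential ω γ N L) lam T).toBlocks₁₂ ∧
    IsInvariant (cov (potential ω γ N L) lam T).toBlocks₂₂ := by
  have h1 := fun c => cov_reflect (N := N) (L := L) hω hγ hlam T c
  simp only [h.comp_reflect hω hγ hlam] at h1
  exact ⟨fun c => (h1 c).1, fun c => (h1 c).2.1, fun c => (h1 c).2.2⟩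

end IsSelfConsistent

lemma integrable_current (x y : Site N L) (T : Site N L → ℝ) :
    Integrable (current ω x y) (steadyState ω γ lam T) := by
  have h := fun b c => integrable_mul_gaussian (steadyCov ω γ lam T) b c
  have e : current ω x y = fun z : EuclideanSpace ℝ (Coord N L) => -(ω ^ 2 / 2) *
      (z (Sum.inl y) * z (Sum.inr x) + z (Sum.inl y) * z (Sum.inr y)
        - z (Sum.inl x) * z (Sum.inr x) - z (Sum.inl x) * z (Sum.inr y)) := by
    ext z; rw [current]; ring
  rw [e]
  exact ((((h _ _).add (h _ _)).sub (h _ _)).sub (h _ _)).const_mul _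

/-- Antisymmetry of Z kills the two on-site terms and makes the two mixed terms add up. -/
lemma integral_current (hω : 0 < ω) (hγ : 0 < γ) (hlam : 0 < lam) {T : Site N L → ℝ}
    (hT : ∀ x, 0 ≤ T x) (x y : Site N L) :
    ∫ z, current ω x y z ∂(steadyState ω γ lam T)
      = ω ^ 2 * (cov (potential ω γ N L) lam T).toBlocks₁₂ x y := by
  have h : ∀ b c : Coord N L, Integrable (fun z : EuclideanSpace ℝ (Coord N L) => z b * z c)
      (steadyState ω γ lam T) := fun b c => integrable_mul_gaussian (steadyCov ω γ lam T) b c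
  have hI := integral_mul_steadyState hω hγ hlam hT
  have e : current ω x y = fun z : EuclideanSpace ℝ (Coord N L) => -(ω ^ 2 / 2) *
      (z (Sum.inl y) * z (Sum.inr x) + z (Sum.inl y) * z (Sum.inr y)
        - z (Sum.inl x) * z (Sum.inr x) - z (Sum.inl x) * z (Sum.inr y)) := by
    ext z; rw [current]; ring
  rw [e, integral_const_mul,
    integral_sub (by exact ((h _ _).add (h _ _)).sub (h _ _)) (h _ _),
    integral_sub (by exact (h _ _).add (h _ _)) (h _ _), integral_add (h _ _) (h _ _), hI, hI, hI, hI]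
  have hanti := (isSteadyMoments_cov (isElastic_potential (N := N) (L := L) hω hγ) hlam T).anti
  have ha : ∀ x y, (cov (potential ω γ N L) lam T) (Sum.inl y) (Sum.inr x)
      = -(cov (potential ω γ N L) lam T) (Sum.inl x) (Sum.inr y) :=
    fun x y => congrFun (congrFun hanti x) y
  have hxx := ha x x
  have hyy := ha y y
  rw [ha x y]
  simp only [Matrix.toBlocks₁₂, Matrix.of_apply]
  have hxx' : (cov (potential ω γ N L) lam T) (Sum.inl x) (Sum.inr x) = 0 := by linarith
  have hyy' : (cov (potential ω γ N L) lam T) (Sum.inl y) (Sum.inr y) = 0 := by linarith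
  rw [hxx', hyy']
  ring

namespace IsSelfConsistent

variable {T : Site N L → ℝ}

/-- The reflection exchanging x and y makes Z symmetric in this pair, while Z is antisymmetric. -/
lemma corr_eq_zero (h : IsSelfConsistent ω γ lam TL TR T) (hω : 0 < ω) (hγ : 0 < γ)
    (hlam : 0 < lam) {x y : Site N L} (hxy : x.1 = y.1) :
    (cov (potential ω γ N L) lam T).toBlocks₁₂ x y = 0 := by
  have hanti := (isSteadyMoments_cov (isElastic_potential (N := N) (L := L) hω hγ) hlam T).anti
  have h1 := congrFun (congrFun ((h.isInvariant hω hγ hlam).2.1 (x.2 + y.2)) x) y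
  have hx : reflect (x.2 + y.2) x = y := Prod.ext hxy (by rw [reflect_snd]; abel)
  have hy : reflect (x.2 + y.2) y = x := Prod.ext hxy.symm (by rw [reflect_snd]; abel)
  rw [Matrix.submatrix_apply, hx, hy] at h1
  have h2 := congrFun (congrFun hanti x) y
  rw [Matrix.transpose_apply, Matrix.neg_apply] at h2
  linarith

/-- The mean current is the same through all bonds in the first direction. -/
lemma exists_corr_eq (h : IsSelfConsistent ω γ lam TL TR T) (hω : 0 < ω) (hγ : 0 < γ)
    (hlam : 0 < lam) : ∃ j : ℝ, ∀ x y : Site N L, IsUp x y →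
      (cov (potential ω γ N L) lam T).toBlocks₁₂ x y = j := by
  have hΦ := isElastic_potential (N := N) (L := L) hω hγ
  have hst := isSteadyMoments_cov hΦ hlam T
  have hinv := (h.isInvariant hω hγ hlam).2.1
  have hzero : ∀ x y : Site N L, x.1 = y.1 → _ := fun x y hxy => h.corr_eq_zero hω hγ hlam hxy
  obtain ⟨-, -, -, hb⟩ := (isSelfConsistent_iff hω hγ hlam T).1 h
  set Z := (cov (potential ω γ N L) lam T).toBlocks₁₂ with hZ
  have hanti : ∀ x y, Z y x = - Z x y := fun x y => congrFun (congrFun hst.anti x) y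
  -- Energy conservation at the interior site y: absence of flux means that the diagonal entry of
  -- [Φ, Z] at y vanishes.
  have hstep : ∀ x y z : Site N L, IsUp x y → IsUp y z → Z x y = Z y z := by
    intro x y z hxy hyz
    have hy : ¬ IsBoundary y := by
      have := hxy.1; have := hyz.1; have := z.1.2
      rw [IsBoundary]; omega
    have h1 := hb y hy
    rw [exchange_eq hΦ hlam] at h1
    have h2 := congrFun (congrFun (hst.mom_sub hlam) y) y
    rw [Matrix.sub_apply, Matrix.diagonal_apply_eq, h1, Matrix.smul_apply, smul_eq_mul,
      eq_comm, mul_eq_zero] at h2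
    have h3 : comm (potential ω γ N L) Z y y = 0 :=
      h2.resolve_left (by positivity)
    -- Neighbours in the same layer drop out since Z vanishes there, which leaves the two neighbours
    -- in the first direction.
    have h4 : ∀ w, potential ω γ N L y w * Z w y
        = (if w = x then -ω ^ 2 * Z x y else 0) + (if w = z then -ω ^ 2 * Z z y else 0) := by
      intro w
      have hxz : x ≠ z := fun e => by
        have := hxy.1; have := hyz.1; rw [e] at *; omega
      by_cases hwx : w = x
      · subst hwx
        rw [if_pos rfl, if_neg hxz, add_zero, (potential_of_isUp hω hxy).2]
      by_cases hwz : w = z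
      · subst hwz
        rw [if_neg hwx, if_pos rfl, zero_add, (potential_of_isUp hω hyz).1]
      rw [if_neg hwx, if_neg hwz, add_zero]
      by_cases hwy : w.1 = y.1
      · rw [hzero w y hwy, mul_zero]
      · have e0 : y ≠ w := fun e => hwy (by rw [e])
        have e1 : ¬ IsUp y w := fun e => hwz (Prod.ext (Fin.ext (e.1.trans hyz.1.symm))
          (e.2.trans hyz.2.symm))
        have e2 : ¬ IsUp w y := fun e => hwx (Prod.ext
          (Fin.ext (by have := e.1; have := hxy.1; omega)) (e.2.symm.trans hxy.2))
        have e3 : ∀ a, w ≠ shift a y := fun a e => hwy (by rw [e]; rfl)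
        have e4 : ∀ a, y ≠ shift a w := fun a e => hwy (by
          have : y.1 = (shift a w).1 := congrArg Prod.fst e
          exact this.symm)
        rw [potential_eq ω γ hω]
        simp [e0, hop, e1, e2, e3, e4]
    have h5 : (potential ω γ N L * Z) y y = -ω ^ 2 * Z x y - ω ^ 2 * Z z y := by
      rw [Matrix.mul_apply]
      simp only [h4, Finset.sum_add_distrib, Finset.sum_ite_eq', Finset.mem_univ, if_true]
      ring
    have h6 : (Z * potential ω γ N L) y y = -(potential ω γ N L * Z) y y := by
      rw [Matrix.mul_apply, Matrix.mul_apply, ← Finset.sum_neg_distrib]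
      refine Finset.sum_congr rfl fun w _ => ?_
      have : potential ω γ N L w y = potential ω γ N L y w :=
        congrFun (congrFun hΦ.symm y) w
      rw [this, hanti w y]; ring
    rw [comm, Matrix.sub_apply, h6, h5, hanti y z] at h3
    have h7 : ω ^ 2 * (Z y z - Z x y) = 0 := by linarith
    have := (mul_eq_zero.1 h7).resolve_left (by positivity)
    linarith
  have hlayer : ∀ x y x' y' : Site N L, IsUp x y → IsUp x' y' → x.1 = x'.1 → Z x y = Z x' y' := by
    intro x y x' y' hxy hxy' he
    have h1 := congrFun (congrFun (hinv (x.2 + x'.2)) x) y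
    have hx : reflect (x.2 + x'.2) x = x' := Prod.ext he (by rw [reflect_snd]; abel)
    have hy : reflect (x.2 + x'.2) y = y' := Prod.ext
      (Fin.ext (by rw [reflect_fst, hxy.1, hxy'.1, he]))
      (by rw [reflect_snd, hxy.2, hxy'.2]; abel)
    rw [Matrix.submatrix_apply, hx, hy] at h1
    exact h1.symm
  by_cases hN : 2 ≤ N
  · refine ⟨Z (⟨0, by omega⟩, 0) (⟨1, by omega⟩, 0), ?_⟩
    have key : ∀ (i : ℕ) (hi : i + 1 < N),
        Z (⟨i, by omega⟩, 0) (⟨i + 1, hi⟩, 0) = Z (⟨0, by omega⟩, 0) (⟨1, by omega⟩, 0) := by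
      intro i
      induction i with
      | zero => intro _; rfl
      | succ i ih =>
        intro hi
        rw [← ih (by omega)]
        exact (hstep (⟨i, by omega⟩, 0) (⟨i + 1, by omega⟩, 0) (⟨i + 1 + 1, hi⟩, 0)
          ⟨rfl, rfl⟩ ⟨rfl, rfl⟩).symm
    intro x y hxy
    have hi : (x.1 : ℕ) + 1 < N := by have := y.1.2; have := hxy.1; omega
    rw [← key x.1 hi]
    exact hlayer _ _ _ _ hxy ⟨rfl, rfl⟩ rfl
  · refine ⟨0, fun x y hxy => ?_⟩
    have := y.1.2
    have := hxy.1
    omega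

end IsSelfConsistent

end SelfConsistent

end Crystal

namespace Crystal

/-! ### The decaying root of the layer recursion -/

section BandRoot

/-- The root in `(0, 1)` of `z + 1 / z = 2 + b`. -/
noncomputable def bandRoot (b : ℝ) : ℝ := 2 / (2 + b + Real.sqrt (b * (4 + b)))

lemma bandRoot_pos {b : ℝ} (hb : 0 ≤ b) : 0 < bandRoot b := by
  rw [bandRoot]; positivity

lemma bandRoot_eq {b : ℝ} (hb : 0 ≤ b) : bandRoot b ^ 2 + 1 = (2 + b) * bandRoot b := by
  have hs : Real.sqrt (b * (4 + b)) ^ 2 = b * (4 + b) := Real.sq_sqrt (by positivity)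
  have h0 := Real.sqrt_nonneg (b * (4 + b))
  rw [bandRoot]
  set s := Real.sqrt (b * (4 + b))
  have hne : 2 + b + s ≠ 0 := by positivity
  field_simp
  nlinarith

lemma bandRoot_le {b c : ℝ} (hc : 0 ≤ c) (hb : c ≤ b) : bandRoot b ≤ 2 / (2 + c) := by
  rw [bandRoot]
  have := Real.sqrt_nonneg (b * (4 + b))
  exact div_le_div_of_nonneg_left (by norm_num) (by positivity) (by linarith)

lemma le_bandRoot {b c : ℝ} (hb : 0 ≤ b) (hc : b ≤ c) : 1 / (2 + c) ≤ bandRoot b := by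
  have hs : Real.sqrt (b * (4 + b)) ≤ 2 + b := by
    rw [Real.sqrt_le_left (by positivity)]; nlinarith
  have h0 := Real.sqrt_nonneg (b * (4 + b))
  rw [bandRoot, div_le_div_iff₀ (by linarith) (by positivity)]
  linarith

lemma nuSq_ge {n : ℕ} (ω γ : ℝ) (y : Fin n → ℝ) : γ ^ 2 / ω ^ 2 ≤ nuSq ω γ y := by
  rw [nuSq]
  have : 0 ≤ ∑ a, (1 - Real.cos (2 * Real.pi * y a)) :=
    Finset.sum_nonneg fun a _ => sub_nonneg.2 (Real.cos_le_one _)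
  linarith

lemma nuSq_nonneg {n : ℕ} (ω γ : ℝ) (y : Fin n → ℝ) : 0 ≤ nuSq ω γ y :=
  le_trans (by positivity) (nuSq_ge ω γ y)

lemma nuSq_le {n : ℕ} (ω γ : ℝ) (y : Fin n → ℝ) : nuSq ω γ y ≤ γ ^ 2 / ω ^ 2 + 4 * n := by
  rw [nuSq]
  have : ∑ a, (1 - Real.cos (2 * Real.pi * y a)) ≤ ∑ _a : Fin n, (2 : ℝ) :=
    Finset.sum_le_sum fun a _ => by linarith [Real.neg_one_le_cos (2 * Real.pi * y a)]
  rw [Finset.sum_const, Finset.card_univ, Fintype.card_fin, nsmul_eq_mul] at this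
  linarith

end BandRoot

/-! ### Diagonalisation of a layer by the Hartley transform -/

section Hartley

variable {n : ℕ} {L : Fin n → ℕ}

/-- A layer of the crystal. -/
abbrev Torus (L : Fin n → ℕ) : Type := (a : Fin n) → ZMod (L a)

variable [∀ a, NeZero (L a)]

/-- The characters of the torus. -/
noncomputable def torusChar (k j : Torus L) : ℂ := ∏ a, ZMod.stdAddChar (k a * j a)

lemma torusChar_comm (k j : Torus L) : torusChar k j = torusChar j k := by
  simp only [torusChar, mul_comm]

lemma torusChar_add (k j j' : Torus L) :
    torusChar k (j + j') = torusChar k j * torusChar k j' := by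
  simp only [torusChar, Pi.add_apply, mul_add, AddChar.map_add_eq_mul, Finset.prod_mul_distrib]

lemma torusChar_neg (k j : Torus L) :
    torusChar k (-j) = (starRingEnd ℂ) (torusChar k j) := by
  simp only [torusChar, Pi.neg_apply, mul_neg, AddChar.map_neg_eq_conj, map_prod]

lemma sum_torusChar (j : Torus L) :
    ∑ k : Torus L, torusChar k j = if j = 0 then (layerCard L : ℂ) else 0 := by
  have h1 : ∑ k : Torus L, torusChar k j
      = ∏ a, ∑ k : ZMod (L a), (ZMod.stdAddChar (k * j a) : ℂ) := by
    rw [Finset.prod_univ_sum, Fintype.piFinset_univ]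
    rfl
  have h2 : ∀ a, ∑ k : ZMod (L a), (ZMod.stdAddChar (k * j a) : ℂ)
      = if j a = 0 then (Fintype.card (ZMod (L a)) : ℂ) else 0 := by
    intro a
    rw [AddChar.sum_mulShift (j a) (ZMod.isPrimitive_stdAddChar (L a))]
    push_cast
    rfl
  rw [h1]
  simp only [h2]
  split_ifs with h
  · subst h
    simp [layerCard, Fintype.card_pi]
  · obtain ⟨a, ha⟩ := Function.ne_iff.1 h
    exact Finset.prod_eq_zero (Finset.mem_univ a) (if_neg ha)

/-- The real and symmetric version of the discrete Fourier transform. -/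
noncomputable def hartley (L : Fin n → ℕ) [∀ a, NeZero (L a)] :
    Matrix (Torus L) (Torus L) ℝ :=
  Matrix.of fun k j => ((torusChar k j).re + (torusChar k j).im) / Real.sqrt (layerCard L)

lemma hartley_transpose : (hartley L).transpose = hartley L := by
  ext k j
  simp only [hartley, Matrix.transpose_apply, Matrix.of_apply, torusChar_comm]

/-- For characters χ, (Re + Im)χ(j) · (Re + Im)χ(j') = Re χ(j - j') + Im χ(j + j'). Summation over
the dual variable gives a delta from the first term and 0 from the second, since character sums are
real. -/
lemma hartley_mul_self : hartley L * hartley L = 1 := by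
  ext j j'
  have hl := layerCard_pos (L := L)
  have hterm : ∀ k : Torus L, hartley L j k * hartley L k j'
      = ((torusChar k (j + -j')).re + (torusChar k (j + j')).im) / layerCard L := by
    intro k
    simp only [hartley, Matrix.of_apply, torusChar_comm j k]
    rw [torusChar_add, torusChar_add, torusChar_neg, div_mul_div_comm,
      Real.mul_self_sqrt hl.le]
    congr 1
    simp only [Complex.mul_re, Complex.mul_im, Complex.conj_re, Complex.conj_im]
    ring
  rw [Matrix.mul_apply]
  simp only [hterm]
  rw [← Finset.sum_div, Finset.sum_add_distrib, ← Complex.re_sum, ← Complex.im_sum,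
    sum_torusChar, sum_torusChar]
  have h1 : ((if j + j' = 0 then (layerCard L : ℂ) else 0)).im = 0 := by split_ifs <;> simp
  rw [h1, add_zero, Matrix.one_apply, ← sub_eq_add_neg]
  simp only [sub_eq_zero]
  split_ifs
  · simp [hl.ne']
  · simp

/-- The wave vector in `[0, 1]^n` that belongs to an element of the torus. -/
noncomputable def waveVector (k : Torus L) : Fin n → ℝ := fun a => ((k a).val : ℝ) / (L a : ℝ)

lemma torusChar_single (k : Torus L) (a : Fin n) :
    torusChar k (Pi.single a 1)
      = Complex.exp ((2 * Real.pi * waveVector k a : ℝ) * Complex.I) := by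
  rw [torusChar, Finset.prod_eq_single a]
  · rw [Pi.single_eq_same, mul_one, ZMod.stdAddChar_apply, ZMod.toCircle_apply, waveVector]
    congr 1
    push_cast
    ring
  · intro b _ hb
    rw [Pi.single_eq_of_ne hb, mul_zero, AddChar.map_zero_eq_one]
  · simp

/-- The odd contributions of the two opposite shifts cancel, so columns of the real transform are
eigenvectors of the periodic hopping. -/
lemma hartley_shift (k j : Torus L) (a : Fin n) :
    hartley L (j + Pi.single a 1) k + hartley L (j - Pi.single a 1) k
      = hartley L j k * (2 * Real.cos (2 * Real.pi * waveVector k a)) := by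
  simp only [hartley, Matrix.of_apply, torusChar_comm _ k, sub_eq_add_neg]
  rw [torusChar_add, torusChar_add, torusChar_neg, torusChar_single, Complex.exp_mul_I,
    ← Complex.ofReal_cos, ← Complex.ofReal_sin]
  simp only [map_add, map_mul, Complex.conj_ofReal, Complex.conj_I, Complex.mul_re,
    Complex.add_re, Complex.ofReal_re, Complex.I_re, Complex.mul_im, Complex.ofReal_im, Complex.I_im,
    Complex.add_im, Complex.neg_re, Complex.neg_im]
  ring

/-- The hopping matrix of a layer. -/
def torusHop (L : Fin n → ℕ) : Matrix (Torus L) (Torus L) ℝ :=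
  Matrix.of fun j j' => ∑ a : Fin n,
    ((if j' = j + Pi.single a 1 then 1 else 0) + (if j = j' + Pi.single a 1 then 1 else 0))

/-- The matrix `2 + ν² - Δ` of a layer. -/
noncomputable def torusMatrix (ω γ : ℝ) (L : Fin n → ℕ) : Matrix (Torus L) (Torus L) ℝ :=
  (2 + 2 * n + γ ^ 2 / ω ^ 2) • (1 : Matrix (Torus L) (Torus L) ℝ) - torusHop L

lemma torusHop_mul_apply (Y : Matrix (Torus L) (Torus L) ℝ) (j k : Torus L) :
    (torusHop L * Y) j k
      = ∑ a : Fin n, (Y (j + Pi.single a 1) k + Y (j - Pi.single a 1) k) := by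
  simp only [torusHop, Matrix.mul_apply, Matrix.of_apply, Finset.sum_mul]
  rw [Finset.sum_comm]
  refine Finset.sum_congr rfl fun a _ => ?_
  have h : ∀ j' : Torus L, j = j' + Pi.single a 1 ↔ j' = j - Pi.single a 1 := fun j' => by
    rw [eq_sub_iff_add_eq, eq_comm]
  simp only [add_mul, Finset.sum_add_distrib, ite_mul, one_mul, zero_mul, h,
    Finset.sum_ite_eq', Finset.mem_univ, if_true]

lemma torusMatrix_mul_hartley (ω γ : ℝ) :
    torusMatrix ω γ L * hartley L
      = hartley L * Matrix.diagonal fun k => 2 + nuSq ω γ (waveVector k) := by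
  ext j k
  rw [torusMatrix, sub_mul, Matrix.sub_apply, torusHop_mul_apply, Matrix.mul_diagonal]
  simp only [hartley_shift, ← Finset.mul_sum, Matrix.smul_mul, one_mul, Matrix.smul_apply,
    smul_eq_mul, nuSq, Finset.sum_sub_distrib, Finset.sum_const, Finset.card_univ,
    Fintype.card_fin, nsmul_eq_mul, mul_one]
  ring

/-- The decaying root for the wave vector of `k`. -/
noncomputable def modeRoot (ω γ : ℝ) (k : Torus L) : ℝ := bandRoot (nuSq ω γ (waveVector k))

lemma modeRoot_pos {L : Fin n → ℕ} (ω γ : ℝ) (k : Torus L) : 0 < modeRoot ω γ k :=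
  bandRoot_pos (nuSq_nonneg _ _ _)

/-- An upper bound below one for the decaying roots. -/
noncomputable def rootBound (ω γ : ℝ) : ℝ := 2 / (2 + γ ^ 2 / ω ^ 2)

lemma modeRoot_le {L : Fin n → ℕ} (ω γ : ℝ) (k : Torus L) : modeRoot ω γ k ≤ rootBound ω γ :=
  bandRoot_le (by positivity) (nuSq_ge _ _ _)

lemma rootBound_pos (ω γ : ℝ) : 0 < rootBound ω γ := by rw [rootBound]; positivity

lemma rootBound_lt_one {ω γ : ℝ} (hω : 0 < ω) (hγ : 0 < γ) : rootBound ω γ < 1 := by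
  have : 0 < γ ^ 2 / ω ^ 2 := by positivity
  rw [rootBound, div_lt_one (by positivity)]
  linarith

/-- The correlations between layers at distance `m`. -/
noncomputable def layerKernel (ω γ : ℝ) (L : Fin n → ℕ) [∀ a, NeZero (L a)] (m : ℕ) :
    Matrix (Torus L) (Torus L) ℝ :=
  hartley L * Matrix.diagonal (fun k => modeRoot ω γ k ^ m) * hartley L

lemma layerKernel_zero (ω γ : ℝ) : layerKernel ω γ L 0 = 1 := by
  simp [layerKernel, hartley_mul_self]

lemma layerKernel_transpose (ω γ : ℝ) (m : ℕ) :
    (layerKernel ω γ L m).transpose = layerKernel ω γ L m := by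
  simp [layerKernel, Matrix.transpose_mul, hartley_transpose, Matrix.mul_assoc]

/-- In each mode this is the quadratic equation of the root, multiplied by its m-th power. -/
lemma torusMatrix_mul_layerKernel (ω γ : ℝ) (m : ℕ) :
    torusMatrix ω γ L * layerKernel ω γ L (m + 1)
      = layerKernel ω γ L (m + 2) + layerKernel ω γ L m := by
  simp only [layerKernel]
  rw [← Matrix.mul_assoc, ← Matrix.mul_assoc, torusMatrix_mul_hartley, Matrix.mul_assoc (hartley L),
    Matrix.diagonal_mul_diagonal, ← Matrix.add_mul, ← Matrix.mul_add, Matrix.diagonal_add]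
  congr 3
  ext k
  have h := bandRoot_eq (nuSq_nonneg ω γ (waveVector k))
  rw [modeRoot, show bandRoot (nuSq ω γ (waveVector k)) ^ (m + 2)
    + bandRoot (nuSq ω γ (waveVector k)) ^ m = bandRoot (nuSq ω γ (waveVector k)) ^ m *
      (bandRoot (nuSq ω γ (waveVector k)) ^ 2 + 1) by ring, h]
  ring

lemma trace_layerKernel (ω γ : ℝ) (m : ℕ) :
    ∑ j, layerKernel ω γ L m j j = ∑ k : Torus L, modeRoot ω γ k ^ m := by
  have h : (layerKernel ω γ L m).trace = ∑ k : Torus L, modeRoot ω γ k ^ m := by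
    rw [layerKernel, Matrix.trace_mul_comm, ← Matrix.mul_assoc, hartley_mul_self, one_mul,
      Matrix.trace_diagonal]
  exact h

lemma hs_layerKernel_le (ω γ : ℝ) (m : ℕ) :
    hs (layerKernel ω γ L m) (layerKernel ω γ L m) ≤ layerCard L * rootBound ω γ ^ (2 * m) := by
  have h : hs (layerKernel ω γ L m) (layerKernel ω γ L m)
      = ∑ k : Torus L, modeRoot ω γ k ^ (2 * m) := by
    rw [layerKernel, hs_mul_right, hartley_transpose, Matrix.mul_assoc, Matrix.mul_assoc,
      hartley_mul_self, mul_one, hs_mul_left, hartley_transpose, ← Matrix.mul_assoc,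
      hartley_mul_self, one_mul, hs_diagonal_left]
    refine Finset.sum_congr rfl fun k _ => ?_
    rw [Matrix.diagonal_apply_eq]
    ring
  rw [h, layerCard, ← nsmul_eq_mul, ← Finset.card_univ]
  exact Finset.sum_le_card_nsmul _ _ _ fun k _ =>
    pow_le_pow_left₀ (modeRoot_pos ω γ k).le (modeRoot_le ω γ k) _

/-- The antisymmetric continuation of `layerKernel` to all integers. -/
noncomputable def signedKernel (ω γ : ℝ) (L : Fin n → ℕ) [∀ a, NeZero (L a)] (m : ℤ) :
    Matrix (Torus L) (Torus L) ℝ :=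
  (m.sign : ℝ) • layerKernel ω γ L m.natAbs

lemma signedKernel_neg (ω γ : ℝ) (m : ℤ) : signedKernel ω γ L (-m) = -signedKernel ω γ L m := by
  simp [signedKernel]

lemma signedKernel_transpose (ω γ : ℝ) (m : ℤ) :
    (signedKernel ω γ L m).transpose = signedKernel ω γ L m := by
  rw [signedKernel, Matrix.transpose_smul, layerKernel_transpose]

lemma signedKernel_succ (ω γ : ℝ) (m : ℕ) :
    signedKernel ω γ L (m + 1) = layerKernel ω γ L (m + 1) := by
  have h1 : ((m : ℤ) + 1).sign = 1 := Int.sign_eq_one_of_pos (by positivity)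
  have h2 : ((m : ℤ) + 1).natAbs = m + 1 := by omega
  rw [signedKernel, h1, h2]; simp

lemma signedKernel_zero (ω γ : ℝ) : signedKernel ω γ L 0 = 0 := by simp [signedKernel]

/-- The odd extension is 0 at m = 0, where the decaying solution would be the identity. The
recursion therefore fails only at m = 1 and m = -1, and these defects are the sources on the bonds.
-/
lemma torusMatrix_mul_signedKernel (ω γ : ℝ) (m : ℤ) :
    torusMatrix ω γ L * signedKernel ω γ L m = signedKernel ω γ L (m + 1)
      + signedKernel ω γ L (m - 1) + (if m = 1 then 1 else 0) - (if m = -1 then 1 else 0) := by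
  have hpos : ∀ m : ℕ, torusMatrix ω γ L * signedKernel ω γ L (m + 1)
      = signedKernel ω γ L (m + 1 + 1) + signedKernel ω γ L (m + 1 - 1)
        + (if ((m : ℤ) + 1) = 1 then 1 else 0) := by
    intro m
    have e : ((m : ℤ) + 1 + 1) = ((m + 1 : ℕ) : ℤ) + 1 := by push_cast; ring
    rw [e, signedKernel_succ, signedKernel_succ, torusMatrix_mul_layerKernel, add_sub_cancel_right]
    rcases m with _ | m
    · simp [signedKernel_zero, layerKernel_zero]
    · rw [Nat.cast_add, Nat.cast_one, signedKernel_succ,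
        if_neg (by omega), add_zero]
  rcases lt_trichotomy m 0 with h | h | h
  · obtain ⟨p, rfl⟩ : ∃ p : ℕ, m = -((p : ℤ) + 1) := ⟨(-m - 1).toNat, by omega⟩
    have h1 := hpos p
    rw [signedKernel_neg, mul_neg, h1,
      show -((p : ℤ) + 1) + 1 = -((p : ℤ) + 1 - 1) by ring,
      show -((p : ℤ) + 1) - 1 = -((p : ℤ) + 1 + 1) by ring, signedKernel_neg, signedKernel_neg,
      if_neg (by omega : ¬ -((p : ℤ) + 1) = 1)]
    simp only [neg_inj]
    abel
  · subst h
    simp [signedKernel_zero, signedKernel_neg]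
  · obtain ⟨p, rfl⟩ : ∃ p : ℕ, m = (p : ℤ) + 1 := ⟨(m - 1).toNat, by omega⟩
    rw [hpos p, if_neg (by omega : ¬ ((p : ℤ) + 1) = -1), sub_zero]

end Hartley

/-! ### Response to a constant temperature gradient -/

section Corrector

variable {N n : ℕ} {L : Fin n → ℕ} [∀ a, NeZero (L a)] {ω γ lam : ℝ}

/-- The response of the infinite crystal to a constant temperature gradient. -/
noncomputable def corrector (ω γ : ℝ) (N : ℕ) (L : Fin n → ℕ) [∀ a, NeZero (L a)] :
    Matrix (Site N L) (Site N L) ℝ :=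
  Matrix.of fun x y => signedKernel ω γ L ((y.1 : ℤ) - (x.1 : ℤ)) x.2 y.2

/-- The error made by `corrector` in the first and in the last layer. -/
noncomputable def correctorError (ω γ : ℝ) (N : ℕ) (L : Fin n → ℕ) [∀ a, NeZero (L a)] :
    Matrix (Site N L) (Site N L) ℝ :=
  Matrix.of fun x y =>
    (if (x.1 : ℕ) + 1 = N then signedKernel ω γ L ((y.1 : ℤ) - (x.1 : ℤ) - 1) x.2 y.2 else 0)
    + (if (x.1 : ℕ) = 0 then signedKernel ω γ L ((y.1 : ℤ) - (x.1 : ℤ) + 1) x.2 y.2 else 0)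

lemma corrector_transpose : (corrector ω γ N L).transpose = -corrector ω γ N L := by
  ext x y
  simp only [corrector, Matrix.transpose_apply, Matrix.of_apply, Matrix.neg_apply]
  rw [show (x.1 : ℤ) - (y.1 : ℤ) = -((y.1 : ℤ) - (x.1 : ℤ)) by ring, signedKernel_neg,
    Matrix.neg_apply]
  congr 1
  exact congrFun (congrFun (signedKernel_transpose ω γ _) x.2) y.2

lemma sum_isUp_mul (x : Site N L) (F : ℤ → Torus L → ℝ) :
    ∑ y : Site N L, (if IsUp x y then F y.1 y.2 else 0)
      = if (x.1 : ℕ) + 1 < N then F (x.1 + 1) x.2 else 0 := by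
  have h : ∀ y : Site N L, (if IsUp x y then F y.1 y.2 else 0)
      = (if IsUp x y then 1 else 0) * F (x.1 + 1) x.2 := by
    intro y
    split_ifs with h
    · have e : ((y.1 : ℕ) : ℤ) = (x.1 : ℤ) + 1 := by rw [h.1]; push_cast; rfl
      rw [e, h.2, one_mul]
    · rw [zero_mul]
  simp only [h]
  rw [← Finset.sum_mul, sum_isUp]
  split_ifs <;> simp

lemma sum_isDown_mul (x : Site N L) (F : ℤ → Torus L → ℝ) :
    ∑ y : Site N L, (if IsUp y x then F y.1 y.2 else 0)
      = if (x.1 : ℕ) = 0 then 0 else F (x.1 - 1) x.2 := by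
  split_ifs with h
  · refine Finset.sum_eq_zero fun y _ => if_neg ?_
    rintro ⟨h1, -⟩
    omega
  · rw [Finset.sum_eq_single ((⟨x.1 - 1, by omega⟩, x.2) : Site N L)]
    · rw [if_pos ⟨by simp only; omega, rfl⟩]
      congr 1
      simp only
      omega
    · intro y _ hy
      rw [if_neg]
      rintro ⟨h1, h2⟩
      exact hy (Prod.ext (Fin.ext (by simp only; omega)) h2.symm)
    · simp

/-- The defects of the recursion at layer distance 1 and -1 assemble to the bond matrix. The error
collects the terms from the missing layers before the first and after the last one. -/
lemma potential_mul_corrector (hω : 0 < ω) :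
    potential ω γ N L * corrector ω γ N L
      = ω ^ 2 • (bond N L (fun _ => 1) + correctorError ω γ N L) := by
  ext x y
  set m : ℤ := (y.1 : ℤ) - (x.1 : ℤ) with hm
  have hhop : (hop N L * corrector ω γ N L) x y
      = (if (x.1 : ℕ) + 1 < N then signedKernel ω γ L (m - 1) x.2 y.2 else 0)
        + (if (x.1 : ℕ) = 0 then 0 else signedKernel ω γ L (m + 1) x.2 y.2)
        + (torusHop L * signedKernel ω γ L m) x.2 y.2 := by
    have e : ∀ w, hop N L x w * corrector ω γ N L w y
        = (if IsUp x w then signedKernel ω γ L ((y.1 : ℤ) - (w.1 : ℤ)) w.2 y.2 else 0)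
        + (if IsUp w x then signedKernel ω γ L ((y.1 : ℤ) - (w.1 : ℤ)) w.2 y.2 else 0)
        + ∑ a : Fin n, ((if w = shift a x then corrector ω γ N L w y else 0)
          + (if x = shift a w then corrector ω γ N L w y else 0)) := by
      intro w
      simp only [hop, Matrix.of_apply, add_mul, ite_mul, one_mul, zero_mul, Finset.sum_mul]
      rfl
    rw [Matrix.mul_apply]
    simp only [e]
    rw [Finset.sum_add_distrib, Finset.sum_add_distrib,
      sum_isUp_mul x (fun i j => signedKernel ω γ L ((y.1 : ℤ) - i) j y.2),
      sum_isDown_mul x (fun i j => signedKernel ω γ L ((y.1 : ℤ) - i) j y.2),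
      show (y.1 : ℤ) - (x.1 + 1) = m - 1 by rw [hm]; ring,
      show (y.1 : ℤ) - (x.1 - 1) = m + 1 by rw [hm]; ring, torusHop_mul_apply, Finset.sum_comm]
    congr 1
    refine Finset.sum_congr rfl fun a _ => ?_
    have e2 : ∀ w : Site N L, x = shift a w ↔ w = (x.1, x.2 - Pi.single a 1) := by
      intro w
      rw [Prod.ext_iff, Prod.ext_iff]
      simp only [shift]
      refine and_congr eq_comm ⟨fun h => ?_, fun h => ?_⟩
      · rw [h]; abel
      · rw [h]; abel
    rw [Finset.sum_add_distrib]
    simp only [e2, Finset.sum_ite_eq', Finset.mem_univ, if_true]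
    rfl
  have hker := congrFun (congrFun (torusMatrix_mul_signedKernel (L := L) ω γ m) x.2) y.2
  rw [torusMatrix, sub_mul, Matrix.sub_apply, Matrix.smul_mul, one_mul, Matrix.smul_apply,
    Matrix.sub_apply, Matrix.add_apply, Matrix.add_apply, smul_eq_mul] at hker
  have hup : (if m = 1 then (1 : Matrix (Torus L) (Torus L) ℝ) else 0) x.2 y.2
      = if IsUp x y then 1 else 0 := by
    by_cases h1 : m = 1
    · have h3 : (y.1 : ℕ) = (x.1 : ℕ) + 1 := by omega
      simp [h1, IsUp, h3, Matrix.one_apply, eq_comm]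
    · have h3 : ¬ (y.1 : ℕ) = (x.1 : ℕ) + 1 := by omega
      simp [h1, IsUp, h3]
  have hdown : (if m = -1 then (1 : Matrix (Torus L) (Torus L) ℝ) else 0) x.2 y.2
      = if IsUp y x then 1 else 0 := by
    by_cases h1 : m = -1
    · have h3 : (x.1 : ℕ) = (y.1 : ℕ) + 1 := by omega
      simp [h1, IsUp, h3, Matrix.one_apply]
    · have h3 : ¬ (x.1 : ℕ) = (y.1 : ℕ) + 1 := by omega
      simp [h1, IsUp, h3]
  rw [hup, hdown] at hker
  have hx := x.1.2
  rw [potential_eq ω γ hω, sub_mul, Matrix.sub_apply, Matrix.smul_mul, Matrix.smul_mul, one_mul,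
    Matrix.smul_apply, Matrix.smul_apply, hhop, Matrix.smul_apply, Matrix.add_apply]
  simp only [corrector, correctorError, bond, Matrix.of_apply, smul_eq_mul, ← hm]
  have hlast : (if (x.1 : ℕ) + 1 = N then signedKernel ω γ L (m - 1) x.2 y.2 else 0)
      = signedKernel ω γ L (m - 1) x.2 y.2
        - if (x.1 : ℕ) + 1 < N then signedKernel ω γ L (m - 1) x.2 y.2 else 0 := by
    by_cases h : (x.1 : ℕ) + 1 = N
    · rw [if_pos h, if_neg (by omega)]; ring
    · rw [if_neg h, if_pos (by omega)]; ring
  have hfirst : (if (x.1 : ℕ) = 0 then signedKernel ω γ L (m + 1) x.2 y.2 else 0)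
      = signedKernel ω γ L (m + 1) x.2 y.2
        - if (x.1 : ℕ) = 0 then 0 else signedKernel ω γ L (m + 1) x.2 y.2 := by
    split_ifs <;> ring
  rw [hlast, hfirst]
  have hw : ω ^ 2 * (2 + 2 * (n : ℝ)) + γ ^ 2
      = ω ^ 2 * (2 + 2 * (n : ℝ) + γ ^ 2 / ω ^ 2) := by field_simp
  rw [hw]
  linear_combination ω ^ 2 * hker

lemma hs_layered (F : Fin N → Fin N → Matrix (Torus L) (Torus L) ℝ) :
    hs (Matrix.of fun x y : Site N L => F x.1 y.1 x.2 y.2)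
      (Matrix.of fun x y : Site N L => F x.1 y.1 x.2 y.2)
      = ∑ i, ∑ i', hs (F i i') (F i i') := by
  simp only [hs, Matrix.of_apply, Fintype.sum_prod_type]
  refine Finset.sum_congr rfl fun i _ => ?_
  rw [Finset.sum_comm]

lemma sum_ite_le_of_unique {ι : Type*} [Fintype ι] {p : ι → Prop} [DecidablePred p] {s : ℝ}
    (hs : 0 ≤ s) (h : ∀ x y, p x → p y → x = y) : ∑ x, (if p x then s else 0) ≤ s := by
  have h1 := mul_le_mul_of_nonneg_right (sum_ite_le_one h) hs
  rw [Finset.sum_mul, one_mul] at h1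
  simpa only [ite_mul, one_mul, zero_mul] using h1

lemma hs_signedKernel_le (hω : 0 < ω) (hγ : 0 < γ) {m : ℤ} {i : ℕ} (hm : m.natAbs = i + 1) :
    hs (signedKernel ω γ L m) (signedKernel ω γ L m) ≤ layerCard L * rootBound ω γ ^ i := by
  have h1 := hs_layerKernel_le (L := L) ω γ (i + 1)
  have h2 : (m.sign : ℝ) * (m.sign : ℝ) = 1 := by
    rcases lt_trichotomy m 0 with h | h | h
    · simp [Int.sign_eq_neg_one_of_neg h]
    · omega
    · simp [Int.sign_eq_one_of_pos h]
  rw [signedKernel, hs_smul_left, hs_smul_right, ← mul_assoc, h2, one_mul, hm]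
  refine h1.trans (mul_le_mul_of_nonneg_left ?_ layerCard_pos.le)
  exact pow_le_pow_of_le_one (rootBound_pos ω γ).le (rootBound_lt_one hω hγ).le (by omega)

lemma sum_rootBound_le (hω : 0 < ω) (hγ : 0 < γ) (N : ℕ) :
    ∑ i : Fin N, rootBound ω γ ^ (i : ℕ) ≤ 1 / (1 - rootBound ω γ) := by
  have h0 := (rootBound_pos ω γ).le
  have h1 := rootBound_lt_one hω hγ
  rw [Fin.sum_univ_eq_sum_range (fun i => rootBound ω γ ^ i) N, one_div,
    ← tsum_geometric_of_lt_one h0 h1]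
  exact (summable_geometric_of_lt_one h0 h1).sum_le_tsum _ fun i _ => pow_nonneg h0 i

/-- Only one row of layers at each end contributes, and the kernel decays geometrically along it, so
the sum is bounded independently of N. -/
lemma hs_correctorError_le (hω : 0 < ω) (hγ : 0 < γ) :
    hs (correctorError ω γ N L) (correctorError ω γ N L)
      ≤ 4 / (1 - rootBound ω γ) * layerCard L := by
  have hr := rootBound_lt_one hω hγ
  have hl := layerCard_pos (L := L)
  have hb : 0 ≤ layerCard L * (1 / (1 - rootBound ω γ)) :=
    mul_nonneg hl.le (one_div_nonneg.2 (by linarith))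
  let F₁ : Fin N → Fin N → Matrix (Torus L) (Torus L) ℝ := fun i i' =>
    if (i : ℕ) + 1 = N then signedKernel ω γ L ((i' : ℤ) - (i : ℤ) - 1) else 0
  let F₂ : Fin N → Fin N → Matrix (Torus L) (Torus L) ℝ := fun i i' =>
    if (i : ℕ) = 0 then signedKernel ω γ L ((i' : ℤ) - (i : ℤ) + 1) else 0
  have hE : correctorError ω γ N L = (Matrix.of fun x y : Site N L => F₁ x.1 y.1 x.2 y.2)
      + (Matrix.of fun x y : Site N L => F₂ x.1 y.1 x.2 y.2) := by
    ext x y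
    simp only [correctorError, Matrix.of_apply, Matrix.add_apply, F₁, F₂]
    congr 1 <;> split_ifs <;> rfl
  have hz : hs (0 : Matrix (Torus L) (Torus L) ℝ) 0 = 0 := by simp [hs]
  have h1 : ∑ i, ∑ i', hs (F₁ i i') (F₁ i i') ≤ layerCard L * (1 / (1 - rootBound ω γ)) := by
    refine le_trans (Finset.sum_le_sum (g := fun i : Fin N => if (i : ℕ) + 1 = N then
      layerCard L * (1 / (1 - rootBound ω γ)) else 0) fun i _ => ?_)
      (sum_ite_le_of_unique hb fun x y hx hy => Fin.ext (by omega))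
    by_cases hi : (i : ℕ) + 1 = N
    · simp only [F₁, if_pos hi]
      -- At the right end the exponent is the distance to the last layer, hence the reversal.
      calc _ ≤ ∑ i' : Fin N, layerCard L * rootBound ω γ ^ ((Fin.rev i' : Fin N) : ℕ) := by
            refine Finset.sum_le_sum fun i' _ => hs_signedKernel_le hω hγ ?_
            have := i'.2
            rw [Fin.val_rev]
            omega
        _ = layerCard L * ∑ i' : Fin N, rootBound ω γ ^ (i' : ℕ) := by
            rw [← Finset.mul_sum]
            congr 1
            exact Equiv.sum_comp Fin.revPerm fun i' : Fin N => rootBound ω γ ^ (i' : ℕ)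
        _ ≤ _ := mul_le_mul_of_nonneg_left (sum_rootBound_le hω hγ N) hl.le
    · simp only [F₁, if_neg hi, hz, Finset.sum_const_zero, le_refl]
  have h2 : ∑ i, ∑ i', hs (F₂ i i') (F₂ i i') ≤ layerCard L * (1 / (1 - rootBound ω γ)) := by
    refine le_trans (Finset.sum_le_sum (g := fun i : Fin N => if (i : ℕ) = 0 then
      layerCard L * (1 / (1 - rootBound ω γ)) else 0) fun i _ => ?_)
      (sum_ite_le_of_unique hb fun x y hx hy => Fin.ext (by omega))
    by_cases hi : (i : ℕ) = 0
    · simp only [F₂, if_pos hi]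
      calc _ ≤ ∑ i' : Fin N, layerCard L * rootBound ω γ ^ (i' : ℕ) :=
            Finset.sum_le_sum fun i' _ => hs_signedKernel_le hω hγ (by omega)
        _ = layerCard L * ∑ i' : Fin N, rootBound ω γ ^ (i' : ℕ) := by rw [← Finset.mul_sum]
        _ ≤ _ := mul_le_mul_of_nonneg_left (sum_rootBound_le hω hγ N) hl.le
    · simp only [F₂, if_neg hi, hz, Finset.sum_const_zero, le_refl]
  have h3 := hs_self_add_le (Matrix.of fun x y : Site N L => F₁ x.1 y.1 x.2 y.2)
    (Matrix.of fun x y : Site N L => F₂ x.1 y.1 x.2 y.2)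
  rw [hs_layered, hs_layered] at h3
  rw [hE]
  refine h3.trans ?_
  rw [show 4 / (1 - rootBound ω γ) * layerCard L
    = 4 * (layerCard L * (1 / (1 - rootBound ω γ))) by ring]
  linarith

lemma bond_transpose {L : Fin n → ℕ} (D : ℕ → ℝ) : (bond N L D).transpose = -bond N L D := by
  ext x y
  simp [bond]

/-- The corrector, normalised to solve the transport equation up to boundary terms. -/
noncomputable def response (ω γ lam : ℝ) (N : ℕ) (L : Fin n → ℕ) [∀ a, NeZero (L a)] :
    Matrix (Site N L) (Site N L) ℝ :=
  (1 / (2 * lam * ω ^ 2)) • corrector ω γ N L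

/-- The bound for the error made by `response`. -/
noncomputable def responseBound (ω γ lam : ℝ) (n : ℕ) : ℝ :=
  (2 + 2 * potentialBound ω γ n ^ 2 / lam ^ 4) * (4 / (1 - rootBound ω γ))

/-- By transposition, ΦW and WΦ are the same multiple ω² of the bond matrix P up to end errors. The
commutator is thus a pure end term, and λ(ΦW + WΦ) equals 2λω² P up to such terms, which explains
the normalisation of `response`. -/
lemma hs_transport_response_sub_le (hω : 0 < ω) (hγ : 0 < γ) (hlam : 0 < lam) :
    hs (transport (potential ω γ N L) lam (response ω γ lam N L) - bond N L fun _ => 1)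
      (transport (potential ω γ N L) lam (response ω γ lam N L) - bond N L fun _ => 1)
      ≤ responseBound ω γ lam n * layerCard L := by
  have hΦ := isElastic_potential (N := N) (L := L) hω hγ
  set Φ := potential ω γ N L
  set E := correctorError ω γ N L with hEdef
  set P := bond N L fun _ => (1 : ℝ) with hP
  set W := corrector ω γ N L
  have hleft : Φ * W = ω ^ 2 • (P + E) := potential_mul_corrector hω
  have hright : W * Φ = ω ^ 2 • (P - E.transpose) := by
    have h := congrArg Matrix.transpose hleft
    rw [Matrix.transpose_mul, hΦ.symm, corrector_transpose, Matrix.transpose_smul,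
      Matrix.transpose_add, bond_transpose, neg_mul] at h
    rw [← neg_neg (W * Φ), h, ← smul_neg]
    congr 1
    abel
  have hcomm : comm Φ W = ω ^ 2 • (E + E.transpose) := by
    rw [comm, hleft, hright, ← smul_sub]
    congr 1
    abel
  have hR : transport Φ lam (response ω γ lam N L) - P = (1 / 2 : ℝ) • (E - E.transpose)
      + (1 / (4 * lam ^ 2)) • comm Φ (E + E.transpose) := by
    rw [response, transport_smul, transport, hcomm, comm_smul, hleft, hright, ← smul_add]
    simp only [smul_add, smul_smul, smul_sub]
    have e1 : 1 / (2 * lam * ω ^ 2) * (lam * ω ^ 2) = 1 / 2 := by field_simp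
    have e2 : 1 / (2 * lam * ω ^ 2) * (1 / (2 * lam) * ω ^ 2) = 1 / (4 * lam ^ 2) := by
      field_simp; norm_num
    rw [e1, e2]
    have e3 : P = (1 / 2 : ℝ) • P + (1 / 2 : ℝ) • P := by
      rw [← add_smul]; norm_num
    nth_rewrite 3 [e3]
    abel
  have hE := hs_correctorError_le (N := N) (L := L) hω hγ
  rw [← hEdef] at hE
  have h1 := hs_self_sub_le E E.transpose
  have h2 := hs_self_add_le E E.transpose
  rw [hs_transpose] at h1 h2
  have h3 := hΦ.hs_comm_le (E + E.transpose)
  have h4 := hs_self_add_le ((1 / 2 : ℝ) • (E - E.transpose))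
    ((1 / (4 * lam ^ 2)) • comm Φ (E + E.transpose))
  rw [hR]
  refine h4.trans ?_
  simp only [hs_smul_left, hs_smul_right]
  set K := potentialBound ω γ n
  have h5 : hs (comm Φ (E + E.transpose)) (comm Φ (E + E.transpose)) ≤ 4 * K ^ 2 * (4 * hs E E) :=
    h3.trans (mul_le_mul_of_nonneg_left (by linarith) (by positivity))
  have h6 := mul_le_mul_of_nonneg_left h5 (sq_nonneg (1 / (4 * lam ^ 2)))
  have h7 : (1 / (4 * lam ^ 2)) ^ 2 * (4 * K ^ 2 * (4 * hs E E)) = K ^ 2 / lam ^ 4 * hs E E := by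
    field_simp
  rw [h7] at h6
  calc _ ≤ (2 + 2 * K ^ 2 / lam ^ 4) * hs E E := by
        have : (2 + 2 * K ^ 2 / lam ^ 4) * hs E E
          = 2 * hs E E + 2 * (K ^ 2 / lam ^ 4 * hs E E) := by ring
        rw [this]
        nlinarith
    _ ≤ (2 + 2 * K ^ 2 / lam ^ 4) * (4 / (1 - rootBound ω γ) * layerCard L) :=
        mul_le_mul_of_nonneg_left hE (by positivity)
    _ = _ := by rw [responseBound, ← mul_assoc]

/-- The mean of the decaying roots over all wave vectors. -/
noncomputable def meanRoot (ω γ : ℝ) (L : Fin n → ℕ) [∀ a, NeZero (L a)] : ℝ :=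
  (∑ k : Torus L, modeRoot ω γ k) / layerCard L

/-- The sum of the bond entries over a layer is a trace, namely the sum of the roots over the modes;
this is how the conductivity enters. -/
lemma hs_bond_response (D : ℕ → ℝ) :
    hs (bond N L D) (response ω γ lam N L)
      = layerCard L * (meanRoot ω γ L / (lam * ω ^ 2)) * ∑ i ∈ Finset.range (N - 1), D i := by
  have hl := layerCard_pos (L := L)
  rw [response, hs_smul_right, hs_bond D _ fun _ j => 2 * layerKernel ω γ L 1 j j]
  · have h := trace_layerKernel (L := L) ω γ 1
    simp only [pow_one] at h
    rw [← Finset.mul_sum, h, ← Finset.sum_mul, meanRoot]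
    field_simp
  · intro x y h
    have h1 : corrector ω γ N L y x = -corrector ω γ N L x y :=
      congrFun (congrFun corrector_transpose x) y
    have h2 : corrector ω γ N L x y = layerKernel ω γ L 1 x.2 x.2 := by
      have e : (y.1 : ℤ) - (x.1 : ℤ) = ((0 : ℕ) : ℤ) + 1 := by
        have := h.1
        omega
      rw [corrector, Matrix.of_apply, e, signedKernel_succ, h.2]
    rw [h1, h2]; ring

/-- The resulting positivity permits dividing the current by the mean root. -/
lemma meanRoot_ge (L : Fin n → ℕ) [∀ a, NeZero (L a)] :
    1 / (2 + (γ ^ 2 / ω ^ 2 + 4 * n)) ≤ meanRoot ω γ L := by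
  rw [meanRoot, le_div_iff₀ layerCard_pos, mul_comm, layerCard, ← nsmul_eq_mul, ← Finset.card_univ]
  exact Finset.card_nsmul_le_sum _ _ _ fun k _ => le_bandRoot (nuSq_nonneg _ _ _) (nuSq_le _ _ _)

lemma meanRoot_le_one (hω : 0 < ω) (hγ : 0 < γ) : meanRoot ω γ L ≤ 1 := by
  rw [meanRoot, div_le_one layerCard_pos, layerCard, ← mul_one (Fintype.card _ : ℝ),
    ← nsmul_eq_mul, ← Finset.card_univ]
  exact Finset.sum_le_card_nsmul _ _ _ fun k _ =>
    (modeRoot_le ω γ k).trans (rootBound_lt_one hω hγ).le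

end Corrector

end Crystal

namespace Crystal

/-! ### Rates for the gradient, the correlations and the current -/

section Asymptotics

variable {N n : ℕ} {L : Fin n → ℕ} [∀ a, NeZero (L a)] {ω γ lam TL TR : ℝ}

/-- The bound for the fluctuations of the temperature gradient. -/
noncomputable def gradientBound (ω γ lam : ℝ) (n : ℕ) : ℝ :=
  transportBound (potentialBound ω γ n) lam *
    (responseBound ω γ lam n / (2 * lam * γ ^ 2) ^ 2) + responseBound ω γ lam n

lemma responseBound_nonneg (hω : 0 < ω) (hγ : 0 < γ) (hlam : 0 < lam) :
    0 ≤ responseBound ω γ lam n := by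
  have := rootBound_lt_one hω hγ
  exact mul_nonneg (by positivity) (div_nonneg (by norm_num) (by linarith))

lemma transportBound_nonneg (K lam : ℝ) : 0 ≤ transportBound K lam := by
  rw [transportBound]
  positivity

lemma gradientBound_nonneg (hω : 0 < ω) (hγ : 0 < γ) (hlam : 0 < lam) :
    0 ≤ gradientBound ω γ lam n := by
  have h1 := responseBound_nonneg (n := n) hω hγ hlam
  have h2 := transportBound_nonneg (potentialBound ω γ n) lam
  rw [gradientBound]
  positivity

/-- For a self-consistent profile the temperature gradient is constant up to an error that is
bounded in `ℓ²`, uniformly in the size of the system. -/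
lemma IsSelfConsistent.exists_gradient {T : Site N L → ℝ}
    (h : IsSelfConsistent ω γ lam TL TR T) (hω : 0 < ω) (hγ : 0 < γ) (hlam : 0 < lam)
    {τ : ℕ → ℝ} (hτ : ∀ x, T x = τ x.1) :
    ∃ α : ℝ, (∀ x y : Site N L, IsUp x y → (cov (potential ω γ N L) lam T).toBlocks₁₂ x y
        = α * (meanRoot ω γ L / (2 * lam * ω ^ 2))) ∧
      ∑ i ∈ Finset.range (N - 1), (ω ^ 2 * (τ i - τ (i + 1)) - α) ^ 2
        ≤ gradientBound ω γ lam n * α ^ 2 := by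
  have hΦ := isElastic_potential (N := N) (L := L) hω hγ
  have hl := layerCard_pos (L := L)
  have hst := isSteadyMoments_cov hΦ hlam T
  obtain ⟨j, hj⟩ := h.exists_corr_eq hω hγ hlam
  have hmean : 0 < meanRoot ω γ L :=
    lt_of_lt_of_le (by positivity) (meanRoot_ge (ω := ω) (γ := γ) L)
  set c := meanRoot ω γ L / (2 * lam * ω ^ 2) with hc
  have hc0 : 0 < c := by positivity
  set Z := (cov (potential ω γ N L) lam T).toBlocks₁₂ with hZ
  -- Here c is the mean of the response over the bonds between two consecutive layers, so that α
  -- times the response has the same mean bond entry as Z.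
  refine ⟨j / c, fun x y hxy => by rw [hj x y hxy, div_mul_cancel₀ _ hc0.ne'], ?_⟩
  set α := j / c with hα
  set w := response ω γ lam N L with hw
  set D : ℕ → ℝ := fun i => ω ^ 2 * (τ i - τ (i + 1)) with hD
  set R := transport (potential ω γ N L) lam w - bond N L fun _ => 1 with hR
  have hRle : hs R R ≤ responseBound ω γ lam n * layerCard L :=
    hs_transport_response_sub_le hω hγ hlam
  set Y := Z - α • w with hY
  have horth : ∀ E : ℕ → ℝ, hs (bond N L E) Y = 0 := by
    intro E
    have h1 : hs (bond N L E) Z = ∑ i ∈ Finset.range (N - 1), E i * ∑ _j : Torus L, 2 * j := by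
      refine hs_bond E Z (fun _ _ => 2 * j) fun x y hxy => ?_
      have h2 : Z y x = -Z x y := congrFun (congrFun hst.anti x) y
      rw [h2, hj x y hxy]; ring
    have h3 : ∑ _j : Torus L, 2 * j = layerCard L * (2 * j) := by
      rw [Finset.sum_const, Finset.card_univ, nsmul_eq_mul, layerCard]
    rw [hY, hs_sub_right, hs_smul_right, hs_bond_response, h1, h3, ← Finset.sum_mul, hα]
    rw [show meanRoot ω γ L / (lam * ω ^ 2) = 2 * c by rw [hc]; field_simp]
    field_simp
    ring
  have hbond : bond N L D - α • bond N L (fun _ => 1) = bond N L fun i => D i - α := by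
    ext x y
    simp only [bond, Matrix.sub_apply, Matrix.smul_apply, Matrix.of_apply, smul_eq_mul]
    split_ifs <;> ring
  have htr : transport (potential ω γ N L) lam Y = (bond N L fun i => D i - α) - α • R := by
    rw [hY, transport_sub, transport_smul, hst.transport_eq hΦ.symm hlam,
      comm_potential_diagonal hω hτ, ← hbond, hR, smul_sub]
    abel
  -- Paired with Y, the unknown gradient fluctuations drop out by orthogonality, and only the end
  -- error remains.
  have hYle : (2 * lam * γ ^ 2) ^ 2 * hs Y Y ≤ α ^ 2 * hs R R := by
    have h1 := hΦ.hs_le_of_hs_transport_le hlam Y ((-α) • R) (by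
      rw [htr, hs_sub_right, hs_comm, horth, hs_smul_right, hs_smul_right]
      linarith)
    rw [hs_smul_left, hs_smul_right] at h1
    linarith
  -- The same equation solved for the fluctuations: boundedness of `transport` now controls them by
  -- Y and R.
  have hbd : (bond N L fun i => D i - α) = transport (potential ω γ N L) lam Y + α • R := by
    rw [htr]; abel
  have h1 := hs_self_add_le (transport (potential ω γ N L) lam Y) (α • R)
  rw [← hbd, hs_bond_self, hs_smul_left, hs_smul_right] at h1
  have h2 := hΦ.hs_transport_le hlam Y
  have hB := responseBound_nonneg (n := n) hω hγ hlam
  have hTB := transportBound_nonneg (potentialBound ω γ n) lam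
  have h3 : hs Y Y ≤ α ^ 2 * (responseBound ω γ lam n * layerCard L) / (2 * lam * γ ^ 2) ^ 2 := by
    rw [le_div_iff₀ (by positivity), mul_comm]
    exact hYle.trans (mul_le_mul_of_nonneg_left hRle (sq_nonneg _))
  have h4 := mul_le_mul_of_nonneg_left h3 hTB
  have h5 := mul_le_mul_of_nonneg_left hRle (sq_nonneg α)
  have h6 : layerCard L * ∑ i ∈ Finset.range (N - 1), (D i - α) ^ 2
      ≤ layerCard L * (gradientBound ω γ lam n * α ^ 2) := by
    have e : layerCard L * (gradientBound ω γ lam n * α ^ 2)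
        = transportBound (potentialBound ω γ n) lam *
          (α ^ 2 * (responseBound ω γ lam n * layerCard L) / (2 * lam * γ ^ 2) ^ 2)
          + α ^ 2 * (responseBound ω γ lam n * layerCard L) := by
      rw [gradientBound]; ring
    rw [e]
    linarith
  exact le_of_mul_le_mul_left h6 hl

lemma sq_sum_range_le {a : ℕ → ℝ} {k M : ℕ} {B : ℝ} (hk : k ≤ M)
    (h : ∑ i ∈ Finset.range M, a i ^ 2 ≤ B) :
    (∑ i ∈ Finset.range k, a i) ^ 2 ≤ M * B := by
  have h1 := sq_sum_le_card_mul_sum_sq (s := Finset.range k) (f := a)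
  rw [Finset.card_range] at h1
  have h2 : ∑ i ∈ Finset.range k, a i ^ 2 ≤ ∑ i ∈ Finset.range M, a i ^ 2 :=
    Finset.sum_le_sum_of_subset_of_nonneg (Finset.range_mono hk) fun i _ _ => sq_nonneg _
  have h3 : 0 ≤ ∑ i ∈ Finset.range k, a i ^ 2 := Finset.sum_nonneg fun i _ => sq_nonneg _
  have hkM : (k : ℝ) ≤ M := by exact_mod_cast hk
  exact h1.trans (mul_le_mul hkM (h2.trans h) h3 (by positivity))

/-- For N ≥ 16 G the deviation is at most |M α| / 2, so |M α| ≤ 2 |b|, and M ≥ N / 2 costs another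
factor 2. With b = ω²(TL - TR) this bounds α by the boundary data. -/
lemma sq_le_of_sq_sub_le {b M N G α : ℝ} (hG : 0 ≤ G) (hN : 16 * G ≤ N)
    (hM : N / 2 ≤ M) (h : (b - M * α) ^ 2 ≤ N * (G * α ^ 2)) : N ^ 2 * α ^ 2 ≤ 16 * b ^ 2 := by
  have h0 : N * (16 * G) ≤ 4 * M ^ 2 := by nlinarith
  have h1 : N * (G * α ^ 2) ≤ (M * α / 2) ^ 2 := by nlinarith [sq_nonneg α]
  have h2 := sq_le_sq.1 (h.trans h1)
  have h4 : |M * α| ≤ |b| + |b - M * α| := by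
    have := abs_sub b (b - M * α)
    rwa [sub_sub_cancel] at this
  rw [abs_div, abs_two] at h2
  have h5 : (M * α) ^ 2 ≤ (2 * b) ^ 2 := by
    rw [sq_le_sq, abs_mul 2 b, abs_two]
    linarith
  have h6 : N ^ 2 ≤ 4 * M ^ 2 := by nlinarith
  have h7 := mul_le_mul_of_nonneg_right h6 (sq_nonneg α)
  calc N ^ 2 * α ^ 2 ≤ 4 * (M * α) ^ 2 := by linarith [h7]
    _ ≤ 16 * b ^ 2 := by linarith

set_option maxHeartbeats 400000 in
/-- Quantitative version of the limit theorem. -/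
lemma exists_rate (n : ℕ) (TL TR : ℝ) (hω : 0 < ω) (hγ : 0 < γ) (hlam : 0 < lam) :
    ∃ C : ℝ, 0 ≤ C ∧ ∃ N₁ : ℕ, ∀ (N : ℕ) (L : Fin n → ℕ) [∀ a, NeZero (L a)], 2 ≤ N → N₁ ≤ N →
      ∀ T : Site N L → ℝ, IsSelfConsistent ω γ lam TL TR T →
        (∀ x, (T x - linearProfile TL TR x.1) ^ 2 ≤ C / N) ∧
        hs (cov (potential ω γ N L) lam T).toBlocks₁₂ (cov (potential ω γ N L) lam T).toBlocks₁₂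
          ≤ layerCard L * (C / N) ∧
        ∀ x y, IsUp x y → (((N : ℝ) - 1) * (ω ^ 2 *
          (cov (potential ω γ N L) lam T).toBlocks₁₂ x y)
          - ω ^ 2 / (2 * lam) * meanRoot ω γ L * (TL - TR)) ^ 2 ≤ C / N := by
  set G := gradientBound ω γ lam n with hG
  have hG0 : 0 ≤ G := gradientBound_nonneg hω hγ hlam
  set A := 16 * ω ^ 4 * (TL - TR) ^ 2 with hA
  have hA0 : 0 ≤ A := by positivity
  refine ⟨4 * G * A / ω ^ 4 + 4 * (G + 1) * A / (2 * lam * γ ^ 2) ^ 2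
    + G * A / (2 * lam) ^ 2, by positivity, ⌈16 * G⌉₊ + 1, ?_⟩
  set C₁ := 4 * G * A / ω ^ 4 with hC₁
  set C₂ := 4 * (G + 1) * A / (2 * lam * γ ^ 2) ^ 2 with hC₂
  set C₃ := G * A / (2 * lam) ^ 2 with hC₃
  have hC₁0 : 0 ≤ C₁ := by positivity
  have hC₂0 : 0 ≤ C₂ := by positivity
  have hC₃0 : 0 ≤ C₃ := by positivity
  intro N L _ hN hN₁ T hT
  have hΦ := isElastic_potential (N := N) (L := L) hω hγ
  have hl := layerCard_pos (L := L)
  obtain ⟨τ, hτ⟩ := hT.exists_layer hω hγ hlam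
  obtain ⟨α, hZ, hgrad⟩ := hT.exists_gradient hω hγ hlam hτ
  rw [← hG] at hgrad
  have hNr : (2 : ℝ) ≤ N := by exact_mod_cast hN
  have hN16 : 16 * G ≤ N := by
    have h1 := Nat.le_ceil (16 * G)
    have h2 : ((⌈16 * G⌉₊ + 1 : ℕ) : ℝ) ≤ N := by exact_mod_cast hN₁
    push_cast at h2
    linarith
  have hM : ((N - 1 : ℕ) : ℝ) = (N : ℝ) - 1 := by
    rw [Nat.cast_sub (by omega)]; simp
  set M : ℝ := (N : ℝ) - 1 with hMdef
  have hMN : (N : ℝ) / 2 ≤ M := by rw [hMdef]; linarith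
  have hM0 : 0 < M := by linarith
  have hMle : M ≤ N := by rw [hMdef]; linarith
  have h0 : τ 0 = TL := by
    have h1 := hT.left (⟨0, by omega⟩, 0) rfl
    rw [hτ] at h1
    exact h1
  have hlast : τ (N - 1) = TR := by
    have h1 := hT.right (⟨N - 1, by omega⟩, 0) (by simp only; omega)
    rw [hτ] at h1
    exact h1
  -- Cauchy-Schwarz for the telescoping sum of the gradient fluctuations.
  have hdev : ∀ k, k ≤ N - 1 → (ω ^ 2 * (τ 0 - τ k) - k * α) ^ 2 ≤ N * (G * α ^ 2) := by
    intro k hk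
    have h1 := sq_sum_range_le hk hgrad
    have h2 : ∑ i ∈ Finset.range k, (ω ^ 2 * (τ i - τ (i + 1)) - α)
        = ω ^ 2 * (τ 0 - τ k) - k * α := by
      rw [Finset.sum_sub_distrib, ← Finset.mul_sum, Finset.sum_range_sub']
      simp
    rw [h2, hM] at h1
    exact h1.trans (mul_le_mul_of_nonneg_right hMle (by positivity))
  have hend := hdev (N - 1) le_rfl
  rw [h0, hlast, hM] at hend
  have hα : N ^ 2 * α ^ 2 ≤ A := by
    have h1 := sq_le_of_sq_sub_le hG0 hN16 hMN hend
    rw [hA]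
    exact h1.trans_eq (by ring)
  have hN0 : (0 : ℝ) < N := by linarith
  have hNα : N * α ^ 2 ≤ A / N := by
    rw [le_div_iff₀ hN0]
    linarith [show (N : ℝ) * α ^ 2 * N = N ^ 2 * α ^ 2 by ring]
  have hdev' : ∀ k, k ≤ N - 1 → (ω ^ 2 * (τ 0 - τ k) - k * α) ^ 2 ≤ G * A / N := by
    intro k hk
    have h1 := mul_le_mul_of_nonneg_left hNα hG0
    rw [mul_div_assoc]
    linarith [hdev k hk]
  have hend' := hdev' (N - 1) le_rfl
  rw [h0, hlast, hM] at hend'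
  have hle₁ : C₁ / N ≤ (C₁ + C₂ + C₃) / N := by gcongr; linarith
  have hle₂ : C₂ / N ≤ (C₁ + C₂ + C₃) / N := by gcongr; linarith
  have hle₃ : C₃ / N ≤ (C₁ + C₂ + C₃) / N := by gcongr; linarith
  refine ⟨fun x => le_trans ?_ hle₁, le_trans ?_ (mul_le_mul_of_nonneg_left hle₂ hl.le),
    fun x y hxy => le_trans ?_ hle₃⟩
  · have hx : (x.1 : ℕ) ≤ N - 1 := by omega
    have h1 := hdev' _ hx
    set e := ω ^ 2 * (τ 0 - τ x.1) - (x.1 : ℕ) * α with he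
    set e' := ω ^ 2 * (TL - TR) - M * α with he'
    set t := ((x.1 : ℕ) : ℝ) / M with ht
    have ht0 : 0 ≤ t := by positivity
    have ht1 : t ≤ 1 := by
      rw [ht, div_le_one hM0, ← hM]
      exact_mod_cast hx
    -- The unknown mean gradient α cancels when the deviation at the right end is interpolated
    -- linearly.
    have h2 : ω ^ 2 * (T x - linearProfile TL TR x.1) = t * e' - e := by
      have h3 : t * M = (x.1 : ℕ) := div_mul_cancel₀ _ hM0.ne'
      rw [hτ, linearProfile, he, he', h0, ← hMdef, ← ht, ← h3]
      ring
    have h4 : (t * e' - e) ^ 2 ≤ 4 * (G * A / N) := by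
      have h5 : (t * e') ^ 2 ≤ e' ^ 2 := by
        rw [mul_pow]
        exact mul_le_of_le_one_left (sq_nonneg _) (pow_le_one₀ ht0 ht1)
      linarith [sq_nonneg (t * e' + e), show (t * e' - e) ^ 2 + (t * e' + e) ^ 2
        = 2 * (t * e') ^ 2 + 2 * e ^ 2 by ring]
    rw [← h2] at h4
    have h6 : C₁ / N = 4 * (G * A / N) / ω ^ 4 := by rw [hC₁]; ring
    rw [h6, le_div_iff₀ (by positivity)]
    linarith [show (ω ^ 2 * (T x - linearProfile TL TR x.1)) ^ 2
      = (T x - linearProfile TL TR x.1) ^ 2 * ω ^ 4 by ring]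
  · have hst := isSteadyMoments_cov hΦ hlam T
    -- Coercivity bounds Z by the temperature differences, whose squares sum to O(1/N).
    have h1 := hΦ.hs_le_of_hs_transport_le hlam (cov (potential ω γ N L) lam T).toBlocks₁₂
      (transport (potential ω γ N L) lam (cov (potential ω γ N L) lam T).toBlocks₁₂) le_rfl
    rw [hst.transport_eq hΦ.symm hlam, comm_potential_diagonal hω hτ, hs_bond_self] at h1
    have h2 : ∑ i ∈ Finset.range (N - 1), (ω ^ 2 * (τ i - τ (i + 1))) ^ 2
        ≤ 2 * (G + 1) * (A / N) := by
      have h3 : ∑ i ∈ Finset.range (N - 1), (ω ^ 2 * (τ i - τ (i + 1))) ^ 2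
          ≤ ∑ i ∈ Finset.range (N - 1),
            (2 * (ω ^ 2 * (τ i - τ (i + 1)) - α) ^ 2 + 2 * α ^ 2) :=
        Finset.sum_le_sum fun i _ => by
          linarith [sq_nonneg (ω ^ 2 * (τ i - τ (i + 1)) - 2 * α)]
      rw [Finset.sum_add_distrib, ← Finset.mul_sum, Finset.sum_const, Finset.card_range,
        nsmul_eq_mul, hM] at h3
      have h4 : M * (2 * α ^ 2) ≤ 2 * (A / N) := by
        linarith [mul_le_mul_of_nonneg_right hMle (sq_nonneg α)]
      have h5 : G * α ^ 2 ≤ G * (A / N) := by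
        refine mul_le_mul_of_nonneg_left (le_trans ?_ hNα) hG0
        exact le_mul_of_one_le_left (sq_nonneg α) (by linarith)
      linarith
    have h6 : layerCard L * (C₂ / N)
        = layerCard L * (2 * (2 * (G + 1) * (A / N))) / (2 * lam * γ ^ 2) ^ 2 := by
      rw [hC₂]; ring
    rw [h6, le_div_iff₀ (by positivity), mul_comm]
    have h7 := mul_le_mul_of_nonneg_left h2 hl.le
    linarith
  · have hm0 : 0 < meanRoot ω γ L :=
      lt_of_lt_of_le (by positivity) (meanRoot_ge (ω := ω) (γ := γ) L)
    have hm1 := meanRoot_le_one (L := L) hω hγ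
    have h1 : M * (ω ^ 2 * (cov (potential ω γ N L) lam T).toBlocks₁₂ x y)
        - ω ^ 2 / (2 * lam) * meanRoot ω γ L * (TL - TR)
        = -(meanRoot ω γ L / (2 * lam)) * (ω ^ 2 * (TL - TR) - M * α) := by
      rw [hZ x y hxy]
      field_simp
      ring
    have h2 : meanRoot ω γ L ^ 2 ≤ 1 := pow_le_one₀ hm0.le hm1
    have h3 : C₃ / N = 1 / (2 * lam) ^ 2 * (G * A / N) := by rw [hC₃]; ring
    rw [h1, h3, mul_pow, neg_sq, div_pow]
    exact mul_le_mul (by gcongr) hend' (sq_nonneg _) (by positivity)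

end Asymptotics

end Crystal

namespace Crystal

/-! ### Deviation from local equilibrium in terms of Z -/

section LocalMoments

variable {ι : Type*} [Fintype ι] [DecidableEq ι] {Φ : Matrix ι ι ℝ} {g K lam : ℝ} {T : ι → ℝ}
  {U Z V : Matrix ι ι ℝ}

lemma IsSteadyMoments.hs_mom_sub_le (h : IsSteadyMoments Φ lam T U Z V) (hΦ : IsElastic Φ g K)
    (hlam : 0 < lam) :
    hs (V - Matrix.diagonal T) (V - Matrix.diagonal T) ≤ K ^ 2 / lam ^ 2 * hs Z Z := by
  have h1 : V - Matrix.diagonal T = (-(1 / (2 * lam))) • comm Φ Z := by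
    rw [neg_smul, ← h.mom_sub hlam, neg_sub]
  rw [h1, hs_smul_left, hs_smul_right]
  have h2 := mul_le_mul_of_nonneg_left (hΦ.hs_comm_le Z) (sq_nonneg (1 / (2 * lam)))
  calc _ = (1 / (2 * lam)) ^ 2 * hs (comm Φ Z) (comm Φ Z) := by ring
    _ ≤ _ := h2
    _ = _ := by field_simp; norm_num

/-- U - diag T Φ⁻¹ = (V - diag T - λZ) Φ⁻¹, and V - diag T is a multiple of [Φ, Z]. -/
lemma IsSteadyMoments.hs_pos_sub_le (h : IsSteadyMoments Φ lam T U Z V) (hΦ : IsElastic Φ g K)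
    (hlam : 0 < lam) :
    hs (U - Matrix.diagonal T * Φ⁻¹) (U - Matrix.diagonal T * Φ⁻¹)
      ≤ (2 * K ^ 2 / lam ^ 2 + 2 * lam ^ 2) / g ^ 2 * hs Z Z := by
  have hg := hΦ.pos
  have h1 : U - Matrix.diagonal T * Φ⁻¹ = (V - Matrix.diagonal T - lam • Z) * Φ⁻¹ := by
    rw [h.pos_mom, show U * Φ + lam • Z - Matrix.diagonal T - lam • Z
      = U * Φ - Matrix.diagonal T by abel, Matrix.sub_mul,
      Matrix.mul_nonsing_inv_cancel_right _ _ hΦ.isUnit_det]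
  have h2 := hΦ.hs_mul_inv_le (V - Matrix.diagonal T - lam • Z)
  have h3 := hs_self_sub_le (V - Matrix.diagonal T) (lam • Z)
  rw [hs_smul_left, hs_smul_right] at h3
  have h4 := h.hs_mom_sub_le hΦ hlam
  rw [h1, div_mul_eq_mul_div, le_div_iff₀ (by positivity), mul_comm]
  refine h2.trans (h3.trans ?_)
  calc _ ≤ 2 * (K ^ 2 / lam ^ 2 * hs Z Z) + 2 * (lam * (lam * hs Z Z)) := by linarith
    _ = _ := by ring

/-- The equilibrium covariance is a multiple of `diag (Φ⁻¹, 1)`. -/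
lemma cov_const (hΦ : IsElastic Φ g K) (hlam : 0 < lam) (θ : ℝ) :
    cov Φ lam (fun _ => θ) = θ • Matrix.fromBlocks Φ⁻¹ 0 0 1 := by
  have h := isSteadyMoments_cov hΦ hlam fun _ => θ
  obtain ⟨h1, h2, h3⟩ := h.unique (IsSteadyMoments.const hΦ θ) hΦ hlam
  have h4 : (cov Φ lam fun _ => θ).toBlocks₂₁ = 0 := by
    have h5 := cov_transpose Φ lam fun _ => θ
    ext x y
    have h6 := congrFun (congrFun h5 (Sum.inl y)) (Sum.inr x)
    have h7 := congrFun (congrFun h2 y) x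
    exact h6.trans h7
  rw [← Matrix.fromBlocks_toBlocks (cov Φ lam fun _ => θ), h1, h2, h3, h4, Matrix.fromBlocks_smul]
  simp

/-- For the column v = Φ⁻¹ e_y coercivity reads g ‖v‖² ≤ v_y ≤ ‖v‖, so ‖v‖ ≤ 1 / g. -/
lemma IsElastic.abs_inv_apply_le (hΦ : IsElastic Φ g K) (x y : ι) : |Φ⁻¹ x y| ≤ 1 / g := by
  have hg := hΦ.pos
  set v : ι → ℝ := fun z => Φ⁻¹ z y with hv
  have h1 : Φ.mulVec v = fun z => (1 : Matrix ι ι ℝ) z y := by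
    rw [← Matrix.mul_nonsing_inv Φ hΦ.isUnit_det]
    rfl
  have h2 := hΦ.coercive v
  have h3 : v ⬝ᵥ (fun z => (1 : Matrix ι ι ℝ) z y) = v y := by
    simp [dotProduct, Matrix.one_apply]
  rw [h1, h3] at h2
  have h4 : ∀ z, v z ^ 2 ≤ v ⬝ᵥ v := fun z => by
    rw [sq]
    exact Finset.single_le_sum (f := fun z => v z * v z) (fun z _ => mul_self_nonneg _)
      (Finset.mem_univ z)
  have h5 : v y ≤ 1 / g := by
    rw [le_div_iff₀ hg]
    by_contra! hc
    have h6 := mul_le_mul_of_nonneg_left (h4 y) hg.le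
    have h7 : 0 < v y := by
      by_contra! h8
      nlinarith
    nlinarith
  have h6 : v ⬝ᵥ v ≤ (1 / g) ^ 2 := by
    have h7 : v ⬝ᵥ v ≤ v y / g := by rw [le_div_iff₀ hg]; linarith
    refine h7.trans ?_
    rw [sq, div_eq_mul_one_div]
    exact mul_le_mul_of_nonneg_right h5 (by positivity)
  exact abs_le_of_sq_le_sq ((h4 x).trans h6) (by positivity)

lemma IsElastic.abs_equilibrium_apply_le (hΦ : IsElastic Φ g K) (b c : ι ⊕ ι) :
    |(Matrix.fromBlocks Φ⁻¹ 0 0 1 : Matrix (ι ⊕ ι) (ι ⊕ ι) ℝ) b c| ≤ 1 / g + 1 := by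
  have hg : 0 < 1 / g := by have := hΦ.pos; positivity
  rcases b with x | x <;> rcases c with y | y
  · exact (hΦ.abs_inv_apply_le x y).trans (by linarith)
  · simp only [Matrix.fromBlocks_apply₁₂, Matrix.zero_apply, abs_zero]
    linarith
  · simp only [Matrix.fromBlocks_apply₂₁, Matrix.zero_apply, abs_zero]
    linarith
  · simp only [Matrix.fromBlocks_apply₂₂, Matrix.one_apply]
    split_ifs
    · rw [abs_one]; linarith
    · rw [abs_zero]; linarith

end LocalMoments

/-! ### Pointwise comparison with local equilibrium -/

section LocalEquilibrium

variable {N n : ℕ} {L : Fin n → ℕ} [∀ a, NeZero (L a)] {ω γ lam TL TR : ℝ}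

/-- The constant in the comparison of a steady state with local equilibrium. -/
noncomputable def localBound (ω γ lam : ℝ) (n : ℕ) : ℝ :=
  1 + potentialBound ω γ n ^ 2 / lam ^ 2
    + (2 * potentialBound ω γ n ^ 2 / lam ^ 2 + 2 * lam ^ 2) / (γ ^ 2) ^ 2

lemma IsInvariant.sq_apply_le_of_hs_le {Y : Matrix (Site N L) (Site N L) ℝ} (h : IsInvariant Y)
    {B : ℝ} (hB : hs Y Y ≤ layerCard L * B) (x y : Site N L) : Y x y ^ 2 ≤ B :=
  le_of_mul_le_mul_left ((h.sq_apply_le x y).trans hB) layerCard_pos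

/-- The covariance of the steady state of a self-consistent profile is close to the covariance of
local equilibrium, if the position-momentum correlations are small. -/
lemma IsSelfConsistent.sq_cov_sub_le {T : Site N L → ℝ} (h : IsSelfConsistent ω γ lam TL TR T)
    (hω : 0 < ω) (hγ : 0 < γ) (hlam : 0 < lam) {B : ℝ}
    (hB : hs (cov (potential ω γ N L) lam T).toBlocks₁₂ (cov (potential ω γ N L) lam T).toBlocks₁₂
      ≤ layerCard L * B) (b c : Coord N L) :
    (cov (potential ω γ N L) lam T b c - T (siteOf b) *
      (Matrix.fromBlocks (potential ω γ N L)⁻¹ 0 0 1 : Matrix (Coord N L) (Coord N L) ℝ) b c) ^ 2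
      ≤ localBound ω γ lam n * B := by
  have hΦ := isElastic_potential (N := N) (L := L) hω hγ
  have hl := layerCard_pos (L := L)
  have hst := isSteadyMoments_cov hΦ hlam T
  obtain ⟨hU, hZ, hV⟩ := h.isInvariant hω hγ hlam
  have hD : ∀ c, (Matrix.diagonal T).submatrix (reflect c) (reflect c) = Matrix.diagonal T := by
    intro c
    rw [Matrix.submatrix_diagonal_equiv, h.comp_reflect hω hγ hlam]
  -- The comparison matrices are reflection invariant as well, so the Hilbert-Schmidt bounds for the
  -- differences become bounds for their entries.
  have hI : ∀ c, (potential ω γ N L)⁻¹.submatrix (reflect c) (reflect c)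
      = (potential ω γ N L)⁻¹ := by
    intro c
    rw [← Matrix.inv_submatrix_equiv, potential_reflect hω]
  have hB0 : 0 ≤ B := nonneg_of_mul_nonneg_right ((hs_self_nonneg _).trans hB) hl
  set K := potentialBound ω γ n
  have hle : ∀ {r : ℝ}, r ≤ localBound ω γ lam n → r * B ≤ localBound ω γ lam n * B :=
    fun hr => mul_le_mul_of_nonneg_right hr hB0
  have hp₁ : 0 ≤ K ^ 2 / lam ^ 2 := by positivity
  have hp₂ : 0 ≤ (2 * K ^ 2 / lam ^ 2 + 2 * lam ^ 2) / (γ ^ 2) ^ 2 := by positivity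
  have hscale : ∀ {r s : ℝ}, 0 ≤ r →
      s ≤ r * hs (cov (potential ω γ N L) lam T).toBlocks₁₂
        (cov (potential ω γ N L) lam T).toBlocks₁₂ → s ≤ layerCard L * (r * B) := by
    intro r s hr hs'
    refine hs'.trans ((mul_le_mul_of_nonneg_left hB hr).trans_eq (by ring))
  have hone : B ≤ localBound ω γ lam n * B :=
    le_mul_of_one_le_left hB0 (by rw [localBound]; linarith)
  have hZle := fun x y => hZ.sq_apply_le_of_hs_le hB x y
  rcases b with x | x <;> rcases c with y | y
  · have h1 : IsInvariant ((cov (potential ω γ N L) lam T).toBlocks₁₁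
        - Matrix.diagonal T * (potential ω γ N L)⁻¹) := by
      intro c
      conv_rhs => rw [← hU c, ← hD c, ← hI c, Matrix.submatrix_mul_equiv]
      rfl
    have h2 := h1.sq_apply_le_of_hs_le (hscale hp₂ (hst.hs_pos_sub_le hΦ hlam)) x y
    rw [Matrix.sub_apply, Matrix.diagonal_mul] at h2
    exact h2.trans (hle (by rw [localBound]; linarith))
  · rw [Matrix.fromBlocks_apply₁₂, Matrix.zero_apply, mul_zero, sub_zero]
    exact (hZle x y).trans hone
  · rw [Matrix.fromBlocks_apply₂₁, Matrix.zero_apply, mul_zero, sub_zero,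
      ← congrFun (congrFun (cov_transpose (potential ω γ N L) lam T) (Sum.inr x)) (Sum.inl y)]
    exact (hZle y x).trans hone
  · have h1 : IsInvariant ((cov (potential ω γ N L) lam T).toBlocks₂₂ - Matrix.diagonal T) := by
      intro c
      conv_rhs => rw [← hV c, ← hD c]
      rfl
    have h2 := h1.sq_apply_le_of_hs_le (hscale hp₁ (hst.hs_mom_sub_le hΦ hlam)) x y
    have h3 : Matrix.diagonal T x y = T x * (1 : Matrix (Site N L) (Site N L) ℝ) x y := by
      rw [← Matrix.diagonal_one, Matrix.diagonal_apply, Matrix.diagonal_apply]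
      split_ifs <;> simp
    rw [Matrix.sub_apply, h3] at h2
    exact h2.trans (hle (by rw [localBound]; linarith))

end LocalEquilibrium

end Crystal

namespace Crystal

/-! ### The mean root as a Riemann sum -/

section RiemannSum

variable {n : ℕ}

/-- The cell of the unit cube with lower corner at the wave vector of `k`. -/
def cell {L : Fin n → ℕ} (k : Torus L) : Set (Fin n → ℝ) :=
  Set.univ.pi fun a => Set.Ico (waveVector k a) (waveVector k a + 1 / (L a : ℝ))

lemma measurableSet_cell {L : Fin n → ℕ} (k : Torus L) : MeasurableSet (cell k) :=
  MeasurableSet.univ_pi fun _ => measurableSet_Ico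

variable {L : Fin n → ℕ} [∀ a, NeZero (L a)]

lemma side_pos (L : Fin n → ℕ) [∀ a, NeZero (L a)] (a : Fin n) : (0 : ℝ) < L a :=
  Nat.cast_pos.2 (Nat.pos_of_ne_zero (NeZero.ne _))

/-- Described by floors, the cell containing a point determines k, which gives both disjointness and
the covering of the half-open cube. -/
lemma mem_cell_iff {k : Torus L} {y : Fin n → ℝ} :
    y ∈ cell k ↔ ∀ a, 0 ≤ y a ∧ ⌊(L a : ℝ) * y a⌋₊ = (k a).val := by
  simp only [cell, Set.mem_univ_pi, Set.mem_Ico, waveVector]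
  refine forall_congr' fun a => ?_
  have hL := side_pos L a
  have e : ((k a).val : ℝ) / L a + 1 / L a = ((k a).val + 1) / L a := by ring
  rw [e, div_le_iff₀ hL, lt_div_iff₀ hL]
  constructor
  · rintro ⟨h1, h2⟩
    have h3 : 0 ≤ y a * L a := le_trans (Nat.cast_nonneg _) h1
    have h4 : 0 ≤ y a := nonneg_of_mul_nonneg_left h3 hL
    refine ⟨h4, ?_⟩
    rw [Nat.floor_eq_iff (by positivity), mul_comm]
    exact ⟨h1, h2⟩
  · rintro ⟨h1, h2⟩
    rw [Nat.floor_eq_iff (by positivity), mul_comm] at h2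
    exact h2

lemma iUnion_cell : ⋃ k : Torus L, cell k = Set.univ.pi fun _ : Fin n => Set.Ico (0 : ℝ) 1 := by
  ext y
  simp only [Set.mem_iUnion, mem_cell_iff, Set.mem_univ_pi, Set.mem_Ico]
  constructor
  · rintro ⟨k, hk⟩ a
    refine ⟨(hk a).1, ?_⟩
    have hL := side_pos L a
    have h1 := Nat.lt_floor_add_one ((L a : ℝ) * y a)
    rw [(hk a).2] at h1
    have h2 : ((k a).val : ℝ) + 1 ≤ L a := by exact_mod_cast ZMod.val_lt (k a)
    by_contra! h3
    nlinarith
  · intro h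
    refine ⟨fun a => (⌊(L a : ℝ) * y a⌋₊ : ZMod (L a)), fun a => ⟨(h a).1, ?_⟩⟩
    have hL := side_pos L a
    rw [ZMod.val_cast_of_lt]
    rw [Nat.floor_lt (mul_nonneg hL.le (h a).1)]
    exact mul_lt_of_lt_one_right hL (h a).2

lemma pairwise_disjoint_cell : Pairwise (Function.onFun Disjoint (cell : Torus L → _)) := by
  intro k k' hkk'
  refine Set.disjoint_left.2 fun y hy hy' => hkk' ?_
  rw [mem_cell_iff] at hy hy'
  funext a
  exact ZMod.val_injective _ ((hy a).2.symm.trans (hy' a).2)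

lemma volume_real_cell (k : Torus L) : volume.real (cell k) = 1 / layerCard L := by
  have h1 : volume.real (cell k) = ∏ a, (1 / (L a : ℝ)) := by
    rw [cell, Measure.real, Real.volume_pi_Ico, ENNReal.toReal_prod]
    refine Finset.prod_congr rfl fun a _ => ?_
    have hL := side_pos L a
    rw [add_sub_cancel_left, ENNReal.toReal_ofReal (by positivity)]
  rw [h1, layerCard, Fintype.card_pi]
  simp [ZMod.card]

lemma waveVector_mem (k : Torus L) : waveVector k ∈ Set.Icc (0 : Fin n → ℝ) 1 := by
  refine ⟨fun a => ?_, fun a => ?_⟩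
  · have hL := side_pos L a
    simp only [waveVector, Pi.zero_apply]
    positivity
  · have hL := side_pos L a
    simp only [waveVector, Pi.one_apply]
    rw [div_le_one hL]
    exact_mod_cast (ZMod.val_lt (k a)).le

/-- Riemann sums over the dual torus converge to the integral over the unit cube. -/
lemma exists_riemannSum {f : (Fin n → ℝ) → ℝ} (hf : Continuous f) {ε : ℝ} (hε : 0 < ε) :
    ∃ N₀ : ℕ, ∀ (L : Fin n → ℕ) [∀ a, NeZero (L a)], (∀ a, N₀ ≤ L a) →
      |(∑ k : Torus L, f (waveVector k)) / layerCard L - ∫ y in Set.Icc (0 : Fin n → ℝ) 1, f y|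
        ≤ ε := by
  have hc : UniformContinuousOn f (Set.Icc (0 : Fin n → ℝ) 1) :=
    isCompact_Icc.uniformContinuousOn_of_continuous hf.continuousOn
  obtain ⟨δ, hδ, hfδ⟩ := Metric.uniformContinuousOn_iff.1 hc ε hε
  -- This makes every side 1 / L a of a cell strictly shorter than δ.
  refine ⟨⌈1 / δ⌉₊ + 1, fun L _ hL => ?_⟩
  have hint : IntegrableOn f (Set.Icc (0 : Fin n → ℝ) 1) := hf.continuousOn.integrableOn_compact
    isCompact_Icc
  have hsub : ∀ k : Torus L, cell k ⊆ Set.Icc (0 : Fin n → ℝ) 1 := by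
    intro k y hy
    have h1 : y ∈ ⋃ k : Torus L, cell k := Set.mem_iUnion.2 ⟨k, hy⟩
    rw [iUnion_cell, Set.mem_univ_pi] at h1
    exact ⟨fun a => (h1 a).1, fun a => (h1 a).2.le⟩
  have hsplit : ∫ y in Set.Icc (0 : Fin n → ℝ) 1, f y
      = ∑ k : Torus L, ∫ y in cell k, f y := by
    have h1 : (Set.univ.pi fun _ : Fin n => Set.Ico (0 : ℝ) 1)
        =ᵐ[volume] Set.Icc (0 : Fin n → ℝ) 1 :=
      Measure.univ_pi_Ico_ae_eq_Icc (f := (0 : Fin n → ℝ)) (g := 1)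
    rw [← setIntegral_congr_set h1, ← iUnion_cell (L := L),
      integral_iUnion_fintype measurableSet_cell pairwise_disjoint_cell
        fun k => hint.mono_set (hsub k)]
  have hl := layerCard_pos (L := L)
  have hcell : ∀ k : Torus L, |f (waveVector k) / layerCard L - ∫ y in cell k, f y|
      ≤ ε * (1 / layerCard L) := by
    intro k
    have hfin : volume (cell k) < ⊤ :=
      (measure_mono (hsub k)).trans_lt isCompact_Icc.measure_lt_top
    have h1 : f (waveVector k) / layerCard L = ∫ _ in cell k, f (waveVector k) := by
      rw [setIntegral_const, volume_real_cell, smul_eq_mul]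
      ring
    have hconst : IntegrableOn (fun _ : Fin n → ℝ => f (waveVector k)) (cell k) :=
      integrableOn_const hfin.ne
    rw [h1, ← integral_sub hconst (hint.mono_set (hsub k)),
      ← volume_real_cell k, ← Real.norm_eq_abs]
    refine norm_setIntegral_le_of_norm_le_const hfin fun y hy => ?_
    rw [← dist_eq_norm]
    refine (hfδ _ (waveVector_mem k) y (hsub k hy) ?_).le
    rw [dist_pi_lt_iff hδ]
    intro a
    have h2 := hy a (Set.mem_univ a)
    have h3 : 1 / (L a : ℝ) < δ := by
      have h4 := Nat.le_ceil (1 / δ)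
      have h5 : ((⌈1 / δ⌉₊ + 1 : ℕ) : ℝ) ≤ L a := by exact_mod_cast hL a
      push_cast at h5
      rw [one_div_lt (side_pos L a) hδ]
      linarith
    rw [dist_comm, Real.dist_eq, abs_of_nonneg (by linarith [h2.1])]
    linarith [h2.2]
  rw [hsplit, Finset.sum_div, ← Finset.sum_sub_distrib]
  refine (Finset.abs_sum_le_sum_abs _ _).trans ((Finset.sum_le_sum fun k _ => hcell k).trans_eq ?_)
  rw [Finset.sum_const, Finset.card_univ, nsmul_eq_mul]
  change layerCard L * _ = _
  field_simp

lemma continuous_bandRoot_nuSq (ω γ : ℝ) :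
    Continuous fun y : Fin n → ℝ => bandRoot (nuSq ω γ y) := by
  have h : Continuous fun y : Fin n → ℝ => nuSq ω γ y := by
    simp only [nuSq]
    fun_prop
  simp only [bandRoot]
  refine continuous_const.div (by fun_prop) fun y => ?_
  have := nuSq_nonneg ω γ y
  positivity

lemma conductivity_eq (ω γ lam : ℝ) (n : ℕ) :
    conductivity ω γ lam n
      = ω ^ 2 / (2 * lam) * ∫ y in Set.Icc (0 : Fin n → ℝ) 1, bandRoot (nuSq ω γ y) := by
  have h : ∀ y : Fin n → ℝ, bandRoot (nuSq ω γ y)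
      = 2 * (1 / (2 + nuSq ω γ y + Real.sqrt (nuSq ω γ y * (4 + nuSq ω γ y)))) :=
    fun y => by rw [bandRoot]; ring
  simp only [h, integral_const_mul, conductivity]
  ring

lemma exists_meanRoot (ω γ lam : ℝ) (n : ℕ) (Δ : ℝ) {ε : ℝ} (hε : 0 < ε) :
    ∃ N₀ : ℕ, ∀ (L : Fin n → ℕ) [∀ a, NeZero (L a)], (∀ a, N₀ ≤ L a) →
      |ω ^ 2 / (2 * lam) * meanRoot ω γ L * Δ - conductivity ω γ lam n * Δ| ≤ ε := by
  set r := |ω ^ 2 / (2 * lam) * Δ| with hr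
  obtain ⟨N₀, h⟩ := exists_riemannSum (continuous_bandRoot_nuSq (n := n) ω γ)
    (ε := ε / (r + 1)) (by positivity)
  refine ⟨N₀, fun L _ hL => ?_⟩
  have h1 := h L hL
  have h2 : (∑ k : Torus L, bandRoot (nuSq ω γ (waveVector k))) / layerCard L
    = meanRoot ω γ L := rfl
  rw [h2] at h1
  rw [conductivity_eq, show ∀ a b I : ℝ, a * b * Δ - a * I * Δ = (a * Δ) * (b - I) by
    intros; ring, abs_mul, ← hr]
  calc r * _ ≤ (r + 1) * (ε / (r + 1)) :=
        mul_le_mul (by linarith) h1 (abs_nonneg _) (by positivity)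
    _ = ε := mul_div_cancel₀ _ (by positivity)

end RiemannSum

/-! ### Uniform limits and convergence of moments -/

section Limits

variable {ω γ lam : ℝ}

/-- The rates of convergence imply uniform convergence. -/
lemma exists_limits (n : ℕ) (TL TR : ℝ) (hω : 0 < ω) (hγ : 0 < γ) (hlam : 0 < lam) {ε : ℝ}
    (hε : 0 < ε) :
    ∃ N₀ : ℕ, ∀ (N : ℕ) (L : Fin n → ℕ) [∀ a, NeZero (L a)], 2 ≤ N → N₀ ≤ N →
      ∀ T : Site N L → ℝ, IsSelfConsistent ω γ lam TL TR T →
        (∀ x, |T x - linearProfile TL TR x.1| ≤ ε) ∧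
        (∀ b c, |cov (potential ω γ N L) lam T b c - T (siteOf b) *
          (Matrix.fromBlocks (potential ω γ N L)⁻¹ 0 0 1 : Matrix (Coord N L) (Coord N L) ℝ) b c|
            ≤ ε) ∧
        ∀ x y, IsUp x y → |((N : ℝ) - 1) * (ω ^ 2 *
          (cov (potential ω γ N L) lam T).toBlocks₁₂ x y)
          - ω ^ 2 / (2 * lam) * meanRoot ω γ L * (TL - TR)| ≤ ε := by
  obtain ⟨C, hC, N₁, h⟩ := exists_rate n TL TR hω hγ hlam
  have hB : 1 ≤ localBound ω γ lam n := by
    rw [localBound]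
    have h1 : 0 ≤ potentialBound ω γ n ^ 2 / lam ^ 2 := by positivity
    have h2 : 0 ≤ (2 * potentialBound ω γ n ^ 2 / lam ^ 2 + 2 * lam ^ 2) / (γ ^ 2) ^ 2 := by
      positivity
    linarith
  refine ⟨max N₁ ⌈localBound ω γ lam n * C / ε ^ 2⌉₊, fun N L _ hN hN₀ T hT => ?_⟩
  obtain ⟨h1, h2, h3⟩ := h N L hN ((le_max_left _ _).trans hN₀) T hT
  have hN0 : (0 : ℝ) < N := by exact_mod_cast (by omega : 0 < N)
  have hsmall : localBound ω γ lam n * (C / N) ≤ ε ^ 2 := by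
    have h4 : (⌈localBound ω γ lam n * C / ε ^ 2⌉₊ : ℝ) ≤ N := by
      exact_mod_cast (le_max_right _ _).trans hN₀
    have h5 := (Nat.le_ceil _).trans h4
    rw [div_le_iff₀ (by positivity)] at h5
    rw [← mul_div_assoc, div_le_iff₀ hN0]
    linarith
  have hsmall' : C / N ≤ ε ^ 2 := (le_mul_of_one_le_left (by positivity) hB).trans hsmall
  exact ⟨fun x => abs_le_of_sq_le_sq ((h1 x).trans hsmall') hε.le,
    fun b c => abs_le_of_sq_le_sq ((hT.sq_cov_sub_le hω hγ hlam h2 b c).trans hsmall) hε.le,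
    fun x y hxy => abs_le_of_sq_le_sq ((h3 x y hxy).trans hsmall') hε.le⟩

variable {N n : ℕ} {L : Fin n → ℕ}

lemma linearProfile_mem {TL TR : ℝ} (hN : 2 ≤ N) (i : Fin N) :
    min TL TR ≤ linearProfile TL TR i ∧ linearProfile TL TR i ≤ max TL TR := by
  have hM : (0 : ℝ) < (N : ℝ) - 1 := by
    have : (2 : ℝ) ≤ N := by exact_mod_cast hN
    linarith
  set t := ((i : ℕ) : ℝ) / ((N : ℝ) - 1) with ht
  have ht0 : 0 ≤ t := by positivity
  have ht1 : t ≤ 1 := by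
    rw [ht, div_le_one hM]
    have : ((i : ℕ) : ℝ) + 1 ≤ N := by exact_mod_cast i.2
    linarith
  rw [linearProfile, ← ht]
  constructor
  · have h1 := mul_le_mul_of_nonneg_left (min_le_right TL TR) ht0
    have h2 := mul_le_mul_of_nonneg_left (min_le_left TL TR) (sub_nonneg.2 ht1)
    linarith
  · have h1 := mul_le_mul_of_nonneg_left (le_max_right TL TR) ht0
    have h2 := mul_le_mul_of_nonneg_left (le_max_left TL TR) (sub_nonneg.2 ht1)
    linarith

lemma abs_linearProfile_sub_le (TL TR : ℝ) (hN : 2 ≤ N) {i j : Fin N} {R : ℕ}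
    (h : |((i : ℕ) : ℤ) - ((j : ℕ) : ℤ)| ≤ R) :
    |linearProfile TL TR i - linearProfile TL TR j| ≤ R * |TR - TL| / ((N : ℝ) - 1) := by
  have hM : (0 : ℝ) < (N : ℝ) - 1 := by
    have : (2 : ℝ) ≤ N := by exact_mod_cast hN
    linarith
  have h1 : |((i : ℕ) : ℝ) - ((j : ℕ) : ℝ)| ≤ R := by exact_mod_cast h
  have e : linearProfile TL TR i - linearProfile TL TR j
      = (((i : ℕ) : ℝ) - ((j : ℕ) : ℝ)) * (TR - TL) / ((N : ℝ) - 1) := by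
    rw [linearProfile, linearProfile]; ring
  rw [e, abs_div, abs_mul, abs_of_pos hM]
  gcongr

variable [∀ a, NeZero (L a)]

lemma posSemidef_gibbs (hω : 0 < ω) (hγ : 0 < γ) {θ : ℝ} (hθ : 0 ≤ θ) :
    (θ • Matrix.fromBlocks (potential ω γ N L)⁻¹ 0 0 1 :
      Matrix (Coord N L) (Coord N L) ℝ).PosSemidef := by
  have hΦ := isElastic_potential (N := N) (L := L) hω hγ
  -- The Gibbs covariance is the steady covariance at uniform temperature for any friction; friction
  -- 1 is an arbitrary choice.
  rw [← cov_const hΦ one_pos θ]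
  exact cov_posSemidef hΦ one_pos fun _ => hθ

lemma integral_mul_gibbsState (hω : 0 < ω) (hγ : 0 < γ) {θ : ℝ} (hθ : 0 ≤ θ) (b c : Coord N L) :
    ∫ z, z b * z c ∂(gibbsState ω γ N L θ) = θ *
      (Matrix.fromBlocks (potential ω γ N L)⁻¹ 0 0 1 : Matrix (Coord N L) (Coord N L) ℝ) b c := by
  rw [gibbsState, integral_mul_gaussian (posSemidef_gibbs hω hγ hθ)]
  rfl

/-- Moments of fixed order are close to those of the Gibbs state at temperature `θ`, if the
temperatures at the sites involved are close to `θ`. -/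
lemma exists_moments_close (n m : ℕ) {TL TR : ℝ} (hω : 0 < ω) (hγ : 0 < γ) (hlam : 0 < lam)
    (hTL : 0 ≤ TL) {ε : ℝ} (hε : 0 < ε) :
    ∃ η > 0, ∃ N₀ : ℕ, ∀ (N : ℕ) (L : Fin n → ℕ) [∀ a, NeZero (L a)], 2 ≤ N → N₀ ≤ N →
      ∀ T : Site N L → ℝ, IsSelfConsistent ω γ lam TL TR T →
        (∀ x, |T x - linearProfile TL TR x.1| ≤ η) ∧
        ∀ θ, 0 ≤ θ → θ ≤ max TL TR → ∀ c : Fin m → Coord N L,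
          (∀ k, |T (siteOf (c k)) - θ| ≤ 3 * η) →
          |∫ z, ∏ k, z (c k) ∂(steadyState ω γ lam T)
            - ∫ z, ∏ k, z (c k) ∂(gibbsState ω γ N L θ)| ≤ ε := by
  set Q := 1 / γ ^ 2 + 1 with hQ
  have hQ0 : 0 < Q := by positivity
  have hmax : 0 ≤ max TL TR := hTL.trans (le_max_left _ _)
  obtain ⟨δ, hδ, hmom⟩ := exists_delta_moments m (max TL TR * Q + 1) hε
  -- The tolerance δ is shared by the distance η from local equilibrium and the temperature mismatch
  -- 3 η, amplified by at most Q. The bound η ≤ 1 pays for the extra 1 in the a priori bound on the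
  -- covariances.
  set η := min 1 (δ / (1 + 3 * Q)) with hη
  have hη0 : 0 < η := by positivity
  have hη1 : η ≤ 1 := min_le_left _ _
  have hη2 : η * (1 + 3 * Q) ≤ δ := by
    rw [← le_div_iff₀ (by positivity)]
    exact min_le_right _ _
  obtain ⟨N₀, h⟩ := exists_limits n TL TR hω hγ hlam hη0
  refine ⟨η, hη0, N₀, fun N L _ hN hN₀ T hT => ?_⟩
  obtain ⟨h1, h2, -⟩ := h N L hN hN₀ T hT
  refine ⟨h1, fun θ hθ hθ' c hc => ?_⟩
  have hΦ := isElastic_potential (N := N) (L := L) hω hγ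
  rw [steadyState, gibbsState, steadyCov_eq hlam hT.nonneg]
  have hE := fun b c => hΦ.abs_equilibrium_apply_le b c
  set E : Matrix (Coord N L) (Coord N L) ℝ := Matrix.fromBlocks (potential ω γ N L)⁻¹ 0 0 1
  set S := cov (potential ω γ N L) lam T
  refine hmom (cov_posSemidef hΦ hlam hT.nonneg) (posSemidef_gibbs hω hγ hθ) c (fun k l => ?_)
    (fun k l => ?_) fun k l => ?_
  · have h3 := h2 (c k) (c l)
    have h4 : |T (siteOf (c k)) * E (c k) (c l)| ≤ max TL TR * Q := by
      rw [abs_mul, abs_of_nonneg (hT.nonneg _)]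
      exact mul_le_mul (hT.bounds hω hγ hlam _).2 (hE _ _) (abs_nonneg _) hmax
    have h5 := abs_add_le (S (c k) (c l) - T (siteOf (c k)) * E (c k) (c l))
      (T (siteOf (c k)) * E (c k) (c l))
    rw [sub_add_cancel] at h5
    linarith
  · rw [Matrix.smul_apply, smul_eq_mul, abs_mul, abs_of_nonneg hθ]
    have := mul_le_mul hθ' (hE (c k) (c l)) (abs_nonneg _) hmax
    linarith
  · have h3 := h2 (c k) (c l)
    have h4 : |(T (siteOf (c k)) - θ) * E (c k) (c l)| ≤ 3 * η * Q := by
      rw [abs_mul]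
      exact mul_le_mul (hc k) (hE _ _) (abs_nonneg _) (by positivity)
    have h5 := abs_add_le (S (c k) (c l) - T (siteOf (c k)) * E (c k) (c l))
      ((T (siteOf (c k)) - θ) * E (c k) (c l))
    rw [Matrix.smul_apply, smul_eq_mul, show S (c k) (c l) - θ * E (c k) (c l)
      = S (c k) (c l) - T (siteOf (c k)) * E (c k) (c l)
        + (T (siteOf (c k)) - θ) * E (c k) (c l) by ring]
    linarith

/-- Convergence of the moments of fixed order to those of local equilibrium. -/
lemma exists_moments_local (n m R : ℕ) {TL TR : ℝ} (hω : 0 < ω) (hγ : 0 < γ) (hlam : 0 < lam)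
    (hTL : 0 ≤ TL) (hTR : 0 ≤ TR) {ε : ℝ} (hε : 0 < ε) :
    ∃ N₀ : ℕ, ∀ (N : ℕ) (L : Fin n → ℕ) [∀ a, NeZero (L a)], 2 ≤ N → N₀ ≤ N →
      ∀ T : Site N L → ℝ, IsSelfConsistent ω γ lam TL TR T →
        ∀ (x : Site N L) (c : Fin m → Coord N L),
          (∀ k, |(((siteOf (c k)).1 : ℕ) : ℤ) - ((x.1 : ℕ) : ℤ)| ≤ R) →
          |∫ z, ∏ k, z (c k) ∂(steadyState ω γ lam T)
            - ∫ z, ∏ k, z (c k) ∂(gibbsState ω γ N L (T x))| ≤ ε ∧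
          |∫ z, ∏ k, z (c k) ∂(steadyState ω γ lam T)
            - ∫ z, ∏ k, z (c k) ∂(gibbsState ω γ N L (linearProfile TL TR x.1))| ≤ ε := by
  obtain ⟨η, hη, N₁, h⟩ := exists_moments_close n m (TR := TR) hω hγ hlam hTL hε
  -- For such N the linear profile varies by at most η over R layers. The mismatch is then 2 η
  -- relative to the linear profile at x and 3 η relative to T x.
  refine ⟨max N₁ (⌈R * |TR - TL| / η⌉₊ + 1), fun N L _ hN hN₀ T hT x c hc => ?_⟩
  obtain ⟨h1, h2⟩ := h N L hN ((le_max_left _ _).trans hN₀) T hT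
  have hM : (0 : ℝ) < (N : ℝ) - 1 := by
    have : (2 : ℝ) ≤ N := by exact_mod_cast hN
    linarith
  have hR : R * |TR - TL| / ((N : ℝ) - 1) ≤ η := by
    have h3 : ((⌈R * |TR - TL| / η⌉₊ + 1 : ℕ) : ℝ) ≤ N := by
      exact_mod_cast (le_max_right _ _).trans hN₀
    have h4 := Nat.le_ceil (R * |TR - TL| / η)
    push_cast at h3
    rw [div_le_comm₀ hM hη]
    linarith
  have hlin : ∀ k, |T (siteOf (c k)) - linearProfile TL TR x.1| ≤ 2 * η := by
    intro k
    have h3 := abs_sub_le (T (siteOf (c k))) (linearProfile TL TR (siteOf (c k)).1)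
      (linearProfile TL TR x.1)
    have h4 := abs_linearProfile_sub_le TL TR hN (hc k)
    linarith [h1 (siteOf (c k))]
  have hmin : 0 ≤ min TL TR := le_min hTL hTR
  refine ⟨h2 (T x) (hT.nonneg x) (hT.bounds hω hγ hlam x).2 c fun k => ?_,
    h2 _ (hmin.trans (linearProfile_mem hN _).1) (linearProfile_mem hN _).2 c fun k => ?_⟩
  · have h3 := abs_sub_le (T (siteOf (c k))) (linearProfile TL TR x.1) (T x)
    have h4 := h1 x
    rw [abs_sub_comm] at h4
    linarith [hlin k]
  · linarith [hlin k]

end Limits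

end Crystal

/-! ### The main theorem -/

open Crystal in
theorem mainTheorem5 (d : ℕ) (hd : 1 ≤ d) (ω γ lam : ℝ) (hω : 0 < ω) (hγ : 0 < γ)
    (hlam : 0 < lam) (TL TR : ℝ) (hTL : 0 ≤ TL) (hTR : 0 ≤ TR) :
    -- the stationary state exists, is unique, and is the Gaussian steady state
    (∀ (N : ℕ) (L : Fin (d - 1) → ℕ) [∀ a, NeZero (L a)], 2 ≤ N →
      ∀ T : Site N L → ℝ, (∀ x, 0 ≤ T x) →
        ∀ μ, IsStationary ω γ lam T μ ↔ μ = steadyState ω γ lam T) ∧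
    -- the self-consistent profile exists, is unique, lies between the boundary temperatures and is
    -- constant in the periodic directions; there is no mean current in the periodic directions,
    -- and the mean current in the first direction is the same through all bonds
    (∀ (N : ℕ) (L : Fin (d - 1) → ℕ) [∀ a, NeZero (L a)], 2 ≤ N →
      (∃! T : Site N L → ℝ, IsSelfConsistent ω γ lam TL TR T) ∧
      ∀ T : Site N L → ℝ, IsSelfConsistent ω γ lam TL TR T →
        (∀ x, min TL TR ≤ T x ∧ T x ≤ max TL TR) ∧
        (∀ x y : Site N L, x.1 = y.1 → T x = T y) ∧
        (∀ (a : Fin (d - 1)) (x : Site N L),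
          Integrable (current ω x (shift a x)) (steadyState ω γ lam T) ∧
          ∫ z, current ω x (shift a x) z ∂(steadyState ω γ lam T) = 0) ∧
        ∃ J : ℝ, ∀ x y : Site N L, (y.1 : ℕ) = (x.1 : ℕ) + 1 → y.2 = x.2 →
          Integrable (current ω x y) (steadyState ω γ lam T) ∧
          ∫ z, current ω x y z ∂(steadyState ω γ lam T) = J) ∧
    -- the temperature profile becomes linear
    (∀ ε : ℝ, 0 < ε → ∃ N₀ : ℕ, ∀ (N : ℕ) (L : Fin (d - 1) → ℕ) [∀ a, NeZero (L a)],
      2 ≤ N → N₀ ≤ N → (∀ a, N₀ ≤ L a) →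
      ∀ T : Site N L → ℝ, IsSelfConsistent ω γ lam TL TR T →
        ∀ x, |T x - linearProfile TL TR x.1| ≤ ε) ∧
    -- local equilibrium, all pair correlations
    (∀ ε : ℝ, 0 < ε → ∃ N₀ : ℕ, ∀ (N : ℕ) (L : Fin (d - 1) → ℕ) [∀ a, NeZero (L a)],
      2 ≤ N → N₀ ≤ N → (∀ a, N₀ ≤ L a) →
      ∀ T : Site N L → ℝ, IsSelfConsistent ω γ lam TL TR T →
        ∀ b c : Coord N L,
          |∫ z, z b * z c ∂(steadyState ω γ lam T)
            - ∫ z, z b * z c ∂(gibbsState ω γ N L (T (siteOf b)))| ≤ ε) ∧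
    -- local equilibrium, correlations of any finite number `m` of coordinates at distance at
    -- most `R` (in the first direction) from a site `x`
    (∀ (m R : ℕ) (ε : ℝ), 0 < ε → ∃ N₀ : ℕ,
      ∀ (N : ℕ) (L : Fin (d - 1) → ℕ) [∀ a, NeZero (L a)],
      2 ≤ N → N₀ ≤ N → (∀ a, N₀ ≤ L a) →
      ∀ T : Site N L → ℝ, IsSelfConsistent ω γ lam TL TR T →
        ∀ (x : Site N L) (c : Fin m → Coord N L),
          (∀ k, |(((siteOf (c k)).1 : ℕ) : ℤ) - ((x.1 : ℕ) : ℤ)| ≤ R) →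
          |∫ z, ∏ k, z (c k) ∂(steadyState ω γ lam T)
            - ∫ z, ∏ k, z (c k) ∂(gibbsState ω γ N L (T x))| ≤ ε ∧
          |∫ z, ∏ k, z (c k) ∂(steadyState ω γ lam T)
            - ∫ z, ∏ k, z (c k) ∂(gibbsState ω γ N L (linearProfile TL TR x.1))| ≤ ε) ∧
    -- Fourier's law
    (∀ ε : ℝ, 0 < ε → ∃ N₀ : ℕ, ∀ (N : ℕ) (L : Fin (d - 1) → ℕ) [∀ a, NeZero (L a)],
      2 ≤ N → N₀ ≤ N → (∀ a, N₀ ≤ L a) →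
      ∀ T : Site N L → ℝ, IsSelfConsistent ω γ lam TL TR T →
        ∀ x y : Site N L, (y.1 : ℕ) = (x.1 : ℕ) + 1 → y.2 = x.2 →
          |((N : ℝ) - 1) * ∫ z, current ω x y z ∂(steadyState ω γ lam T)
            - conductivity ω γ lam (d - 1) * (TL - TR)| ≤ ε) := by
  refine ⟨fun N L _ _ T hT μ => isStationary_iff hω hγ hlam hT μ, fun N L _ hN =>
    ⟨existsUnique_isSelfConsistent hω hγ hlam hTL hTR hN, fun T hT =>
      ⟨fun x => hT.bounds hω hγ hlam x, fun x y hxy => hT.eq_of_layer_eq hω hγ hlam hxy,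
        fun a x => ⟨integrable_current _ _ _, ?_⟩, ?_⟩⟩, fun ε hε => ?_, fun ε hε => ?_,
    fun m R ε hε => ?_, fun ε hε => ?_⟩
  · rw [integral_current hω hγ hlam hT.nonneg, hT.corr_eq_zero hω hγ hlam (x := x) (y := shift a x) rfl,
      mul_zero]
  · obtain ⟨j, hj⟩ := hT.exists_corr_eq hω hγ hlam
    refine ⟨ω ^ 2 * j, fun x y h1 h2 => ⟨integrable_current _ _ _, ?_⟩⟩
    rw [integral_current hω hγ hlam hT.nonneg, hj x y ⟨h1, h2⟩]
  · obtain ⟨N₀, h⟩ := exists_limits (d - 1) TL TR hω hγ hlam hε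
    exact ⟨N₀, fun N L _ hN hN₀ _ T hT => (h N L hN hN₀ T hT).1⟩
  · obtain ⟨N₀, h⟩ := exists_limits (d - 1) TL TR hω hγ hlam hε
    refine ⟨N₀, fun N L _ hN hN₀ _ T hT b c => ?_⟩
    rw [integral_mul_steadyState hω hγ hlam hT.nonneg,
      integral_mul_gibbsState hω hγ (hT.nonneg _)]
    exact (h N L hN hN₀ T hT).2.1 b c
  · obtain ⟨N₀, h⟩ := exists_moments_local (d - 1) m R hω hγ hlam hTL hTR hε
    exact ⟨N₀, fun N L _ hN hN₀ _ T hT => h N L hN hN₀ T hT⟩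
  -- One half of ε pays for replacing the current by its value for infinitely many layers of the
  -- given cross-section, the other for replacing the mean root by its integral.
  · obtain ⟨N₁, h₁⟩ := exists_limits (d - 1) TL TR hω hγ hlam (half_pos hε)
    obtain ⟨N₂, h₂⟩ := exists_meanRoot ω γ lam (d - 1) (TL - TR) (half_pos hε)
    refine ⟨max N₁ N₂, fun N L _ hN hN₀ hL T hT x y hxy hxy' => ?_⟩
    rw [integral_current hω hγ hlam hT.nonneg]
    have h3 := (h₁ N L hN ((le_max_left _ _).trans hN₀) T hT).2.2 x y ⟨hxy, hxy'⟩
    have h4 := h₂ L fun a => (le_max_right _ _).trans (hL a)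
    refine (abs_sub_le _ _ _).trans ((add_le_add h3 h4).trans_eq (add_halves ε))
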